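/- Let $G$ be a simply connected Lie group of dimension $q$ with Lie algebra $\mathfrak g$ (left invariant vector fields), and let $\mathcal F$ be a Lie $G$-foliation with leaves of dimension $p$ on a closed smooth manifold $M$ of dimension $p+q$; that is, $\mathcal F$ is given by a smooth foliated cocycle $\{U_i,f_i\}$ of submersions $f_i$ of open sets $U_i\subset M$ onto open subsets of $G$, whose transition maps are restrictions of left translations of $G$. For a smooth subbundle $\nu\subset TM$ complementary to $T\mathcal F$ and a continuous piecewise smooth path $c:[0,1]\to G$ with $c(0)=e$ and $c(1)=a$, each $x\in M$ is the starting point of a unique continuous piecewise smooth path $\gamma_x$ tangent to $\nu$ that the maps $f_i$ send locally to left translates of $c$. The map $x\mapsto\gamma_x(1)$ is a smooth diffeomorphism of $M$ that maps leaves onto leaves, and its smooth leafwise homotopy class $\Phi_a$ (among the diffeomorphisms that map leaves onto leaves) depends only on $a$; $\Phi$ is the structural transverse action of $G$ on $(M,\mathcal F)$. For a leaf $L$, let $\Phi_a(L)$ be the image of $L$ under any element of $\Phi_a$, and let $L_x$ be the leaf through $x$. For $(x,g)\in M\times G$ put $$M'_{(x,g)}=\bigcup_{a\in G}\Phi_a(L_x)\times\{a^{-1}ga\}.$$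 Then the sets $M'_{(x,g)}$ are the leaves of a $C^\infty$ foliation $\mathcal G$ of codimension $q$ on $M\times G$; more precisely, $M'_{(x,g)}$ is the leaf of $\mathcal G$ through $(x,g)$. Moreover, let $\nu\subset TM$ be any smooth subbundle complementary to $T\mathcal F$. For $X\in\mathfrak g$ let $X^\nu$ be the vector field on $M$ with values in $\nu$ such that $f_{i*}(X^\nu(x))=X(f_i(x))$ for $x\in U_i$, let $\mathcal V$ be the distribution on $M\times G$ whose fibre at $(x,g)$ is spanned by the vectors $\bigl(X^\nu(x),(X-\operatorname{Ad}_{g^{-1}}X)(g)\bigr)$, $X\in\mathfrak g$, let $\mathcal F'$ be the foliation of $M\times G$ with leaves $L\times\{g\}$ ($L$ a leaf of $\mathcal F$, $g\in G$), and put $\mathcal W=\mathcal V+T\mathcal F'$. Then $\mathcal W$ is a smooth subbundle of rank $p+q$ of $T(M\times G)$, it is integrable (the Lie bracket of two local smooth sections of $\mathcal W$ is a section of $\mathcal W$), and $T\mathcal G=\mathcal W$. -/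

import Mathlib

open Set Filter Topology Manifold
open scoped ContDiff Bundle

/-! ### Smooth foliations, given by foliated cocycles -/

section Foliations

variable {E : Type*} [NormedAddCommGroup E] [NormedSpace ℝ E]
  {H : Type*} [TopologicalSpace H] (I : ModelWithCorners ℝ E H)
  (N : Type*) [TopologicalSpace N] [ChartedSpace H N]

/-- A member `(U, f)` of a smooth foliated cocycle on `N`, of leaf dimension `p` and codimension
`q`: a smooth submersion `f` of the open set `U` onto an open subset of the `q`-manifold `T`, all
of whose (nonempty) fibres are homeomorphic to connected open subsets of `ℝ^p`.
The values of `map` outside `dom` are irrelevant. -/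
structure FoliatedChart (p q : ℕ) (T : Type*) [TopologicalSpace T]
    [ChartedSpace (EuclideanSpace ℝ (Fin q)) T] where
  /-- The open set `U`. -/
  dom : Set N
  /-- The submersion `f`. -/
  map : N → T
  isOpen_dom : IsOpen dom
  isSubmersionAt : ∀ x ∈ dom, Manifold.IsSubmersionAt I (𝓡 q) ∞ map x
  fibre : ∀ t ∈ map '' dom, ∃ V : Set (EuclideanSpace ℝ (Fin p)), IsOpen V ∧ IsConnected V ∧
    Nonempty ((dom ∩ map ⁻¹' {t} : Set N) ≃ₜ V)

/-- A smooth foliation of `N` with leaves of dimension `p` and codimension `q`, described by a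
smooth foliated cocycle with values in (open subsets of) the `q`-manifold `T`. -/
structure SmoothFoliation (p q : ℕ) (T : Type*) [TopologicalSpace T]
    [ChartedSpace (EuclideanSpace ℝ (Fin q)) T] where
  /-- The members of the cocycle. -/
  cocycle : Set (FoliatedChart I N p q T)
  cover : ∀ x : N, ∃ u ∈ cocycle, x ∈ u.dom
  compatible : ∀ u ∈ cocycle, ∀ v ∈ cocycle, ∀ x ∈ u.dom ∩ v.dom,
    ∃ O : Set N, IsOpen O ∧ x ∈ O ∧ O ⊆ u.dom ∩ v.dom ∧
      ∃ h : OpenPartialHomeomorph T T, h.source = u.map '' O ∧ h.target = v.map '' O ∧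
        ∀ y ∈ O, v.map y = h (u.map y)

namespace SmoothFoliation

variable {I N}
variable {p q : ℕ} {T : Type*} [TopologicalSpace T] [ChartedSpace (EuclideanSpace ℝ (Fin q)) T]
  (F : SmoothFoliation I N p q T)

/-- The leaf topology: it is generated by the open sets of the fibres of the submersions. -/
@[reducible] def leafTopology : TopologicalSpace N :=
  TopologicalSpace.generateFrom
    {S | ∃ u ∈ F.cocycle, ∃ t : T, ∃ O : Set N, IsOpen O ∧ S = O ∩ (u.dom ∩ u.map ⁻¹' {t})}

/-- The leaf through `x`: the connected component of `x` for the leaf topology. -/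
def leaf (x : N) : Set N := @connectedComponent N F.leafTopology x

/-- The tangent space of the foliation at `x`: the vectors tangent to the fibres of the
submersions of the cocycle. -/
def tangent (x : N) : Submodule ℝ (TangentSpace I x) where
  carrier := {v | ∀ u ∈ F.cocycle, x ∈ u.dom → mfderiv I (𝓡 q) u.map x v = 0}
  add_mem' := fun {v w} hv hw u hu hx => by rw [map_add, hv u hu hx, hw u hu hx, add_zero]
  zero_mem' := fun u _ _ => map_zero _
  smul_mem' := fun a v hv u hu hx => by rw [map_smul, hv u hu hx, smul_zero]

/-- Smooth foliated diffeomorphisms: each leaf is mapped onto a leaf. -/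
def IsFoliatedDiffeo (f : Diffeomorph I I N N ∞) : Prop :=
  ∀ x, f '' F.leaf x = F.leaf (f x)

/-- Two maps are smoothly leafwise homotopic: there is a smooth homotopy `N × [0,1] → N` between
them whose paths lie in leaves. -/
def LeafwiseHomotopic (f f' : N → N) : Prop :=
  ∃ K : N × unitInterval → N, ContMDiff (I.prod (𝓡∂ 1)) I ∞ K ∧
    (∀ x, K (x, 0) = f x) ∧ (∀ x, K (x, 1) = f' x) ∧
    ∀ x t, K (x, t) ∈ F.leaf (K (x, 0))

end SmoothFoliation

/-! ### Distributions -/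

variable {I N} [IsManifold I ∞ N]

/-- `D` is a smooth vector subbundle of rank `r` of the tangent bundle: it is locally spanned by
`r` smooth vector fields that are linearly independent at every point. -/
def IsSmoothSubbundle (r : ℕ) (D : ∀ x : N, Submodule ℝ (TangentSpace I x)) : Prop :=
  ∀ x : N, ∃ O : Set N, IsOpen O ∧ x ∈ O ∧ ∃ s : Fin r → ∀ y : N, TangentSpace I y,
    (∀ i, ContMDiffOn I I.tangent ∞ (fun y => (⟨y, s i y⟩ : TangentBundle I N)) O) ∧
    ∀ y ∈ O, LinearIndependent ℝ (fun i => s i y) ∧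
      Submodule.span ℝ (range fun i => s i y) = D y

/-- `D` is involutive: the Lie bracket of two (local) smooth vector fields with values in `D` has
its values in `D`. -/
def IsInvolutive (D : ∀ x : N, Submodule ℝ (TangentSpace I x)) : Prop :=
  ∀ O : Set N, IsOpen O → ∀ Y Z : ∀ x : N, TangentSpace I x,
    ContMDiffOn I I.tangent ∞ (fun y => (⟨y, Y y⟩ : TangentBundle I N)) O →
    ContMDiffOn I I.tangent ∞ (fun y => (⟨y, Z y⟩ : TangentBundle I N)) O →
    (∀ y ∈ O, Y y ∈ D y) → (∀ y ∈ O, Z y ∈ D y) →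
    ∀ y ∈ O, VectorField.mlieBracket I Y Z y ∈ D y

variable (I)

/-- `γ`, restricted to `[0,1]`, is a continuous path that is smooth (up to the end points) on
every closed subinterval of `[0,1]` without points of `P` in its interior. -/
def IsPiecewiseSmoothPath (P : Finset ℝ) (γ : ℝ → N) : Prop :=
  ContinuousOn γ (Icc 0 1) ∧
  ∀ a b : ℝ, a < b → Icc a b ⊆ Icc 0 1 → (∀ t ∈ P, t ∉ Ioo a b) →
    ContMDiffOn 𝓘(ℝ, ℝ) I ∞ γ (Icc a b)

end Foliations

/-! ### Lie foliations and their structural transverse action -/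

section LieFoliations

variable {p q : ℕ}
  {M : Type*} [TopologicalSpace M] [ChartedSpace (EuclideanSpace ℝ (Fin (p + q))) M]
  [IsManifold (𝓡 (p + q)) ∞ M]
  {G : Type*} [TopologicalSpace G] [ChartedSpace (EuclideanSpace ℝ (Fin q)) G] [Group G]

namespace SmoothFoliation

variable (F : SmoothFoliation (𝓡 (p + q)) M p q G)

/-- The cocycle, whose submersions take values in the Lie group `G`, is a transverse Lie structure
(a transverse `(G,G)`-structure): its transition maps are restrictions of left translations. -/
def IsLie : Prop :=
  ∀ u ∈ F.cocycle, ∀ v ∈ F.cocycle, ∀ x ∈ u.dom ∩ v.dom,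
    ∃ O : Set M, IsOpen O ∧ x ∈ O ∧ O ⊆ u.dom ∩ v.dom ∧ ∃ g : G, ∀ y ∈ O, v.map y = g * u.map y

/-- `ν` is a smooth vector subbundle of `TM` complementary to the tangent bundle of `F`. -/
def IsComplement (ν : ∀ x : M, Submodule ℝ (TangentSpace (𝓡 (p + q)) x)) : Prop :=
  IsSmoothSubbundle q ν ∧ ∀ x, IsCompl (ν x) (F.tangent x)

/-- `γ` is the `ν`-horizontal lift to `M`, starting at `x`, of the path `c` in `G`: it is piecewise
smooth, tangent to `ν`, and the submersions of the cocycle map it locally to left translates of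
`c`. The last condition says that a lift `γ'` of `γ` to a covering of `M` on which the local
submersions are left translates of a global developing map `D` satisfies
`D (γ' t) = D (γ' 0) * c t` (when `c 0 = 1`). -/
def IsHorizontalLift (ν : ∀ x : M, Submodule ℝ (TangentSpace (𝓡 (p + q)) x))
    (c : ℝ → G) (x : M) (γ : ℝ → M) : Prop :=
  γ 0 = x ∧
  (∃ P : Finset ℝ, IsPiecewiseSmoothPath (𝓡 (p + q)) P γ ∧
    ∀ t ∈ Ioo (0 : ℝ) 1, t ∉ P →
      (mfderiv 𝓘(ℝ, ℝ) (𝓡 (p + q)) γ t (1 : ℝ) : TangentSpace (𝓡 (p + q)) (γ t)) ∈ ν (γ t)) ∧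
  ∀ t₀ ∈ Icc (0 : ℝ) 1, ∀ u ∈ F.cocycle, γ t₀ ∈ u.dom →
    ∃ h : G, ∀ᶠ t in 𝓝[Icc 0 1] t₀, u.map (γ t) = h * c t

/-- `φ` is the smooth foliated diffeomorphism of `M` obtained by moving each point `x` to the end
point of the `ν`-horizontal lift starting at `x` of the path `c`. -/
def IsTransport (ν : ∀ x : M, Submodule ℝ (TangentSpace (𝓡 (p + q)) x)) (c : ℝ → G)
    (φ : Diffeomorph (𝓡 (p + q)) (𝓡 (p + q)) M M ∞) : Prop :=
  F.IsFoliatedDiffeo φ ∧ ∀ x, ∃ γ : ℝ → M, F.IsHorizontalLift ν c x γ ∧ γ 1 = φ x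

/-- The value `Φ_g` at `g` of the structural transverse action of a Lie foliation, as a set of
smooth foliated diffeomorphisms: the smooth leafwise homotopy class of the transport along the
`ν`-horizontal lifts of a piecewise smooth path `c` from the identity to `g`. -/
def structuralAction (g : G) : Set (Diffeomorph (𝓡 (p + q)) (𝓡 (p + q)) M M ∞) :=
  {f | F.IsFoliatedDiffeo f ∧
    ∃ ν : ∀ x : M, Submodule ℝ (TangentSpace (𝓡 (p + q)) x), F.IsComplement ν ∧
    ∃ c : ℝ → G, (∃ P, IsPiecewiseSmoothPath (𝓡 q) P c) ∧ c 0 = 1 ∧ c 1 = g ∧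
    ∃ φ, F.IsTransport ν c φ ∧ F.LeafwiseHomotopic φ f}

/-- The leaf `Φ_g(L)`, the common image of the leaf `L` under the elements of the class `Φ_g`. -/
def structuralImage (g : G) (L : Set M) : Set M :=
  ⋃ φ ∈ F.structuralAction g, φ '' L

/-- `M'_{(x,g)} = ⋃_{a ∈ G} Φ_a(L_x) × {a⁻¹ g a}`. -/
def orbitSet (x : M) (g : G) : Set (M × G) :=
  ⋃ a : G, F.structuralImage a (F.leaf x) ×ˢ {a⁻¹ * g * a}

end SmoothFoliation

/-- The adjoint representation: `Ad g` is the derivative at the identity of `h ↦ g h g⁻¹`, whose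
value at the identity is the identity. -/
noncomputable def groupAd (g : G) (X : GroupLieAlgebra (𝓡 q) G) : GroupLieAlgebra (𝓡 q) G :=
  (mfderiv (𝓡 q) (𝓡 q) (fun h : G => g * h * g⁻¹) 1 X : EuclideanSpace ℝ (Fin q))

namespace SmoothFoliation

variable (F : SmoothFoliation (𝓡 (p + q)) M p q G)

/-- `v` is the value at `x` of `X^ν`, the vector field with values in `ν` whose images under the
submersions of the cocycle are given by the left invariant field `X`. -/
def IsTransverseLiftAt (ν : ∀ x : M, Submodule ℝ (TangentSpace (𝓡 (p + q)) x))
    (X : GroupLieAlgebra (𝓡 q) G) (x : M) (v : TangentSpace (𝓡 (p + q)) x) : Prop :=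
  v ∈ ν x ∧ ∀ u ∈ F.cocycle, x ∈ u.dom →
    mfderiv (𝓡 (p + q)) (𝓡 q) u.map x v = mulInvariantVectorField X (u.map x)

/-- The tangent vector `(v, w)` of `M × G`, for the identification
`T_{(x,g)}(M × G) = T_x M ⊕ T_g G`. -/
noncomputable def pairVector (z : M × G) (v : TangentSpace (𝓡 (p + q)) z.1) (w : TangentSpace (𝓡 q) z.2) :
    TangentSpace ((𝓡 (p + q)).prod (𝓡 q)) z :=
  ((v, w) : EuclideanSpace ℝ (Fin (p + q)) × EuclideanSpace ℝ (Fin q))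

/-- The distribution `V` on `M × G` spanned by the vectors `(X^ν, X - Ad_{g⁻¹} X)`. -/
noncomputable def distV (ν : ∀ x : M, Submodule ℝ (TangentSpace (𝓡 (p + q)) x)) (z : M × G) :
    Submodule ℝ (TangentSpace ((𝓡 (p + q)).prod (𝓡 q)) z) :=
  Submodule.span ℝ {ξ | ∃ (X : GroupLieAlgebra (𝓡 q) G) (v : TangentSpace (𝓡 (p + q)) z.1),
    F.IsTransverseLiftAt ν X z.1 v ∧
    ξ = pairVector z v (mulInvariantVectorField (X - groupAd z.2⁻¹ X) z.2)}

/-- The tangent distribution of the foliation `F'` of `M × G` with leaves `L × {g}`: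
the vectors `(v, 0)` with `v` tangent to `F`. -/
noncomputable def tangentF' (z : M × G) : Submodule ℝ (TangentSpace ((𝓡 (p + q)).prod (𝓡 q)) z) :=
  Submodule.span ℝ {ξ | ∃ v ∈ F.tangent z.1, ξ = pairVector z v 0}

/-- The distribution `W = V + TF'` on `M × G`. -/
noncomputable def distW (ν : ∀ x : M, Submodule ℝ (TangentSpace (𝓡 (p + q)) x)) (z : M × G) :
    Submodule ℝ (TangentSpace ((𝓡 (p + q)).prod (𝓡 q)) z) :=
  F.distV ν z ⊔ F.tangentF' z

end SmoothFoliation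

end LieFoliations

/-! A Lie foliation is given locally by submersions `f` into `G` that are determined up to left
translation. Replacing `f` by `h * f` conjugates the value of `(x, g) ↦ f x * g * (f x)⁻¹`
(`conjAlong f`) by `h`. Followed by charts of `G`, these maps therefore form a foliated cocycle on
`M × G`, and its foliation, `IsLie.conjFoliation`, is the one required.

Orbits lie in leaves: a horizontal lift `γ` of `c` satisfies `f (γ t) = b * c t` locally, so
`conjAlong f` takes the constant value `b * g * b⁻¹` along `t ↦ (γ t, (c t)⁻¹ * g * c t)`. Leaves
lie in orbits (`IsLie.leaf_conjFoliation`): for one well-chosen complement, the set of points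
reached from `(x, g)` by transports and by moves in leaves of `F` is open and closed for the leaf
topology. This needs enough short transports (`IsLie.exists_small_transports`). They are the
time-one maps of transverse lifts of small left invariant fields `X`. The map sending `X` to the
value of `f` at the end of the flow line from `x₀` has differential `X ↦ X (f x₀)` at `0`, hence is
open there, and every plaque near `x₀` is reached. The smoothness of the flow in `X` comes from the
implicit function theorem in a Banach space of continuous paths.

The tangent space of the new foliation is the kernel of the derivative of `conjAlong f`. The
derivative of `h ↦ h * g * h⁻¹` at the identity is `X ↦ -(X - Ad_{g⁻¹} X)(g)`, so this kernel
contains `W`. It meets the vectors `(0, w)` only in zero, because conjugations are diffeomorphisms,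
and this forces equality with `W` (`IsLie.tangent_conjFoliation`). Smoothness, rank and involutivity
of `W` are then properties of the kernel of a submersion. -/

/-! ### Smoothness of composition operators on spaces of continuous maps. -/

section Nemytskii

universe u

variable {K : Type*} [TopologicalSpace K] [CompactSpace K]
  {E : Type u} [NormedAddCommGroup E] [NormedSpace ℝ E]
  {F : Type u} [NormedAddCommGroup F] [NormedSpace ℝ F]

/-- The bilinear operation on continuous maps defined pointwise by a continuous bilinear map. -/
noncomputable def ContinuousMap.pointwiseBilin {A : Type*} [NormedAddCommGroup A] [NormedSpace ℝ A]
    (L : A →L[ℝ] E →L[ℝ] F) : C(K, A) →L[ℝ] C(K, E) →L[ℝ] C(K, F) :=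
  LinearMap.mkContinuous₂
    (LinearMap.mk₂ ℝ
      (fun (a : C(K, A)) (u : C(K, E)) =>
        (⟨fun k => L (a k) (u k),
          (L.continuous.comp a.continuous).clm_apply u.continuous⟩ : C(K, F)))
      (fun a b u => by ext; simp) (fun c a u => by ext; simp)
      (fun a u v => by ext; simp) (fun c a u => by ext; simp)) ‖L‖
    (fun a u => by
      rw [ContinuousMap.norm_le _ (by positivity)]
      intro k
      refine (L.le_opNorm₂ _ _).trans ?_
      gcongr
      · exact a.norm_coe_le_norm k
      · exact u.norm_coe_le_norm k)

-- Composition with `g` is continuous on `C(K, E)`. This gives a modulus of continuity of `g` that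
-- is uniform along the compact image of `u`, even when `E` is infinite-dimensional.
omit [NormedSpace ℝ E] in
lemma ContinuousMap.exists_forall_dist_comp_le {A : Type*} [NormedAddCommGroup A]
    (g : C(E, A)) (u : C(K, E)) {c : ℝ} (hc : 0 < c) :
    ∃ δ > 0, ∀ w : C(K, E), dist w u < δ → ∀ k, dist (g (w k)) (g (u k)) ≤ c := by
  have hcont : Continuous (fun u : C(K, E) => g.comp u) := ContinuousMap.continuous_postcomp _
  obtain ⟨δ, hδ, H⟩ := Metric.continuousAt_iff.1 (hcont.continuousAt (x := u)) c hc
  exact ⟨δ, hδ, fun w hw k =>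
    (ContinuousMap.dist_apply_le_dist (f := g.comp w) (g := g.comp u) k).trans (H hw).le⟩

/-- At each `k` the remainder is bounded by the mean value inequality on a ball around `u k`; the
radius can be chosen independently of `k`. -/
lemma ContinuousMap.hasFDerivAt_postcomp (f : C(E, F)) (f' : C(E, E →L[ℝ] F))
    (hf : ∀ x, HasFDerivAt f (f' x) x) (u : C(K, E)) :
    HasFDerivAt (fun u : C(K, E) => f.comp u)
      (ContinuousMap.pointwiseBilin (ContinuousLinearMap.id ℝ (E →L[ℝ] F)) (f'.comp u)) u := by
  rw [hasFDerivAt_iff_isLittleO_nhds_zero, Asymptotics.isLittleO_iff]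
  intro c hc
  obtain ⟨δ, hδ, H⟩ := ContinuousMap.exists_forall_dist_comp_le f' u hc
  filter_upwards [Metric.ball_mem_nhds (0 : C(K, E)) hδ] with h hh
  rw [ContinuousMap.norm_le _ (by positivity)]
  intro k
  have hmv := (convex_ball (u k) δ).norm_image_sub_le_of_norm_hasFDerivWithin_le'
    (f := f) (f' := f') (φ := f' (u k)) (C := c) (x := u k) (y := u k + h k)
    (fun x _ => (hf x).hasFDerivWithinAt) ?_
    (Metric.mem_ball_self hδ) ?_
  · have h1 : ‖h k‖ ≤ ‖h‖ := h.norm_coe_le_norm k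
    have h2 : c * ‖u k + h k - u k‖ ≤ c * ‖h‖ := by
      rw [add_sub_cancel_left]; gcongr
    refine le_trans (le_of_eq ?_) (hmv.trans h2)
    rw [add_sub_cancel_left]
    rfl
  · intro y hy
    -- A point of the ball becomes a value of a map uniformly close to `u`: translate `u` by a
    -- constant.
    let w : C(K, E) := u + ContinuousMap.const K (y - u k)
    have hw : dist w u < δ := by
      rw [dist_eq_norm]
      simp only [w, add_sub_cancel_left]
      refine lt_of_le_of_lt (b := ‖y - u k‖) ?_ (by simpa [dist_eq_norm] using hy)
      rw [ContinuousMap.norm_le _ (norm_nonneg _)]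
      intro _; rfl
    have := H w hw k
    simpa [w, dist_eq_norm] using this
  · rw [Metric.mem_ball, dist_eq_norm, add_sub_cancel_left]
    exact lt_of_le_of_lt (h.norm_coe_le_norm k) (by simpa using hh)

-- The derivative is the composition operator of `fderiv ℝ f` followed by a fixed continuous linear
-- map, so the induction must range over all targets `F`. The common universe of `E` and `F` also
-- contains `E →L[ℝ] F`.
set_option synthInstance.maxHeartbeats 200000 in
lemma ContinuousMap.contDiff_postcomp_nat (n : ℕ) : ∀ {F : Type u} [NormedAddCommGroup F]
    [NormedSpace ℝ F] (f : C(E, F)) (_ : ContDiff ℝ n f),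
    ContDiff ℝ n (fun u : C(K, E) => f.comp u) := by
  induction n with
  | zero =>
    intro F _ _ f hf
    exact contDiff_zero.2 (ContinuousMap.continuous_postcomp _)
  | succ n ih =>
    intro F _ _ f hf
    have h1 : ContDiff ℝ 1 f := hf.of_le (by exact_mod_cast Nat.le_add_left 1 n)
    rw [Nat.cast_add, Nat.cast_one] at hf ⊢
    have hd : ContDiff ℝ n (fderiv ℝ f) := (contDiff_succ_iff_fderiv.1 hf).2.2
    refine contDiff_succ_iff_hasFDerivAt.2 ?_
    let f' : C(E, E →L[ℝ] F) := ⟨fderiv ℝ f, hd.continuous⟩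
    refine ⟨fun u => ContinuousMap.pointwiseBilin (ContinuousLinearMap.id ℝ (E →L[ℝ] F))
      (f'.comp u), ?_, fun u => ContinuousMap.hasFDerivAt_postcomp f f'
        (fun x => (h1.differentiable one_ne_zero x).hasFDerivAt) u⟩
    exact (ContinuousLinearMap.contDiff _).comp (ih f' hd)

/-- The Nemytskii operator of a smooth map is smooth. -/
lemma ContinuousMap.contDiff_postcomp (f : C(E, F)) (hf : ContDiff ℝ ∞ f) :
    ContDiff ℝ ∞ (fun u : C(K, E) => f.comp u) :=
  contDiff_infty.2 fun n => ContinuousMap.contDiff_postcomp_nat n f (contDiff_infty.1 hf n)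

end Nemytskii

/-! ### Implicit functions that are smooth on a neighbourhood. -/

section Implicit

variable {E₁ E₂ F : Type*} [NormedAddCommGroup E₁] [NormedSpace ℝ E₁] [CompleteSpace E₁]
  [NormedAddCommGroup E₂] [NormedSpace ℝ E₂] [CompleteSpace E₂]
  [NormedAddCommGroup F] [NormedSpace ℝ F] [CompleteSpace F]

/-- A smooth equation has smooth implicit solutions near a point (and not just at it). -/
lemma exists_eventually_contDiffAt_implicit {f : E₁ × E₂ → F} (hf : ContDiff ℝ ∞ f) (u : E₁ × E₂)
    (hu : (fderiv ℝ f u ∘L .inr ℝ E₁ E₂).IsInvertible) :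
    ∃ ψ : E₁ → E₂, ψ u.1 = u.2 ∧ ∀ᶠ x in 𝓝 u.1, ContDiffAt ℝ ∞ ψ x ∧ f (x, ψ x) = f u := by
  have hn : (∞ : WithTop ℕ∞) ≠ 0 := by simp
  have cdf : ContDiffAt ℝ ∞ f u := hf.contDiffAt
  set ψ := cdf.implicitFunction hn hu with hψ
  have hψu : ψ u.1 = u.2 := cdf.implicitFunction_apply_self hn hu
  have hsm : ContDiffAt ℝ ∞ ψ u.1 := cdf.contDiffAt_implicitFunction hn hu
  have hcont : ∀ᶠ x in 𝓝 u.1, ContinuousAt ψ x := by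
    have h1 : ContDiffAt ℝ 1 ψ u.1 := hsm.of_le (by simp)
    filter_upwards [h1.eventually (by simp)] with x hx using hx.continuousAt
  have heq : ∀ᶠ x in 𝓝 u.1, f (x, ψ x) = f u := cdf.eventually_apply_implicitFunction hn hu
  -- Invertible operators form an open set, so the implicit function theorem also applies at the
  -- nearby solutions `(x, ψ x)`.
  have hinv : ∀ᶠ x in 𝓝 u.1, (fderiv ℝ f (x, ψ x) ∘L .inr ℝ E₁ E₂).IsInvertible := by
    have hc : ContinuousAt (fun x => fderiv ℝ f (x, ψ x) ∘L .inr ℝ E₁ E₂) u.1 := by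
      have h1 : ContinuousAt (fun x => fderiv ℝ f (x, ψ x)) u.1 :=
        (hf.continuous_fderiv hn).continuousAt.comp
          (f := fun x => (x, ψ x)) (continuousAt_id.prodMk hsm.continuousAt)
      exact h1.clm_comp continuousAt_const
    obtain ⟨e, he⟩ := hu
    have hmem : fderiv ℝ f (u.1, ψ u.1) ∘L .inr ℝ E₁ E₂ ∈
        range ((↑) : (E₂ ≃L[ℝ] F) → E₂ →L[ℝ] F) := ⟨e, by rw [he, hψu]⟩
    filter_upwards [hc (ContinuousLinearEquiv.isOpen.mem_nhds hmem)] with x hx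
    exact hx
  refine ⟨ψ, hψu, ?_⟩
  filter_upwards [hcont, heq, heq.eventually_nhds, hinv] with x hx hfx hfx' hix
  refine ⟨?_, hfx⟩
  have cdfx : ContDiffAt ℝ ∞ f (x, ψ x) := hf.contDiffAt
  -- The implicit function based at `(x, ψ x)` is smooth at `x`; local uniqueness identifies it with
  -- `ψ` near `x`.
  have huniq := cdfx.eventually_apply_eq_iff_implicitFunction hn hix
  have hev : ∀ᶠ y in 𝓝 x, f (y, ψ y) = f (x, ψ x) ↔
      cdfx.implicitFunction hn hix y = ψ y :=
    (show ContinuousAt (fun y => (y, ψ y)) x from continuousAt_id.prodMk hx).eventually huniq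
  refine (cdfx.contDiffAt_implicitFunction hn hix).congr_of_eventuallyEq ?_
  filter_upwards [hev, hfx'] with y h1 h2
  exact (h1.1 (h2.trans hfx.symm)).symm

end Implicit

/-! ### Local flows as implicit functions in a space of paths. -/

section LocalFlow

universe u

variable {E : Type u} [NormedAddCommGroup E] [NormedSpace ℝ E]

/-- The primitive vanishing at `0`, as an operator on continuous functions on `[-2,2]`. -/
noncomputable def primitiveL [CompleteSpace E] :
    C(Icc (-2 : ℝ) 2, E) →L[ℝ] C(Icc (-2 : ℝ) 2, E) :=
  LinearMap.mkContinuous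
    { toFun := fun u => ⟨fun t => ∫ s in (0 : ℝ)..t, u (projIcc (-2) 2 (by norm_num) s), by
        have hu : Continuous fun s : ℝ => u (projIcc (-2 : ℝ) 2 (by norm_num) s) :=
          u.continuous.comp continuous_projIcc
        exact (intervalIntegral.continuous_primitive
          (fun a b => hu.intervalIntegrable a b) 0).comp continuous_subtype_val⟩
      map_add' := fun u v => by
        ext t
        have hc : ∀ u : C(Icc (-2 : ℝ) 2, E), Continuous fun s : ℝ =>
          u (projIcc (-2 : ℝ) 2 (by norm_num) s) := fun u => u.continuous.comp continuous_projIcc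
        exact intervalIntegral.integral_add ((hc u).intervalIntegrable _ _)
          ((hc v).intervalIntegrable _ _)
      map_smul' := fun c u => by
        ext t
        exact intervalIntegral.integral_smul _ _ } 2
    (fun u => by
      rw [ContinuousMap.norm_le _ (by positivity)]
      intro t
      have h := intervalIntegral.norm_integral_le_of_norm_le_const
        (a := 0) (b := (t : ℝ)) (C := ‖u‖) (f := fun s => u (projIcc (-2 : ℝ) 2 (by norm_num) s))
        (fun s _ => u.norm_coe_le_norm _)
      refine h.trans ?_
      rw [mul_comm]
      gcongr
      rw [sub_zero]
      exact abs_le.2 t.2)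

lemma primitiveL_apply [CompleteSpace E] (u : C(Icc (-2 : ℝ) 2, E)) (t : Icc (-2 : ℝ) 2) :
    primitiveL u t = ∫ s in (0 : ℝ)..t, u (projIcc (-2) 2 (by norm_num) s) := rfl

variable {P : Type u} [NormedAddCommGroup P] [NormedSpace ℝ P]

/-- Smooth dependence on initial values and parameters, near a parameter value for which the
vector field vanishes. -/
theorem exists_smooth_localFlow [CompleteSpace E] [CompleteSpace P] {V : E × P → E}
    (hV : ContDiff ℝ ∞ V) (h0 : ∀ x, V (x, 0) = 0) (x₀ : E) :
    ∃ S : E × P → C(Icc (-2 : ℝ) 2, E), S (x₀, 0) = ContinuousMap.const _ x₀ ∧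
      ∀ᶠ z in 𝓝 (x₀, (0 : P)), ContDiffAt ℝ ∞ S z ∧
        S z (projIcc (-2) 2 (by norm_num) 0) = z.1 ∧
        ∀ t ∈ Ioo (-2 : ℝ) 2, HasDerivAt (fun t => S z (projIcc (-2) 2 (by norm_num) t))
          (V (S z (projIcc (-2) 2 (by norm_num) t), z.2)) t := by
  let K := Icc (-2 : ℝ) 2
  let Vc : C(E × P, E) := ⟨V, hV.continuous⟩
  -- constants and pairing as continuous linear maps
  let cE : E →L[ℝ] C(K, E) := ContinuousLinearMap.const ℝ K
  let inE : C(K, E) →L[ℝ] C(K, E × P) :=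
    (ContinuousLinearMap.inl ℝ E P).compLeftContinuous ℝ K
  let inP : P →L[ℝ] C(K, E × P) :=
    ((ContinuousLinearMap.inr ℝ E P).compLeftContinuous ℝ K).comp (ContinuousLinearMap.const ℝ K)
  let pair : (E × P) × C(K, E) →L[ℝ] C(K, E × P) :=
    (inP.comp (ContinuousLinearMap.snd ℝ E P)).coprod inE
  have pair_apply : ∀ z k, pair z k = (z.2 k, z.1.2) := by
    intro z k
    simp [pair, inP, inE]
  -- A zero of `Φ` at initial value `x` and parameter `λ` is a solution of `u t = x + ∫₀ᵗ V (u s, λ)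
  -- ds`, so the flow is an implicit function. The interval `[-2, 2]` keeps the time `1` in its
  -- interior.
  let Φ : (E × P) × C(K, E) → C(K, E) := fun z =>
    z.2 - cE z.1.1 - primitiveL (Vc.comp (pair z))
  have hΦ : ContDiff ℝ ∞ Φ := by
    have h1 : ContDiff ℝ ∞ (fun z => Vc.comp (pair z)) :=
      (ContinuousMap.contDiff_postcomp Vc hV).comp pair.contDiff
    have h2 : ContDiff ℝ ∞ (fun z : (E × P) × C(K, E) => cE z.1.1) :=
      cE.contDiff.comp (contDiff_fst.comp contDiff_fst)
    have h3 : ContDiff ℝ ∞ (fun z => primitiveL (Vc.comp (pair z))) :=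
      (primitiveL (E := E)).contDiff.comp h1
    exact (contDiff_snd.sub h2).sub h3
  let u₀ : (E × P) × C(K, E) := ((x₀, 0), ContinuousMap.const _ x₀)
  have hΦ0 : ∀ v : C(K, E), Φ ((x₀, 0), v) = v - cE x₀ := by
    intro v
    have : Vc.comp (pair ((x₀, (0 : P)), v)) = 0 := by
      ext k; simp [Vc, pair_apply, h0]
    simp [Φ, this]
  -- At parameter `0` the integral term vanishes and the partial derivative is the identity. No
  -- shortening of the time interval is needed.
  have hinv : (fderiv ℝ Φ u₀ ∘L .inr ℝ (E × P) C(K, E)).IsInvertible := by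
    have h1 : HasFDerivAt (fun v : C(K, E) => Φ ((x₀, 0), v))
        (fderiv ℝ Φ u₀ ∘L .inr ℝ (E × P) C(K, E)) (ContinuousMap.const _ x₀) := by
      have ha : HasFDerivAt Φ (fderiv ℝ Φ u₀) u₀ :=
        (hΦ.differentiable (by simp) u₀).hasFDerivAt
      exact ha.comp (ContinuousMap.const _ x₀ : C(K, E)) (hasFDerivAt_prodMk_right (x₀, (0 : P)) _)
    have h2 : HasFDerivAt (fun v : C(K, E) => Φ ((x₀, 0), v))
        (ContinuousLinearMap.id ℝ C(K, E)) (ContinuousMap.const _ x₀) := by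
      simp_rw [hΦ0]
      exact (hasFDerivAt_id _).sub_const _
    rw [h1.unique h2]
    exact ⟨ContinuousLinearEquiv.refl ℝ _, rfl⟩
  obtain ⟨S, hS0, hS⟩ := exists_eventually_contDiffAt_implicit hΦ u₀ hinv
  refine ⟨S, hS0, ?_⟩
  have hΦu : Φ u₀ = 0 := by
    rw [hΦ0]; ext; simp [cE]
  filter_upwards [hS] with z ⟨hz, hzΦ⟩
  rw [hΦu] at hzΦ
  have hsol : ∀ t : K, S z t = z.1 + ∫ s in (0 : ℝ)..t,
      V (S z (projIcc (-2) 2 (by norm_num) s), z.2) := by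
    intro t
    have := congrArg (fun w : C(K, E) => w t) hzΦ
    simp only [Φ, ContinuousMap.sub_apply, ContinuousMap.zero_apply] at this
    rw [sub_sub, sub_eq_zero] at this
    rw [this, primitiveL_apply]
    simp [cE, Vc, pair_apply]
  refine ⟨hz, ?_, fun t ht => ?_⟩
  · rw [hsol, projIcc_of_mem (by norm_num) (by norm_num : (0 : ℝ) ∈ Icc (-2 : ℝ) 2)]
    simp
  · have hc : Continuous fun s : ℝ => V (S z (projIcc (-2) 2 (by norm_num) s), z.2) :=
      hV.continuous.comp (((S z).continuous.comp continuous_projIcc).prodMk continuous_const)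
    have hd : HasDerivAt (fun t : ℝ => z.1 + ∫ s in (0 : ℝ)..t,
        V (S z (projIcc (-2) 2 (by norm_num) s), z.2))
        (V (S z (projIcc (-2) 2 (by norm_num) t), z.2)) t :=
      (intervalIntegral.integral_hasDerivAt_right (hc.intervalIntegrable _ _)
        (hc.stronglyMeasurableAtFilter _ _) hc.continuousAt).const_add _
    refine hd.congr_of_eventuallyEq ?_
    filter_upwards [Ioo_mem_nhds ht.1 ht.2] with s hs
    rw [hsol, projIcc_of_mem (by norm_num) (Ioo_subset_Icc_self hs)]

end LocalFlow

/-! ### Smoothness of partial derivatives on manifolds. -/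

section PartialDerivative

variable {E : Type*} [NormedAddCommGroup E] [NormedSpace ℝ E] {H : Type*} [TopologicalSpace H]
  {I : ModelWithCorners ℝ E H} {A : Type*} [TopologicalSpace A] [ChartedSpace H A]
  [IsManifold I ∞ A]
  {E' : Type*} [NormedAddCommGroup E'] [NormedSpace ℝ E'] {H' : Type*} [TopologicalSpace H']
  {J : ModelWithCorners ℝ E' H'} {B : Type*} [TopologicalSpace B] [ChartedSpace H' B]
  [IsManifold J ∞ B]
  {E'' : Type*} [NormedAddCommGroup E''] [NormedSpace ℝ E''] {H'' : Type*} [TopologicalSpace H'']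
  {L : ModelWithCorners ℝ E'' H''} {C : Type*} [TopologicalSpace C] [ChartedSpace H'' C]
  [IsManifold L ∞ C]

/-- The partial derivative of a smooth map, in a fixed direction, is smooth. -/
lemma contMDiffOn_mfderiv_left {Λ : A × B → C} {W : Set (A × B)} (hW : IsOpen W)
    (hΛ : ContMDiffOn (I.prod J) L ∞ Λ W) (a : A) (v : TangentSpace I a) :
    ContMDiffOn J L.tangent ∞
      (fun b => (⟨Λ (a, b), mfderiv I L (fun x => Λ (x, b)) a v⟩ : TangentBundle L C))
      {b | (a, b) ∈ W} := by
  have : IsManifold I 1 A := IsManifold.of_le (n := ∞) (by simp)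
  have : IsManifold J 1 B := IsManifold.of_le (n := ∞) (by simp)
  have : IsManifold L 1 C := IsManifold.of_le (n := ∞) (by simp)
  -- The partial derivative is the tangent map of `Λ` evaluated on the smooth family of vectors `(v,
  -- 0)` over `(a, b)`.
  let fb : B → TangentBundle J B := fun b => ⟨b, 0⟩
  have sfb : ContMDiff J J.tangent ∞ fb := Bundle.contMDiff_zeroSection _ _
  let fv : B → TangentBundle I A := fun _ => ⟨a, v⟩
  have sfv : ContMDiff J I.tangent ∞ fv := contMDiff_const
  let F₁ : B → TangentBundle I A × TangentBundle J B := fun b => (fv b, fb b)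
  have S₁ : ContMDiff J (I.tangent.prod J.tangent) ∞ F₁ := sfv.prodMk sfb
  let F₂ : TangentBundle I A × TangentBundle J B → TangentBundle (I.prod J) (A × B) :=
    (equivTangentBundleProd I A J B).symm
  have S₂ : ContMDiff (I.tangent.prod J.tangent) (I.prod J).tangent ∞ F₂ :=
    contMDiff_equivTangentBundleProd_symm
  have S₃ := hΛ.contMDiffOn_tangentMapWithin (m := ∞) (by simp) hW.uniqueMDiffOn
  have S := S₃.comp (S₂.comp S₁).contMDiffOn (s := {b | (a, b) ∈ W}) (fun b hb => hb)
  refine S.congr fun b hb => ?_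
  have hmem : W ∈ 𝓝 (a, b) := hW.mem_nhds hb
  have hd : MDifferentiableAt (I.prod J) L Λ (a, b) :=
    ((hΛ (a, b) hb).contMDiffAt hmem).mdifferentiableAt (by simp)
  simp only [Function.comp_apply, tangentMapWithin, F₁, F₂, fb, fv]
  have h1 : mfderivWithin (I.prod J) L Λ W (a, b) = mfderiv (I.prod J) L Λ (a, b) :=
    mfderivWithin_of_mem_nhds hmem
  refine congrArg (fun w => (⟨Λ (a, b), w⟩ : TangentBundle L C)) ?_
  have h2 := mfderiv_prod_eq_add_apply (v := ((v, (0 : TangentSpace J b)) :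
    TangentSpace (I.prod J) (a, b))) hd
  refine Eq.trans ?_ (DFunLike.congr_fun h1.symm _)
  refine Eq.trans ?_ h2.symm
  simp

end PartialDerivative

/-! ### Left invariant vector fields. -/

section LieGroup

variable {E : Type*} [NormedAddCommGroup E] [NormedSpace ℝ E] {H : Type*} [TopologicalSpace H]
  {I : ModelWithCorners ℝ E H} {G : Type*} [TopologicalSpace G] [ChartedSpace H G] [Group G]
  [LieGroup I ∞ G]

/-- The field is the partial derivative at `h = 1` of `(h, g) ↦ g * h`. -/
lemma contMDiff_infty_mulInvariantVectorField (X : GroupLieAlgebra I G) :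
    ContMDiff I I.tangent ∞
      (fun g => (⟨g, mulInvariantVectorField X g⟩ : TangentBundle I G)) := by
  have : IsManifold I ∞ G := inferInstance
  have h := contMDiffOn_mfderiv_left (I := I) (J := I) (L := I) (A := G) (B := G) (C := G)
    (Λ := fun z => z.2 * z.1) (W := univ) isOpen_univ
    (contMDiff_snd.mul contMDiff_fst).contMDiffOn 1 X
  rw [← contMDiffOn_univ]
  refine (h.mono (subset_univ _)).congr fun g _ => ?_
  have : ∀ (g' : G) (w : E), g' = g → (⟨g, w⟩ : TangentBundle I G) = ⟨g', w⟩ := by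
    rintro _ _ rfl; rfl
  exact this _ _ (mul_one g)

lemma mfderiv_mul_left_mulInvariantVectorField (X : GroupLieAlgebra I G) (g h : G) :
    mfderiv I I (fun y => g * y) h (mulInvariantVectorField X h) =
      mulInvariantVectorField X (g * h) := by
  have hd : ∀ (k y : G), MDifferentiableAt I I (fun y => k * y) y := fun k y =>
    (contMDiff_mul_left (n := ∞)).contMDiffAt.mdifferentiableAt (by simp)
  have h1 : (fun y => g * h * y) = (fun y => g * y) ∘ fun y => h * y := by
    ext y; simp [mul_assoc]
  rw [mulInvariantVectorField, mulInvariantVectorField, h1]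
  exact (mfderiv_comp_apply_of_eq _ (hd g h) (hd h 1) (mul_one h) X).symm

/-- Evaluation of left invariant vector fields at a point is a linear isomorphism. -/
lemma mulInvariantVectorField_bijective (g : G) :
    Function.Bijective (fun X : GroupLieAlgebra I G => mulInvariantVectorField X g) := by
  have hd : ∀ (k y : G), MDifferentiableAt I I (fun y => k * y) y := fun k y =>
    (contMDiff_mul_left (n := ∞)).contMDiffAt.mdifferentiableAt (by simp)
  have h1 : ∀ (X : E), mfderiv I I (fun y => g⁻¹ * y) (g * 1)
      (mfderiv I I (fun y => g * y) 1 X) = X := fun X => by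
    have := mfderiv_comp (I := I) (I' := I) (I'' := I) (1 : G) (hd g⁻¹ (g * 1)) (hd g 1)
    have h2 : (fun y => g⁻¹ * y) ∘ (fun y => g * y) = (id : G → G) := by ext y; simp
    rw [h2, mfderiv_id] at this
    exact (DFunLike.congr_fun this X).symm
  have h3 : ∀ (X : E), mfderiv I I (fun y => g * y) (1 : G)
      (mfderiv I I (fun y => g⁻¹ * y) g X) = X := fun X => by
    have := mfderiv_comp_apply_of_eq (I := I) (I' := I) (I'' := I) (x := g) (hd g 1) (hd g⁻¹ g)
      (inv_mul_cancel g) X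
    have h2 : (fun y => g * y) ∘ (fun y => g⁻¹ * y) = (id : G → G) := by ext y; simp
    rw [h2, mfderiv_id] at this
    exact this.symm
  refine ⟨fun X Y hXY => ?_, fun Y => ⟨_, h3 Y⟩⟩
  exact (h1 X).symm.trans ((congrArg (mfderiv I I (fun y => g⁻¹ * y) (g * 1)) hXY).trans (h1 Y))

end LieGroup

/-! ### Smooth lifting through a submersion. -/

section Submersion

variable {E : Type*} [NormedAddCommGroup E] [NormedSpace ℝ E] {H : Type*} [TopologicalSpace H]
  {I : ModelWithCorners ℝ E H} {N : Type*} [TopologicalSpace N] [ChartedSpace H N]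
  {E' : Type*} [NormedAddCommGroup E'] [NormedSpace ℝ E'] {H' : Type*} [TopologicalSpace H']
  {J : ModelWithCorners ℝ E' H'} {T : Type*} [TopologicalSpace T] [ChartedSpace H' T]

/-- Near a point, the values of a submersion can be changed by moving the point smoothly. -/
lemma Manifold.IsSubmersionAt.exists_smooth_lift [I.Boundaryless]
    {f : N → T} {x₀ : N} (hf : IsSubmersionAt I J ∞ f x₀) :
    ∃ (W : Set (T × N)) (l : T × N → N), IsOpen W ∧ (f x₀, x₀) ∈ W ∧
      ContMDiffOn (J.prod I) I ∞ l W ∧ (∀ z ∈ W, f (l z) = z.1) ∧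
      ∀ x, (f x, x) ∈ W → l (f x, x) = x := by
  obtain ⟨F, _, _, hf⟩ := hf
  set φ := hf.domChart with hφ
  set κ := hf.codChart
  set e := hf.equiv
  have hφm := hf.domChart_mem_maximalAtlas
  have hκm := hf.codChart_mem_maximalAtlas
  have hw := hf.writtenInCharts
  -- In suitable charts `f` is the first projection. Prescribing the first coordinate and keeping
  -- the second moves a point to a given fibre.
  let c : T × N → E := fun z => e.symm (κ.extend J z.1, (e (φ.extend I z.2)).2)
  let W₀ : Set (T × N) := κ.source ×ˢ φ.source
  have hW₀ : IsOpen W₀ := κ.open_source.prod φ.open_source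
  have hc : ContMDiffOn (J.prod I) 𝓘(ℝ, E) ∞ c W₀ := by
    have h1 : ContMDiffOn (J.prod I) 𝓘(ℝ, E') ∞ (fun z : T × N => κ.extend J z.1) W₀ :=
      (OpenPartialHomeomorph.contMDiffOn_extend hκm).comp contMDiffOn_fst (fun z hz => hz.1)
    have h2 : ContMDiffOn (J.prod I) 𝓘(ℝ, E) ∞ (fun z : T × N => φ.extend I z.2) W₀ :=
      (OpenPartialHomeomorph.contMDiffOn_extend hφm).comp contMDiffOn_snd (fun z hz => hz.2)
    have h3 : ContMDiffOn (J.prod I) 𝓘(ℝ, F) ∞ (fun z : T × N => (e (φ.extend I z.2)).2) W₀ :=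
      ((ContinuousLinearMap.snd ℝ E' F).comp (e : E →L[ℝ] E' × F)).contMDiff.comp_contMDiffOn h2
    exact (e.symm : E' × F →L[ℝ] E).contMDiff.comp_contMDiffOn (h1.prodMk_space h3)
  have htar : IsOpen (φ.extend I).target := φ.isOpen_extend_target
  let W : Set (T × N) := W₀ ∩ c ⁻¹' (φ.extend I).target
  have hWo : IsOpen W := hc.continuousOn.isOpen_inter_preimage hW₀ htar
  have hfc : ∀ x ∈ φ.source, κ.extend J (f x) = (e (φ.extend I x)).1 := fun x hx => by
    have hx' : x ∈ (φ.extend I).source := by rwa [φ.extend_source]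
    have := hw ((φ.extend I).map_source hx')
    have h2 : (φ.extend I).symm (φ.extend I x) = x := (φ.extend I).left_inv hx'
    simp only [Function.comp_apply] at this
    rwa [← hφ, h2] at this
  have hcx : ∀ x ∈ φ.source, c (f x, x) = φ.extend I x := fun x hx => by
    simp only [c, hfc x hx]
    rw [Prod.mk.eta, e.symm_apply_apply]
  refine ⟨W, fun z => (φ.extend I).symm (c z), hWo, ?_, ?_, ?_, ?_⟩
  · refine ⟨⟨hf.mem_codChart_source, hf.mem_domChart_source⟩, ?_⟩
    rw [mem_preimage, hcx x₀ hf.mem_domChart_source]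
    exact (φ.extend I).map_source (by rw [φ.extend_source]; exact hf.mem_domChart_source)
  · refine (contMDiffOn_extend_symm hφm).comp (hc.mono inter_subset_left) fun z hz => ?_
    have := hz.2
    rw [mem_preimage, φ.extend_target] at this
    obtain ⟨h1, h2⟩ := this
    exact ⟨_, h1, I.right_inv h2⟩
  · rintro z ⟨hz1, hz2⟩
    have hl : (φ.extend I).symm (c z) ∈ φ.source := by
      rw [← φ.extend_source (I := I)]; exact (φ.extend I).map_target hz2
    have h1 := hfc _ hl
    rw [(φ.extend I).right_inv hz2] at h1
    simp only [c, e.apply_symm_apply] at h1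
    have h3 := hf.mapsto_domChart_source_codChart_source hl
    refine (κ.extend J).injOn ?_ ?_ h1
    · rw [κ.extend_source]; exact h3
    · rw [κ.extend_source]; exact hz1.1
  · rintro x ⟨hx, -⟩
    show (φ.extend I).symm (c (f x, x)) = x
    rw [hcx x hx.2]
    exact (φ.extend I).left_inv (by rw [φ.extend_source]; exact hx.2)

end Submersion

/-! ### Transverse lifts of left invariant fields. -/

section LieFoliationBasics

variable {p q : ℕ}
  {M : Type*} [TopologicalSpace M] [ChartedSpace (EuclideanSpace ℝ (Fin (p + q))) M]
  [IsManifold (𝓡 (p + q)) ∞ M]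
  {G : Type*} [TopologicalSpace G] [ChartedSpace (EuclideanSpace ℝ (Fin q)) G] [Group G]

lemma FoliatedChart.contMDiffAt {E : Type*} [NormedAddCommGroup E] [NormedSpace ℝ E]
    {H : Type*} [TopologicalSpace H] {I : ModelWithCorners ℝ E H}
    {N : Type*} [TopologicalSpace N] [ChartedSpace H N] {p q : ℕ} {T : Type*} [TopologicalSpace T]
    [ChartedSpace (EuclideanSpace ℝ (Fin q)) T] (u : FoliatedChart I N p q T) {x : N}
    (hx : x ∈ u.dom) : ContMDiffAt I (𝓡 q) ∞ u.map x :=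
  (u.isSubmersionAt x hx).contMDiffAt

lemma FoliatedChart.mdifferentiableAt {E : Type*} [NormedAddCommGroup E] [NormedSpace ℝ E]
    {H : Type*} [TopologicalSpace H] {I : ModelWithCorners ℝ E H}
    {N : Type*} [TopologicalSpace N] [ChartedSpace H N] {p q : ℕ} {T : Type*} [TopologicalSpace T]
    [ChartedSpace (EuclideanSpace ℝ (Fin q)) T] (u : FoliatedChart I N p q T) {x : N}
    (hx : x ∈ u.dom) : MDifferentiableAt I (𝓡 q) u.map x :=
  (u.contMDiffAt hx).mdifferentiableAt (by simp)

namespace SmoothFoliation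

variable {F : SmoothFoliation (𝓡 (p + q)) M p q G}

omit [IsManifold (𝓡 (p + q)) ∞ M] in
lemma IsLie.eventually_eq (hF : F.IsLie) {u v : FoliatedChart (𝓡 (p + q)) M p q G}
    (hu : u ∈ F.cocycle) (hv : v ∈ F.cocycle) {x : M} (hxu : x ∈ u.dom) (hxv : x ∈ v.dom) :
    ∀ᶠ y in 𝓝 x, v.map y = v.map x * (u.map x)⁻¹ * u.map y := by
  obtain ⟨O, hO, hxO, -, g, hg⟩ := hF u hu v hv x ⟨hxu, hxv⟩
  filter_upwards [hO.mem_nhds hxO] with y hy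
  rw [hg y hy, hg x hxO]
  group

variable [LieGroup (𝓡 q) ∞ G]

omit [IsManifold (𝓡 (p + q)) ∞ M] in
lemma IsLie.mfderiv_eq (hF : F.IsLie) {u v : FoliatedChart (𝓡 (p + q)) M p q G}
    (hu : u ∈ F.cocycle) (hv : v ∈ F.cocycle) {x : M} (hxu : x ∈ u.dom) (hxv : x ∈ v.dom)
    (w : TangentSpace (𝓡 (p + q)) x) :
    mfderiv (𝓡 (p + q)) (𝓡 q) v.map x w =
      mfderiv (𝓡 q) (𝓡 q) (fun y => v.map x * (u.map x)⁻¹ * y) (u.map x)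
        (mfderiv (𝓡 (p + q)) (𝓡 q) u.map x w) := by
  have h1 : v.map =ᶠ[𝓝 x] (fun y => v.map x * (u.map x)⁻¹ * y) ∘ u.map :=
    hF.eventually_eq hu hv hxu hxv
  rw [h1.mfderiv_eq]
  exact mfderiv_comp_apply x
    ((contMDiff_mul_left (n := ∞)).contMDiffAt.mdifferentiableAt (by simp))
    (u.mdifferentiableAt hxu) w

-- A single member of the cocycle suffices, as any other one has its derivative factored through it
-- by that of a left translation.
omit [IsManifold (𝓡 (p + q)) ∞ M] in
lemma IsLie.mem_tangent_iff (hF : F.IsLie) {u : FoliatedChart (𝓡 (p + q)) M p q G}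
    (hu : u ∈ F.cocycle) {x : M} (hxu : x ∈ u.dom) (w : TangentSpace (𝓡 (p + q)) x) :
    w ∈ F.tangent x ↔ mfderiv (𝓡 (p + q)) (𝓡 q) u.map x w = 0 := by
  refine ⟨fun h => h u hu hxu, fun h v hv hxv => ?_⟩
  rw [hF.mfderiv_eq hu hv hxu hxv, h]
  exact map_zero _

-- Lifting `X` is independent of the member of the cocycle because the transition maps preserve left
-- invariant fields.
omit [IsManifold (𝓡 (p + q)) ∞ M] in
lemma IsLie.mfderiv_eq_mulInvariantVectorField (hF : F.IsLie)
    {u v : FoliatedChart (𝓡 (p + q)) M p q G}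
    (hu : u ∈ F.cocycle) (hv : v ∈ F.cocycle) {x : M} (hxu : x ∈ u.dom) (hxv : x ∈ v.dom)
    {w : TangentSpace (𝓡 (p + q)) x} {X : GroupLieAlgebra (𝓡 q) G}
    (h : mfderiv (𝓡 (p + q)) (𝓡 q) u.map x w = mulInvariantVectorField X (u.map x)) :
    mfderiv (𝓡 (p + q)) (𝓡 q) v.map x w = mulInvariantVectorField X (v.map x) := by
  rw [hF.mfderiv_eq hu hv hxu hxv, h, mfderiv_mul_left_mulInvariantVectorField]
  congr 1
  group

/-- Left invariant fields lift locally to smooth fields. -/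
lemma IsLie.exists_local_lift (hF : F.IsLie) (X : GroupLieAlgebra (𝓡 q) G) (x₀ : M) :
    ∃ O ∈ 𝓝 x₀, ∃ s : ∀ x : M, TangentSpace (𝓡 (p + q)) x,
      ContMDiffOn (𝓡 (p + q)) (𝓡 (p + q)).tangent ∞
        (fun y => (⟨y, s y⟩ : TangentBundle (𝓡 (p + q)) M)) O ∧
      ∀ y ∈ O, ∀ v ∈ F.cocycle, y ∈ v.dom →
        mfderiv (𝓡 (p + q)) (𝓡 q) v.map y (s y) = mulInvariantVectorField X (v.map y) := by
  obtain ⟨u, hu, hxu⟩ := F.cover x₀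
  obtain ⟨W, l, hW, hxW, hl, hfl, hlx⟩ := (u.isSubmersionAt x₀ hxu).exists_smooth_lift
  have hum : ContMDiffOn (𝓡 (p + q)) (𝓡 q) ∞ u.map u.dom := fun x hx =>
    (u.contMDiffAt hx).contMDiffWithinAt
  let D : Set (G × M) := univ ×ˢ u.dom
  have hD : IsOpen D := isOpen_univ.prod u.isOpen_dom
  let θ : G × M → G × M := fun z => (u.map z.2 * z.1, z.2)
  have hθ : ContMDiffOn ((𝓡 q).prod (𝓡 (p + q))) ((𝓡 q).prod (𝓡 (p + q))) ∞ θ D :=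
    ((hum.comp contMDiffOn_snd fun z hz => hz.2).mul contMDiffOn_fst).prodMk contMDiffOn_snd
  have hW' : IsOpen (D ∩ θ ⁻¹' W) := hθ.continuousOn.isOpen_inter_preimage hD hW
  -- `Λ (g, y)` is `y` moved so that its image becomes `u.map y * g`. Its derivative at `g = 1` in
  -- the direction `X` is therefore a lift of `X`.
  let Λ : G × M → M := fun z => l (θ z)
  have hΛ : ContMDiffOn ((𝓡 q).prod (𝓡 (p + q))) (𝓡 (p + q)) ∞ Λ (D ∩ θ ⁻¹' W) :=
    hl.comp (hθ.mono inter_subset_left) fun z hz => hz.2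
  let O : Set M := {y | ((1 : G), y) ∈ D ∩ θ ⁻¹' W}
  have hO : IsOpen O := hW'.preimage (Continuous.prodMk_right (1 : G))
  have hOW : ∀ y ∈ O, y ∈ u.dom ∧ (u.map y, y) ∈ W := fun y hy =>
    ⟨hy.1.2, by simpa [θ] using hy.2⟩
  have hΛ1 : ∀ y ∈ O, Λ (1, y) = y := fun y hy => by
    simp only [Λ, θ, mul_one]
    exact hlx y (hOW y hy).2
  refine ⟨O, hO.mem_nhds ⟨⟨mem_univ _, hxu⟩, by simpa [θ] using hxW⟩,
    fun y => (mfderiv (𝓡 q) (𝓡 (p + q)) (fun g => Λ (g, y)) 1 X :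
      EuclideanSpace ℝ (Fin (p + q))), ?_, ?_⟩
  · refine (contMDiffOn_mfderiv_left hW' hΛ 1 X).congr fun y hy => ?_
    have : ∀ (y' : M) (w : EuclideanSpace ℝ (Fin (p + q))), y = y' →
      (⟨y, w⟩ : TangentBundle (𝓡 (p + q)) M) = ⟨y', w⟩ := by
      rintro _ _ rfl; rfl
    exact this _ _ (hΛ1 y hy).symm
  · intro y hy v hv hyv
    refine hF.mfderiv_eq_mulInvariantVectorField hu hv (hOW y hy).1 hyv ?_
    have hd : MDifferentiableAt (𝓡 q) (𝓡 (p + q)) (fun g => Λ (g, y)) 1 := by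
      have h1 : ContMDiffAt ((𝓡 q).prod (𝓡 (p + q))) (𝓡 (p + q)) ∞ Λ (1, y) :=
        (hΛ _ hy).contMDiffAt (hW'.mem_nhds hy)
      exact (ContMDiffAt.comp (1 : G) (f := fun g : G => (g, y)) h1
        (contMDiffAt_id.prodMk contMDiffAt_const)).mdifferentiableAt (by simp)
    have h2 := mfderiv_comp_apply_of_eq (1 : G) (u.mdifferentiableAt (hOW y hy).1) hd
      (hΛ1 y hy) X
    refine h2.symm.trans ?_
    have h3 : u.map ∘ (fun g => Λ (g, y)) =ᶠ[𝓝 (1 : G)] fun g => u.map y * g := by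
      have : ∀ᶠ g in 𝓝 (1 : G), (g, y) ∈ D ∩ θ ⁻¹' W :=
        (Continuous.prodMk_left y).continuousAt.eventually (hW'.mem_nhds hy)
      filter_upwards [this] with g hg
      exact hfl _ hg.2
    rw [h3.mfderiv_eq]
    rfl

/-- A smooth family of transverse vector fields lifting the left invariant fields. -/
theorem IsLie.exists_transverse_fields [T2Space M] [SigmaCompactSpace M] (hF : F.IsLie) :
    ∃ Y : ∀ x : M, EuclideanSpace ℝ (Fin q) →ₗ[ℝ] TangentSpace (𝓡 (p + q)) x,
      (∀ X, ContMDiff (𝓡 (p + q)) (𝓡 (p + q)).tangent ∞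
        (fun y => (⟨y, Y y X⟩ : TangentBundle (𝓡 (p + q)) M))) ∧
      ∀ X : EuclideanSpace ℝ (Fin q), ∀ u ∈ F.cocycle, ∀ x ∈ u.dom,
        mfderiv (𝓡 (p + q)) (𝓡 q) u.map x (Y x X) =
          mulInvariantVectorField (I := 𝓡 q) (G := G) X (u.map x) := by
  let t : EuclideanSpace ℝ (Fin q) → ∀ x : M, Set (TangentSpace (𝓡 (p + q)) x) := fun X x =>
    {w | ∀ u ∈ F.cocycle, x ∈ u.dom → mfderiv (𝓡 (p + q)) (𝓡 q) u.map x w =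
          mulInvariantVectorField (I := 𝓡 q) (G := G) X (u.map x)}
  -- The lifts of `X` at a point form an affine, hence convex, set, so local lifts can be glued by a
  -- partition of unity.
  have ht : ∀ X x, Convex ℝ (t X x) := by
    intro X x w hw w' hw' a b _ _ hab u hu hx
    rw [map_add, map_smul, map_smul, hw u hu hx, hw' u hu hx, ← add_smul, hab, one_smul]
  have hs : ∀ i : Fin q, ∃ s : ContMDiffSection (𝓡 (p + q)) (EuclideanSpace ℝ (Fin (p + q))) ∞
      (TangentSpace (𝓡 (p + q)) : M → Type _), ∀ x, s x ∈ t (EuclideanSpace.single i 1) x :=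
    fun i => exists_contMDiffSection_forall_mem_convex_of_local (n := (⊤ : ℕ∞)) (𝓡 (p + q))
      (TangentSpace (𝓡 (p + q)) : M → Type _) _ (ht _) fun x₀ => by
        obtain ⟨O, hO, s, h1, h2⟩ := hF.exists_local_lift (EuclideanSpace.single i 1 :
          EuclideanSpace ℝ (Fin q)) x₀
        exact ⟨O, hO, s, h1, h2⟩
  choose s hs using hs
  -- Only lifts of a basis are glued; taking their combinations for the other `X` makes the family
  -- linear in `X`.
  refine ⟨fun x => ∑ i, ((EuclideanSpace.proj i : EuclideanSpace ℝ (Fin q) →L[ℝ] ℝ) :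
    EuclideanSpace ℝ (Fin q) →ₗ[ℝ] ℝ).smulRight (s i x), fun X => ?_, fun X u hu x hx => ?_⟩
  · have h : ContMDiff (𝓡 (p + q)) (𝓡 (p + q)).tangent ∞
        (fun y => (⟨y, ∑ i, (X i • s i y)⟩ : TangentBundle (𝓡 (p + q)) M)) :=
      ContMDiff.sum_section fun i _ => ContMDiff.const_smul_section (s i).contMDiff
    refine h.congr fun y => ?_
    simp
  · have h : mulInvariantVectorField (I := 𝓡 q) (G := G) X (u.map x) =
        ∑ i, X i • mulInvariantVectorField (I := 𝓡 q) (G := G)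
          (EuclideanSpace.single i (1 : ℝ)) (u.map x) := by
      have h1 : X = ∑ i, X i • (EuclideanSpace.single i (1 : ℝ)) := by
        ext j; simp [Pi.single_apply]
      let D : EuclideanSpace ℝ (Fin q) →L[ℝ] EuclideanSpace ℝ (Fin q) :=
        mfderiv (𝓡 q) (𝓡 q) (fun y => u.map x * y) (1 : G)
      show D X = ∑ i, X i • D (EuclideanSpace.single i (1 : ℝ))
      conv_lhs => rw [h1]
      rw [map_sum]
      simp only [map_smul]
    rw [h]
    simp only [LinearMap.sum_apply, map_sum]
    refine Finset.sum_congr rfl fun i _ => ?_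
    rw [← hs i x u hu hx]
    exact map_smul _ _ _

end SmoothFoliation

end LieFoliationBasics

/-! ### Integral curves and parametrized flows in charts. -/

section LocalFlows

variable {E : Type} [NormedAddCommGroup E] [NormedSpace ℝ E] {H : Type*} [TopologicalSpace H]
  {I : ModelWithCorners ℝ E H} {N : Type*} [TopologicalSpace N] [ChartedSpace H N]
  [IsManifold I ∞ N]

/-- The expression of a vector field in the extended chart at a point. -/
noncomputable def chartField (I : ModelWithCorners ℝ E H) (x₀ : N) (v : ∀ x : N, TangentSpace I x)
    (s : E) : E :=
  mfderiv I 𝓘(ℝ, E) (extChartAt I x₀) ((extChartAt I x₀).symm s) (v ((extChartAt I x₀).symm s))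

lemma contDiffOn_chartField [I.Boundaryless] (x₀ : N) {v : ∀ x : N, TangentSpace I x}
    (hv : ContMDiff I I.tangent ∞ (fun y => (⟨y, v y⟩ : TangentBundle I N))) :
    ContDiffOn ℝ ∞ (chartField I x₀ v) (extChartAt I x₀).target := by
  have : IsManifold I 1 N := IsManifold.of_le (n := ∞) (by simp)
  rw [← contMDiffOn_iff_contDiffOn]
  have h1 := (contMDiffOn_extChartAt (I := I) (n := ∞) (x := x₀)).contMDiffOn_tangentMapWithin
    (m := ∞) (by simp) (chartAt H x₀).open_source.uniqueMDiffOn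
  have h2 : ContMDiffOn 𝓘(ℝ, E) I.tangent ∞ (fun s => (⟨(extChartAt I x₀).symm s,
      v ((extChartAt I x₀).symm s)⟩ : TangentBundle I N)) (extChartAt I x₀).target :=
    hv.comp_contMDiffOn (contMDiffOn_extChartAt_symm x₀)
  have hmem : ∀ s ∈ (extChartAt I x₀).target, (extChartAt I x₀).symm s ∈ (chartAt H x₀).source :=
    fun s hs => by
      rw [← extChartAt_source I]; exact (extChartAt I x₀).map_target hs
  have h3 := (contMDiff_snd_tangentBundle_modelSpace E 𝓘(ℝ, E) (n := ∞)).comp_contMDiffOn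
    (h1.comp h2 hmem)
  refine h3.congr fun s hs => ?_
  have : mfderivWithin I 𝓘(ℝ, E) (extChartAt I x₀) (chartAt H x₀).source
      ((extChartAt I x₀).symm s) = mfderiv I 𝓘(ℝ, E) (extChartAt I x₀)
        ((extChartAt I x₀).symm s) :=
    mfderivWithin_of_mem_nhds ((chartAt H x₀).open_source.mem_nhds (hmem s hs))
  exact DFunLike.congr_fun this.symm _

/-- Solutions in a chart are integral curves. -/
lemma hasMFDerivAt_of_chartField [I.Boundaryless] (x₀ : N) {v : ∀ x : N, TangentSpace I x}
    {y : ℝ → E} {t : ℝ} (ht : y t ∈ (extChartAt I x₀).target)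
    (hy : HasDerivAt y (chartField I x₀ v (y t)) t) :
    HasMFDerivAt 𝓘(ℝ, ℝ) I (fun t => (extChartAt I x₀).symm (y t)) t
      ((1 : ℝ →L[ℝ] ℝ).smulRight (v ((extChartAt I x₀).symm (y t)))) := by
  have : IsManifold I 1 N := IsManifold.of_le (n := ∞) (by simp)
  have h1 : HasMFDerivAt 𝓘(ℝ, E) I (extChartAt I x₀).symm (y t)
      (mfderivWithin 𝓘(ℝ, E) I (extChartAt I x₀).symm (range I) (y t)) := by
    have := (mdifferentiableWithinAt_extChartAt_symm (I := I) ht).hasMFDerivWithinAt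
    rw [I.range_eq_univ] at this ⊢
    exact this.hasMFDerivAt univ_mem
  have h2 : HasMFDerivAt 𝓘(ℝ, ℝ) 𝓘(ℝ, E) y t
      ((1 : ℝ →L[ℝ] ℝ).smulRight (chartField I x₀ v (y t)) : ℝ →L[ℝ] E) :=
    hy.hasFDerivAt.hasMFDerivAt
  refine (h1.comp t h2).congr_mfderiv ?_
  have h3 := mfderivWithin_extChartAt_symm_comp_mfderiv_extChartAt (I := I) ht
  have h4 := DFunLike.congr_fun h3 (v ((extChartAt I x₀).symm (y t)))
  refine ContinuousLinearMap.ext fun a' => ?_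
  let a : ℝ := a'
  exact (map_smul (mfderivWithin 𝓘(ℝ, E) I (extChartAt I x₀).symm (range I) (y t)) a
    (chartField I x₀ v (y t))).trans (congrArg (fun w => a • w) h4)

/-- In a chart, integral curves are solutions. -/
lemma hasDerivAt_chartField (x₀ : N) {v : ∀ x : N, TangentSpace I x}
    {γ : ℝ → N} {t : ℝ} (ht : γ t ∈ (extChartAt I x₀).source)
    (hγ : HasMFDerivAt 𝓘(ℝ, ℝ) I γ t ((1 : ℝ →L[ℝ] ℝ).smulRight (v (γ t)))) :
    HasDerivAt (fun t => extChartAt I x₀ (γ t)) (chartField I x₀ v (extChartAt I x₀ (γ t))) t := by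
  have : IsManifold I 1 N := IsManifold.of_le (n := ∞) (by simp)
  have h1 := (mdifferentiableAt_extChartAt (I := I)
    (by rwa [← extChartAt_source I])).hasMFDerivAt.comp t hγ
  rw [chartField, (extChartAt I x₀).left_inv ht]
  let c : E := mfderiv I 𝓘(ℝ, E) (extChartAt I x₀) (γ t) (v (γ t))
  have h2 : HasMFDerivAt 𝓘(ℝ, ℝ) 𝓘(ℝ, E) (fun t => extChartAt I x₀ (γ t)) t
      ((1 : ℝ →L[ℝ] ℝ).smulRight c : ℝ →L[ℝ] E) :=
    h1.congr_mfderiv (ContinuousLinearMap.ext fun a' => by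
      let a : ℝ := a'
      exact map_smul (mfderiv I 𝓘(ℝ, E) (extChartAt I x₀) (γ t)) a (v (γ t)))
  have h3 : HasFDerivAt (fun t => extChartAt I x₀ (γ t))
    ((1 : ℝ →L[ℝ] ℝ).smulRight c : ℝ →L[ℝ] E) t := hasMFDerivAt_iff_hasFDerivAt.1 h2
  exact h3.hasDerivAt.congr_deriv (one_smul ℝ c)

/-- Bootstrapping in a chart: the derivative of the solution is a smooth function of the solution,
so each order of differentiability yields the next. -/
lemma IsMIntegralCurveAt.contMDiffAt [I.Boundaryless] {v : ∀ x : N, TangentSpace I x}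
    (hv : ContMDiff I I.tangent ∞ (fun y => (⟨y, v y⟩ : TangentBundle I N)))
    {γ : ℝ → N} {t₀ : ℝ} (hγ : IsMIntegralCurveAt γ v t₀) :
    ContMDiffAt 𝓘(ℝ, ℝ) I ∞ γ t₀ := by
  set φ := extChartAt I (γ t₀) with hφ
  have hev : ∀ᶠ t in 𝓝 t₀, γ t ∈ φ.source ∧
      HasDerivAt (fun t => φ (γ t)) (chartField I (γ t₀) v (φ (γ t))) t := by
    filter_upwards [hγ, hγ.continuousAt (extChartAt_source_mem_nhds (I := I) (γ t₀))] with t h1 h2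
    exact ⟨h2, hasDerivAt_chartField (γ t₀) h2 h1⟩
  obtain ⟨s, hs, hso, hts⟩ := eventually_nhds_iff.1 hev
  have key : ∀ n : ℕ, ContDiffOn ℝ n (fun t => φ (γ t)) s := by
    intro n
    induction n with
    | zero => exact contDiffOn_zero.2 fun t ht => (hs t ht).2.continuousAt.continuousWithinAt
    | succ n ih =>
      rw [Nat.cast_add, Nat.cast_one, contDiffOn_succ_iff_deriv_of_isOpen hso]
      refine ⟨fun t ht => (hs t ht).2.differentiableAt.differentiableWithinAt, by simp, ?_⟩
      have h1 : ContDiffOn ℝ n (fun t => chartField I (γ t₀) v (φ (γ t))) s :=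
        ((contDiffOn_chartField (γ t₀) hv).of_le (by exact_mod_cast le_top)).comp ih
          fun t ht => φ.map_source (hs t ht).1
      exact h1.congr fun t ht => (hs t ht).2.deriv
  have h1 : ContMDiffAt 𝓘(ℝ, ℝ) 𝓘(ℝ, E) ∞ (fun t => φ (γ t)) t₀ :=
    ((contDiffOn_infty.2 key).contDiffAt (hso.mem_nhds hts)).contMDiffAt
  have h2 : ContMDiffAt 𝓘(ℝ, E) I ∞ φ.symm (φ (γ t₀)) :=
    (contMDiffOn_extChartAt_symm (γ t₀)).contMDiffAt
      (extChartAt_target_mem_nhds (I := I) (γ t₀))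
  refine (h2.comp t₀ h1).congr_of_eventuallyEq ?_
  filter_upwards [hso.mem_nhds hts] with t ht
  exact (φ.left_inv (hs t ht).1).symm

/-- A bump function extends the germ. Chart expressions of vector fields live on the chart target,
whereas `exists_smooth_localFlow` requires a field on the whole space. -/
lemma exists_contDiff_eventuallyEq {F : Type*} [NormedAddCommGroup F] [NormedSpace ℝ F]
    [FiniteDimensional ℝ E] {w : E → F} {s : Set E} (hs : IsOpen s) {x : E} (hx : x ∈ s)
    (hw : ContDiffOn ℝ ∞ w s) : ∃ w' : E → F, ContDiff ℝ ∞ w' ∧ w' =ᶠ[𝓝 x] w := by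
  obtain ⟨r, hr, hrs⟩ := Metric.nhds_basis_closedBall.mem_iff.1 (hs.mem_nhds hx)
  let χ : ContDiffBump x := ⟨r / 2, r, by positivity, by linarith⟩
  refine ⟨fun y => χ y • w y, contDiff_iff_contDiffAt.2 fun y => ?_, ?_⟩
  · by_cases hy : y ∈ s
    · exact χ.contDiff.contDiffAt.smul (hw.contDiffAt (hs.mem_nhds hy))
    · have hy' : y ∉ tsupport χ := fun h => hy (hrs (χ.tsupport_eq ▸ h))
      refine (contDiffAt_const (c := (0 : F))).congr_of_eventuallyEq ?_
      filter_upwards [(isClosed_tsupport χ).isOpen_compl.mem_nhds hy'] with z hz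
      rw [image_eq_zero_of_notMem_tsupport hz, zero_smul]
  · filter_upwards [χ.eventuallyEq_one] with y hy
    rw [hy, Pi.one_apply, one_smul]

/-- Flows of small vector fields of a finite-dimensional family are defined for a uniform time
near a point, stay near this point, and are smooth in the parameters. -/
theorem exists_local_flow [I.Boundaryless] [FiniteDimensional ℝ E] {q : ℕ}
    {Y : ∀ x : N, EuclideanSpace ℝ (Fin q) →ₗ[ℝ] TangentSpace I x}
    (hY : ∀ X, ContMDiff I I.tangent ∞ (fun y => (⟨y, Y y X⟩ : TangentBundle I N)))
    (x₀ : N) {U : Set N} (hU : U ∈ 𝓝 x₀) :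
    ∃ O ∈ 𝓝 x₀, ∃ ε > 0, ∃ S : N × EuclideanSpace ℝ (Fin q) → ℝ → N,
      ∀ z ∈ O ×ˢ Metric.ball 0 ε, S z 0 = z.1 ∧
        IsMIntegralCurveOn (S z) (fun x => Y x z.2) (Ioo (-2) 2) ∧
        (∀ t ∈ Ioo (-2 : ℝ) 2, S z t ∈ U) ∧
        ContMDiffAt (I.prod 𝓘(ℝ, EuclideanSpace ℝ (Fin q))) I ∞ (fun z => S z 1) z := by
  set φ := extChartAt I x₀ with hφ
  have htar : IsOpen φ.target := isOpen_extChartAt_target x₀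
  have hx₀ : φ x₀ ∈ φ.target := φ.map_source (mem_extChartAt_source x₀)
  choose w hw hwe using fun i : Fin q => exists_contDiff_eventuallyEq htar hx₀
    (contDiffOn_chartField x₀ (hY (EuclideanSpace.single i 1)))
  -- Linearity in the parameter makes the field vanish at parameter `0`, as
  -- `exists_smooth_localFlow` requires.
  let V : E × EuclideanSpace ℝ (Fin q) → E := fun z => ∑ i, z.2 i • w i z.1
  have hV : ContDiff ℝ ∞ V := by
    refine ContDiff.sum fun i _ => ?_
    have h1 : ContDiff ℝ ∞ fun z : E × EuclideanSpace ℝ (Fin q) => z.2 i :=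
      (EuclideanSpace.proj i : EuclideanSpace ℝ (Fin q) →L[ℝ] ℝ).contDiff.comp contDiff_snd
    exact h1.smul ((hw i).comp contDiff_fst)
  have hV' : ∀ᶠ s in 𝓝 (φ x₀), ∀ X, V (s, X) = chartField I x₀ (fun x => Y x X) s := by
    filter_upwards [eventually_all.2 hwe] with s hs X
    have h1 : X = ∑ i, X i • (EuclideanSpace.single i (1 : ℝ)) := by
      ext j; simp [Pi.single_apply]
    have h2 : Y (φ.symm s) X = ∑ i, X i • Y (φ.symm s) (EuclideanSpace.single i 1) := by
      conv_lhs => rw [h1]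
      simp only [map_sum, map_smul]
    simp only [V, chartField]
    rw [h2, map_sum]
    refine Finset.sum_congr rfl fun i _ => ?_
    rw [hs i, map_smul]
    rfl
  obtain ⟨S, hS0, hS⟩ := exists_smooth_localFlow hV (fun x => by simp [V]) (φ x₀)
  have hcU : φ.symm ⁻¹' U ∈ 𝓝 (φ x₀) := by
    refine (continuousAt_extChartAt_symm x₀) ?_
    rwa [extChartAt_to_inv]
  obtain ⟨r, hr, hrs⟩ := Metric.mem_nhds_iff.1
    (inter_mem (inter_mem (htar.mem_nhds hx₀) hcU) hV')
  have hSc : ContinuousAt S (φ x₀, 0) := hS.self_of_nhds.1.continuousAt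
  -- The path at `(φ x₀, 0)` is constant and `S` is continuous for the uniform norm, so nearby
  -- solutions stay during all of `[-2, 2]` in the ball where `V` is the true chart expression.
  have hSr : ∀ᶠ z in 𝓝 (φ x₀, (0 : EuclideanSpace ℝ (Fin q))),
      ∀ k, S z k ∈ Metric.ball (φ x₀) r := by
    have h1 := hSc (Metric.ball_mem_nhds _ hr)
    filter_upwards [h1] with z hz k
    rw [hS0] at hz
    exact lt_of_le_of_lt (ContinuousMap.dist_apply_le_dist k) hz
  have hc : ContinuousAt (fun z : N × EuclideanSpace ℝ (Fin q) => (φ z.1, z.2)) (x₀, 0) :=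
    ((continuousAt_extChartAt x₀).comp (f := Prod.fst) (x := (x₀, (0 : EuclideanSpace ℝ (Fin q))))
      continuousAt_fst).prodMk continuousAt_snd
  have hsrc : ∀ᶠ z : N × EuclideanSpace ℝ (Fin q) in 𝓝 (x₀, 0), z.1 ∈ φ.source :=
    continuousAt_fst.eventually (extChartAt_source_mem_nhds (I := I) x₀)
  have hev := (hc.eventually (hS.and hSr)).and hsrc
  rw [nhds_prod_eq, (Filter.HasBasis.prod (basis_sets _) Metric.nhds_basis_ball).eventually_iff]
    at hev
  obtain ⟨⟨O, ε⟩, ⟨hO, hε⟩, H⟩ := hev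
  refine ⟨O, hO, ε, hε, fun z t => φ.symm (S (φ z.1, z.2) (projIcc (-2) 2 (by norm_num) t)),
    fun z hz => ?_⟩
  obtain ⟨⟨⟨hsm, hinit, hder⟩, hball⟩, hzs⟩ := H hz
  refine ⟨?_, fun t ht => ?_, fun t ht => (hrs (hball _)).1.2, ?_⟩
  · simp only [hinit]
    exact φ.left_inv hzs
  · refine HasMFDerivAt.hasMFDerivWithinAt (hasMFDerivAt_of_chartField x₀
      (v := fun x => Y x z.2) (hrs (hball _)).1.1 ?_)
    rw [← (hrs (hball _)).2]
    exact hder t ht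
  · have h1 : ContMDiffAt (I.prod 𝓘(ℝ, EuclideanSpace ℝ (Fin q)))
        𝓘(ℝ, E × EuclideanSpace ℝ (Fin q)) ∞
        (fun z : N × EuclideanSpace ℝ (Fin q) => (φ z.1, z.2)) z :=
      ((contMDiffAt_extChartAt' (by rwa [← extChartAt_source I])).comp z
        contMDiffAt_fst).prodMk_space contMDiffAt_snd
    have h2 : ContMDiffAt (I.prod 𝓘(ℝ, EuclideanSpace ℝ (Fin q))) 𝓘(ℝ, E) ∞
        (fun z : N × EuclideanSpace ℝ (Fin q) =>
          S (φ z.1, z.2) (projIcc (-2) 2 (by norm_num) 1)) z := by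
      have h3 : ContDiffAt ℝ ∞ (fun y => S y (projIcc (-2) 2 (by norm_num) 1)) (φ z.1, z.2) :=
        (ContinuousMap.evalCLM ℝ (projIcc (-2 : ℝ) 2 (by norm_num) 1) :
          C(Icc (-2 : ℝ) 2, E) →L[ℝ] E).contDiff.contDiffAt.comp _ hsm
      exact h3.contMDiffAt.comp z h1
    exact ((contMDiffOn_extChartAt_symm x₀).contMDiffAt
      (htar.mem_nhds (hrs (hball _)).1.1)).comp z h2

end LocalFlows

/-! ### Leaf topology, plaques and leaves. -/

section LeafTopology

variable {E : Type*} [NormedAddCommGroup E] [NormedSpace ℝ E]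
  {H : Type*} [TopologicalSpace H] {I : ModelWithCorners ℝ E H}
  {N : Type*} [TopologicalSpace N] [ChartedSpace H N]
  {p q : ℕ} {T : Type*} [TopologicalSpace T] [ChartedSpace (EuclideanSpace ℝ (Fin q)) T]

namespace SmoothFoliation

variable (F : SmoothFoliation I N p q T)

lemma isOpen_leafTopology_inter {u : FoliatedChart I N p q T} (hu : u ∈ F.cocycle) (t : T)
    {O : Set N} (hO : IsOpen O) : IsOpen[F.leafTopology] (O ∩ (u.dom ∩ u.map ⁻¹' {t})) :=
  TopologicalSpace.isOpen_generateFrom_of_mem ⟨u, hu, t, O, hO, rfl⟩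

/-- An open set is the union of its traces on the plaques, each of which is open for the leaf
topology. -/
lemma leafTopology_le : F.leafTopology ≤ (inferInstance : TopologicalSpace N) := by
  intro O hO
  have : O = ⋃ x ∈ O, ⋃ u ∈ F.cocycle, O ∩ (u.dom ∩ u.map ⁻¹' {u.map x}) := by
    ext x
    simp only [mem_iUnion]
    constructor
    · intro hx
      obtain ⟨u, hu, hxu⟩ := F.cover x
      exact ⟨x, hx, u, hu, hx, hxu, rfl⟩
    · rintro ⟨_, _, _, _, hx, _⟩
      exact hx
  rw [this]
  refine @isOpen_biUnion _ _ F.leafTopology _ _ fun x _ => ?_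
  refine @isOpen_biUnion _ _ F.leafTopology _ _ fun u hu => ?_
  exact F.isOpen_leafTopology_inter hu _ hO

lemma nhds_leafTopology_le (x : N) : @nhds N F.leafTopology x ≤ 𝓝 x :=
  nhds_mono F.leafTopology_le

lemma eventually_leafTopology {u : FoliatedChart I N p q T} (hu : u ∈ F.cocycle) {x : N}
    (hx : x ∈ u.dom) : ∀ᶠ y in @nhds N F.leafTopology x, y ∈ u.dom ∧ u.map y = u.map x := by
  have h : univ ∩ (u.dom ∩ u.map ⁻¹' {u.map x}) ∈ @nhds N F.leafTopology x :=
    @IsOpen.mem_nhds N F.leafTopology _ _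
      (F.isOpen_leafTopology_inter hu (u.map x) isOpen_univ) ⟨mem_univ x, hx, rfl⟩
  filter_upwards [h] with y hy
  exact hy.2

/-- A continuous map that is locally constant transversally is continuous for the leaf
topology. -/
lemma continuous_leafTopology {Z : Type*} [TopologicalSpace Z] {α : Z → N} (hα : Continuous α)
    (h : ∀ z, ∀ u ∈ F.cocycle, α z ∈ u.dom → ∀ᶠ z' in 𝓝 z, u.map (α z') = u.map (α z)) :
    @Continuous Z N _ F.leafTopology α := by
  refine continuous_generateFrom_iff.2 ?_
  rintro S ⟨u, hu, t, O, hO, rfl⟩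
  refine isOpen_iff_mem_nhds.2 fun z hz => ?_
  filter_upwards [hα.continuousAt (hO.mem_nhds hz.1), hα.continuousAt (u.isOpen_dom.mem_nhds hz.2.1),
    h z u hu hz.2.1] with z' h1 h2 h3
  exact ⟨h1, h2, h3.trans hz.2.2⟩

lemma eventually_compatible {u v : FoliatedChart I N p q T} (hu : u ∈ F.cocycle)
    (hv : v ∈ F.cocycle) {x : N} (hxu : x ∈ u.dom) (hxv : x ∈ v.dom) :
    ∀ᶠ y in 𝓝 x, u.map y = u.map x → v.map y = v.map x := by
  obtain ⟨O, hO, hxO, -, h, -, -, hh⟩ := F.compatible u hu v hv x ⟨hxu, hxv⟩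
  filter_upwards [hO.mem_nhds hxO] with y hy hyx
  rw [hh y hy, hh x hxO, hyx]

lemma mem_leaf (x : N) : x ∈ F.leaf x := @mem_connectedComponent N F.leafTopology x

lemma leaf_eq {x y : N} (h : y ∈ F.leaf x) : F.leaf y = F.leaf x :=
  (@connectedComponent_eq N F.leafTopology _ _ h).symm

/-- The image of a preconnected space under a leafwise map lies in a leaf. -/
lemma mem_leaf_of_preconnected {Z : Type*} [TopologicalSpace Z] [PreconnectedSpace Z] {α : Z → N}
    (hα : @Continuous Z N _ F.leafTopology α) (z z' : Z) : α z' ∈ F.leaf (α z) := by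
  let := F.leafTopology
  exact (isPreconnected_range hα).subset_connectedComponent (mem_range_self z) (mem_range_self z')

/-- The fibres of the members of the cocycle lie in leaves. -/
lemma mem_leaf_of_map_eq {u : FoliatedChart I N p q T} (hu : u ∈ F.cocycle) {x y : N}
    (hx : x ∈ u.dom) (hy : y ∈ u.dom) (hxy : u.map y = u.map x) : y ∈ F.leaf x := by
  obtain ⟨V, -, hV, ⟨e⟩⟩ := u.fibre (u.map x) ⟨x, hx, rfl⟩
  have : ConnectedSpace V := isConnected_iff_connectedSpace.1 hV
  have : ConnectedSpace (u.dom ∩ u.map ⁻¹' {u.map x} : Set N) :=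
    e.symm.surjective.connectedSpace e.symm.continuous
  -- The fibre is connected for the topology of `N`. Its inclusion is still continuous for the finer
  -- leaf topology, since the other members of the cocycle are locally constant on it.
  refine F.mem_leaf_of_preconnected (α := Subtype.val) (F.continuous_leafTopology
    continuous_subtype_val fun z v hv hzv => ?_)
    (⟨x, hx, rfl⟩ : (u.dom ∩ u.map ⁻¹' {u.map x} : Set N)) ⟨y, hy, hxy⟩
  filter_upwards [continuous_subtype_val.continuousAt.eventually
    (F.eventually_compatible hu hv z.2.1 hzv)] with z' h
  exact h (z'.2.2.trans z.2.2.symm)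

lemma image_leaf_subset {f : N → N}
    (hf : @Continuous N N F.leafTopology F.leafTopology f) (x : N) :
    f '' F.leaf x ⊆ F.leaf (f x) := by
  let := F.leafTopology
  exact hf.image_connectedComponent_subset x

/-- A homeomorphism for the leaf topology permutes its connected components. -/
lemma isFoliatedDiffeo_of_continuous {f : Diffeomorph I I N N ∞}
    (hf : @Continuous N N F.leafTopology F.leafTopology f)
    (hf' : @Continuous N N F.leafTopology F.leafTopology f.symm) : F.IsFoliatedDiffeo f := by
  intro x
  refine Subset.antisymm (F.image_leaf_subset hf x) fun y hy => ⟨f.symm y, ?_, by simp⟩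
  have := F.image_leaf_subset hf' (f x) (mem_image_of_mem _ hy)
  simpa using this

end SmoothFoliation

end LeafTopology

/-! ### Global flows on a compact manifold. -/

section CompactFlows

variable {E : Type} [NormedAddCommGroup E] [NormedSpace ℝ E] {H : Type*} [TopologicalSpace H]
  {I : ModelWithCorners ℝ E H} {N : Type*} [TopologicalSpace N] [ChartedSpace H N]
  [IsManifold I ∞ N]

/-- Flows of small vector fields on a compact manifold. -/
theorem exists_flow [I.Boundaryless] [FiniteDimensional ℝ E] [CompactSpace N] [T2Space N] {q : ℕ}
    {Y : ∀ x : N, EuclideanSpace ℝ (Fin q) →ₗ[ℝ] TangentSpace I x}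
    (hY : ∀ X, ContMDiff I I.tangent ∞ (fun y => (⟨y, Y y X⟩ : TangentBundle I N)))
    {U : N → Set N} (hU : ∀ x, U x ∈ 𝓝 x) :
    ∃ ε > 0, ∃ Fl : EuclideanSpace ℝ (Fin q) → N → ℝ → N,
      (∀ X ∈ Metric.ball 0 ε, ∀ x, Fl X x 0 = x ∧ IsMIntegralCurve (Fl X x) (fun y => Y y X)) ∧
      ∀ x₀, ∃ x₁, ∀ᶠ x in 𝓝 x₀, ∀ X ∈ Metric.ball 0 ε,
        (∀ t ∈ Ioo (-2 : ℝ) 2, Fl X x t ∈ U x₁) ∧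
        ContMDiffAt (I.prod 𝓘(ℝ, EuclideanSpace ℝ (Fin q))) I ∞ (fun z => Fl z.2 z.1 1) (x, X) := by
  have : IsManifold I 1 N := IsManifold.of_le (n := ∞) (by simp)
  choose O hO ε hε S hS using fun x₀ => exists_local_flow hY x₀ (hU x₀)
  obtain ⟨s, hs⟩ := CompactSpace.elim_nhds_subcover (fun x => interior (O x))
    fun x => interior_mem_nhds.2 (hO x)
  -- The least radius of a finite subcover; the value `1` serves the empty manifold.
  obtain ⟨δ, hδ, hδs⟩ : ∃ δ > 0, ∀ x ∈ s, δ ≤ ε x := by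
    rcases s.eq_empty_or_nonempty with h | h
    · exact ⟨1, one_pos, by simp [h]⟩
    · obtain ⟨x, hx, hmin⟩ := s.exists_min_image ε h
      exact ⟨ε x, hε x, hmin⟩
  have hcov : ∀ x : N, ∃ x₁ ∈ s, x ∈ interior (O x₁) := fun x => by
    have h : x ∈ ⋃ x ∈ s, interior (O x) := by rw [hs]; trivial
    simpa only [mem_iUnion, exists_prop] using h
  have hv : ∀ X, ContMDiff I I.tangent 1 (fun y => (⟨y, Y y X⟩ : TangentBundle I N)) :=
    fun X => (hY X).of_le (by simp)
  have hglob : ∀ X, ∀ x : N, ∃ γ : ℝ → N, X ∈ Metric.ball (0 : EuclideanSpace ℝ (Fin q)) δ →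
      γ 0 = x ∧ IsMIntegralCurve γ (fun y => Y y X) := by
    intro X x
    by_cases hX : X ∈ Metric.ball (0 : EuclideanSpace ℝ (Fin q)) δ
    -- A time of existence that is the same at all points lets integral curves be continued to the
    -- whole line.
    · obtain ⟨γ, h1, h2⟩ := exists_isMIntegralCurve_of_isMIntegralCurveOn (hv X) two_pos
        (fun x => by
          obtain ⟨x₁, hx₁, hx⟩ := hcov x
          have := hS x₁ (x, X) ⟨interior_subset hx, Metric.ball_subset_ball (hδs x₁ hx₁) hX⟩
          exact ⟨S x₁ (x, X), this.1, this.2.1⟩) x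
      exact ⟨γ, fun _ => ⟨h1, h2⟩⟩
    · exact ⟨fun _ => x, fun h => absurd h hX⟩
  choose Fl hFl using hglob
  refine ⟨δ, hδ, Fl, fun X hX x => hFl X x hX, fun x₀ => ?_⟩
  obtain ⟨x₁, hx₁, hx₀⟩ := hcov x₀
  refine ⟨x₁, ?_⟩
  have hball := Metric.ball_subset_ball (x := (0 : EuclideanSpace ℝ (Fin q))) (hδs x₁ hx₁)
  -- By uniqueness the global curves coincide with the local ones, from which they inherit
  -- confinement and smoothness in the parameters.
  have heq : ∀ x ∈ interior (O x₁), ∀ X ∈ Metric.ball 0 δ,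
      EqOn (Fl X x) (S x₁ (x, X)) (Ioo (-2) 2) := by
    intro x hx X hX
    have h1 := hS x₁ (x, X) ⟨interior_subset hx, hball hX⟩
    have h2 := hFl X x hX
    exact isMIntegralCurveOn_Ioo_eqOn_of_contMDiff_boundaryless (t₀ := 0) (by norm_num) (hv X)
      (h2.2.isMIntegralCurveOn _) h1.2.1 (h2.1.trans h1.1.symm)
  filter_upwards [isOpen_interior.mem_nhds hx₀] with x hx X hX
  have h1 := hS x₁ (x, X) ⟨interior_subset hx, hball hX⟩
  refine ⟨fun t ht => ?_, h1.2.2.2.congr_of_eventuallyEq ?_⟩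
  · rw [heq x hx X hX ht]
    exact h1.2.2.1 t ht
  · filter_upwards [(isOpen_interior.prod Metric.isOpen_ball).mem_nhds
      (show (x, X) ∈ interior (O x₁) ×ˢ Metric.ball 0 δ from ⟨hx, hX⟩)] with z hz
    exact heq z.1 hz.1 z.2 hz.2 (by norm_num)

end CompactFlows

/-! ### Separation of Lie groups and one-parameter paths. -/

section Groups

/-- The T1 axiom is local, unlike the Hausdorff one. For a Lie group it is enough, as a T1
topological group is Hausdorff; uniqueness of integral curves in `G` relies on this. -/
lemma t1Space_of_chartedSpace (H : Type*) [TopologicalSpace H] [T1Space H] (N : Type*)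
    [TopologicalSpace N] [ChartedSpace H N] : T1Space N := by
  refine ⟨fun x => isOpen_compl_iff.1 (isOpen_iff_mem_nhds.2 fun y hy => ?_)⟩
  by_cases hx : x ∈ (chartAt H y).source
  · have h1 : (chartAt H y).source ∩ chartAt H y ⁻¹' {chartAt H y x}ᶜ ∈ 𝓝 y :=
      ((chartAt H y).isOpen_inter_preimage isOpen_compl_singleton).mem_nhds
        ⟨mem_chart_source H y, fun h =>
          hy ((chartAt H y).injOn (mem_chart_source H y) hx h)⟩
    filter_upwards [h1] with z hz hzx
    exact hz.2 (by rw [mem_singleton_iff.1 hzx]; rfl)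
  · filter_upwards [chart_source_mem_nhds H y] with z hz hzx
    exact hx (by rwa [← mem_singleton_iff.1 hzx])

variable {E : Type*} [NormedAddCommGroup E] [NormedSpace ℝ E]
  {G : Type*} [TopologicalSpace G] [ChartedSpace E G] [Group G] [LieGroup 𝓘(ℝ, E) ∞ G]

lemma t2Space_of_lieGroup (E : Type*) [NormedAddCommGroup E] [NormedSpace ℝ E]
    {G : Type*} [TopologicalSpace G] [ChartedSpace E G] [Group G] [LieGroup 𝓘(ℝ, E) ∞ G] :
    T2Space G := by
  have : IsTopologicalGroup G := topologicalGroup_of_lieGroup 𝓘(ℝ, E) ∞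
  have : T1Space G := t1Space_of_chartedSpace E G
  infer_instance

lemma IsMIntegralCurveOn.mul_left {X : GroupLieAlgebra 𝓘(ℝ, E) G} {c : ℝ → G} {s : Set ℝ}
    (hc : IsMIntegralCurveOn c (mulInvariantVectorField (I := 𝓘(ℝ, E)) X) s) (g : G) :
    IsMIntegralCurveOn (fun t => g * c t) (mulInvariantVectorField (I := 𝓘(ℝ, E)) X) s := by
  intro t ht
  have h1 : MDifferentiableAt 𝓘(ℝ, E) 𝓘(ℝ, E) (fun y => g * y) (c t) :=
    (contMDiff_mul_left (n := ∞)).contMDiffAt.mdifferentiableAt (by simp)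
  refine (h1.hasMFDerivAt.comp_hasMFDerivWithinAt t (hc t ht)).congr_mfderiv ?_
  refine ContinuousLinearMap.ext fun a' => ?_
  let a : ℝ := a'
  refine (map_smul (mfderiv 𝓘(ℝ, E) 𝓘(ℝ, E) (fun y => g * y) (c t)) a
    (mulInvariantVectorField X (c t))).trans ?_
  rw [mfderiv_mul_left_mulInvariantVectorField]
  rfl

/-- Left translates of one short integral curve through the identity give the same time of existence
at every point, hence completeness. -/
lemma exists_isMIntegralCurve_mulInvariantVectorField [CompleteSpace E]
    (X : GroupLieAlgebra 𝓘(ℝ, E) G) :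
    ∃ c : ℝ → G, c 0 = 1 ∧ IsMIntegralCurve c (mulInvariantVectorField (I := 𝓘(ℝ, E)) X) := by
  have : T2Space G := t2Space_of_lieGroup E
  have : IsManifold 𝓘(ℝ, E) 1 G := IsManifold.of_le (n := ∞) (by simp)
  have hv : ContMDiff 𝓘(ℝ, E) 𝓘(ℝ, E).tangent 1
    (fun g => (⟨g, mulInvariantVectorField X g⟩ : TangentBundle 𝓘(ℝ, E) G)) :=
    (contMDiff_infty_mulInvariantVectorField X).of_le (by simp)
  obtain ⟨γ, hγ0, hγ⟩ := exists_isMIntegralCurveAt_of_contMDiffAt_boundaryless 0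
    (hv.contMDiffAt (x := 1))
  obtain ⟨ε, hε, hγε⟩ := isMIntegralCurveAt_iff'.1 hγ
  rw [Real.ball_eq_Ioo, zero_sub, zero_add] at hγε
  exact exists_isMIntegralCurve_of_isMIntegralCurveOn hv hε
    (fun g => ⟨fun t => g * γ t, by simp [hγ0], hγε.mul_left g⟩) 1

end Groups

/-! ### Openness of maps with surjective differential. -/

section InverseFunction

variable {E P : Type*} [NormedAddCommGroup E] [NormedSpace ℝ E] [CompleteSpace E]
  [NormedAddCommGroup P] [NormedSpace ℝ P] [CompleteSpace P]
  {N : Type*} [TopologicalSpace N] [ChartedSpace E N] [IsManifold 𝓘(ℝ, E) ∞ N]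

/-- A smooth map with surjective differential at a point is open at this point. -/
lemma map_nhds_eq_of_mfderiv_surjective {f : P → N} {x : P}
    (hf : ContMDiffAt 𝓘(ℝ, P) 𝓘(ℝ, E) ∞ f x)
    (h : Function.Surjective (mfderiv 𝓘(ℝ, P) 𝓘(ℝ, E) f x)) : map f (𝓝 x) = 𝓝 (f x) := by
  have : IsManifold 𝓘(ℝ, E) 1 N := IsManifold.of_le (n := ∞) (by simp)
  set φ := extChartAt 𝓘(ℝ, E) (f x) with hφ
  have hc : ContMDiffAt 𝓘(ℝ, P) 𝓘(ℝ, E) ∞ (φ ∘ f) x := contMDiffAt_extChartAt.comp x hf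
  have hc' : ContDiffAt ℝ ∞ (φ ∘ f) x := hc.contDiffAt
  have hd : HasStrictFDerivAt (φ ∘ f) (fderiv ℝ (φ ∘ f) x) x := hc'.hasStrictFDerivAt (by simp)
  have hsurj : Function.Surjective (fderiv ℝ (φ ∘ f) x) := by
    rw [← mfderiv_eq_fderiv]
    have h1 : MDifferentiableAt 𝓘(ℝ, E) 𝓘(ℝ, E) φ (f x) :=
      mdifferentiableAt_extChartAt (mem_chart_source E (f x))
    have h2 : Function.Surjective (mfderiv 𝓘(ℝ, E) 𝓘(ℝ, E) φ (f x)) :=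
      (isInvertible_mfderiv_extChartAt (mem_extChartAt_source (f x))).bijective.surjective
    intro w
    obtain ⟨w', hw'⟩ := h2 w
    obtain ⟨w'', hw''⟩ := h w'
    refine ⟨w'', ?_⟩
    refine (mfderiv_comp_apply x h1 (hf.mdifferentiableAt (by simp)) w'').trans ?_
    rw [hw'', hw']
  have h3 := hd.map_nhds_eq_of_surj (LinearMap.range_eq_top.2 hsurj)
  have h4 : map φ.symm (𝓝 (φ (f x))) = 𝓝 (f x) := by
    have := map_extChartAt_symm_nhdsWithin_range (I := 𝓘(ℝ, E)) (f x)
    rwa [ModelWithCorners.range_eq_univ, nhdsWithin_univ] at this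
  rw [← h4, show φ (f x) = (φ ∘ f) x from rfl, ← h3, map_map]
  refine Filter.map_congr ?_
  filter_upwards [hf.continuousAt (extChartAt_source_mem_nhds (I := 𝓘(ℝ, E)) (f x))] with y hy
  exact (φ.left_inv hy).symm

end InverseFunction

/-! ### Transports along one-parameter paths. -/

section Transports

variable {p q : ℕ}
  {M : Type*} [TopologicalSpace M] [ChartedSpace (EuclideanSpace ℝ (Fin (p + q))) M]
  [IsManifold (𝓡 (p + q)) ∞ M]
  {G : Type*} [TopologicalSpace G] [ChartedSpace (EuclideanSpace ℝ (Fin q)) G] [Group G]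

namespace SmoothFoliation

/-- `φ` is the transport along a piecewise smooth path from the identity to `a`. -/
def IsTransportTo (F : SmoothFoliation (𝓡 (p + q)) M p q G)
    (ν : ∀ x : M, Submodule ℝ (TangentSpace (𝓡 (p + q)) x))
    (φ : Diffeomorph (𝓡 (p + q)) (𝓡 (p + q)) M M ∞) (a : G) : Prop :=
  ∃ c : ℝ → G, (∃ P, IsPiecewiseSmoothPath (𝓡 q) P c) ∧ c 0 = 1 ∧ c 1 = a ∧ F.IsTransport ν c φ

/-- The fields `Y X` are transverse lifts of the left invariant fields `X`. -/
def IsTransverseLift (F : SmoothFoliation (𝓡 (p + q)) M p q G)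
    (Y : ∀ x : M, EuclideanSpace ℝ (Fin q) →ₗ[ℝ] TangentSpace (𝓡 (p + q)) x) : Prop :=
  ∀ X : EuclideanSpace ℝ (Fin q), ∀ u ∈ F.cocycle, ∀ x ∈ u.dom,
    mfderiv (𝓡 (p + q)) (𝓡 q) u.map x (Y x X) =
      mulInvariantVectorField (I := 𝓡 q) (G := G) X (u.map x)

variable {F : SmoothFoliation (𝓡 (p + q)) M p q G}
  {Y : ∀ x : M, EuclideanSpace ℝ (Fin q) →ₗ[ℝ] TangentSpace (𝓡 (p + q)) x}
  [LieGroup (𝓡 q) ∞ G]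

/-- The derivative of a submersion of the cocycle has the tangent space of `F` as kernel and maps
the range of `Y x` isomorphically onto the tangent space of `G`. -/
lemma IsTransverseLift.isComplement (hF : F.IsLie) (hY : F.IsTransverseLift Y)
    (hYs : ∀ X, ContMDiff (𝓡 (p + q)) (𝓡 (p + q)).tangent ∞
      (fun y => (⟨y, Y y X⟩ : TangentBundle (𝓡 (p + q)) M))) :
    F.IsComplement fun x => LinearMap.range (Y x) := by
  have hinj : ∀ x, ∀ X : EuclideanSpace ℝ (Fin q),
      mulInvariantVectorField (I := 𝓡 q) (G := G) X x = 0 → X = 0 := by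
    intro g X hX
    refine (mulInvariantVectorField_bijective (I := 𝓡 q) g).injective ?_
    exact hX.trans (map_zero (mfderiv (𝓡 q) (𝓡 q) (fun y => g * y) (1 : G))).symm
  refine ⟨fun x => ⟨univ, isOpen_univ, mem_univ x, fun i y => Y y (EuclideanSpace.single i 1),
    fun i => (hYs _).contMDiffOn, fun y _ => ⟨?_, ?_⟩⟩, fun x => ?_⟩
  · obtain ⟨u, hu, hyu⟩ := F.cover y
    have h1 := (EuclideanSpace.basisFun (Fin q) ℝ).toBasis.linearIndependent
    have h2 : LinearMap.ker (Y y) = ⊥ := by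
      refine LinearMap.ker_eq_bot'.2 fun X hX => hinj (u.map y) X ?_
      rw [← hY X u hu y hyu, hX]
      exact map_zero _
    have h3 := h1.map' (Y y) h2
    convert! h3 using 2 with i
    simp
  · change Submodule.span ℝ (range fun i => Y y (EuclideanSpace.single i 1)) = LinearMap.range (Y y)
    rw [LinearMap.range_eq_map, ← (EuclideanSpace.basisFun (Fin q) ℝ).toBasis.span_eq,
      Submodule.map_span, ← range_comp]
    congr 2
    ext i
    simp
  · obtain ⟨u, hu, hxu⟩ := F.cover x
    refine ⟨Submodule.disjoint_def.2 ?_, codisjoint_iff_le_sup.2 fun w _ => ?_⟩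
    · rintro _ ⟨X, rfl⟩ hX
      rw [hF.mem_tangent_iff hu hxu, hY X u hu x hxu] at hX
      rw [hinj _ X hX, map_zero]
    · obtain ⟨X, hX⟩ := (mulInvariantVectorField_bijective (I := 𝓡 q) (u.map x)).surjective
        (mfderiv (𝓡 (p + q)) (𝓡 q) u.map x w)
      refine Submodule.mem_sup.2 ⟨Y x X, ⟨X, rfl⟩, w - Y x X, ?_, by abel⟩
      rw [hF.mem_tangent_iff hu hxu, map_sub, hY X u hu x hxu, sub_eq_zero]
      exact hX.symm

omit [IsManifold (𝓡 (p + q)) ∞ M] [LieGroup (𝓡 q) ∞ G] in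
lemma IsTransverseLift.hasMFDerivAt_map (hY : F.IsTransverseLift Y)
    {u : FoliatedChart (𝓡 (p + q)) M p q G} (hu : u ∈ F.cocycle) {X : EuclideanSpace ℝ (Fin q)}
    {γ : ℝ → M} (hγ : IsMIntegralCurve γ fun y => Y y X) {t : ℝ} (ht : γ t ∈ u.dom) :
    HasMFDerivAt 𝓘(ℝ, ℝ) (𝓡 q) (fun t => u.map (γ t)) t ((1 : ℝ →L[ℝ] ℝ).smulRight
      (mulInvariantVectorField (I := 𝓡 q) (G := G) X (u.map (γ t)))) := by
  refine ((u.mdifferentiableAt ht).hasMFDerivAt.comp t (hγ t)).congr_mfderiv ?_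
  refine ContinuousLinearMap.ext fun a' => ?_
  let a : ℝ := a'
  refine (map_smul (mfderiv (𝓡 (p + q)) (𝓡 q) u.map (γ t)) a (Y (γ t) X)).trans ?_
  rw [hY X u hu _ ht]
  rfl

lemma contMDiff_one_mulInvariantVectorField (X : EuclideanSpace ℝ (Fin q)) :
    ContMDiff (𝓡 q) (𝓡 q).tangent 1
      (fun g => (⟨g, mulInvariantVectorField (I := 𝓡 q) X g⟩ : TangentBundle (𝓡 q) G)) :=
  (contMDiff_infty_mulInvariantVectorField (I := 𝓡 q) (G := G) X).of_le (by simp)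

omit [IsManifold (𝓡 (p + q)) ∞ M] in
/-- The submersions of the cocycle map transverse integral curves locally to left translates. -/
lemma IsTransverseLift.eventually_map_eq (hY : F.IsTransverseLift Y)
    {u : FoliatedChart (𝓡 (p + q)) M p q G} (hu : u ∈ F.cocycle) {X : EuclideanSpace ℝ (Fin q)}
    {γ : ℝ → M} (hγ : IsMIntegralCurve γ fun y => Y y X) {c : ℝ → G}
    (hc : IsMIntegralCurve c (mulInvariantVectorField (I := 𝓡 q) (G := G) X))
    {t₀ : ℝ} (ht : γ t₀ ∈ u.dom) :
    ∀ᶠ t in 𝓝 t₀, u.map (γ t) = u.map (γ t₀) * (c t₀)⁻¹ * c t := by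
  have : IsManifold (𝓡 q) 1 G := IsManifold.of_le (n := ∞) (by simp)
  have h1 : IsMIntegralCurveAt (fun t => u.map (γ t))
      (mulInvariantVectorField (I := 𝓡 q) (G := G) X) t₀ := by
    filter_upwards [hγ.continuous.continuousAt (u.isOpen_dom.mem_nhds ht)] with t ht'
    exact hY.hasMFDerivAt_map hu hγ ht'
  have h2 : IsMIntegralCurveAt (fun t => u.map (γ t₀) * (c t₀)⁻¹ * c t)
      (mulInvariantVectorField (I := 𝓡 q) (G := G) X) t₀ :=
    ((hc.isMIntegralCurveOn univ).mul_left _).isMIntegralCurveAt univ_mem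
  exact isMIntegralCurveAt_eventuallyEq_of_contMDiffAt_boundaryless
    ((contMDiff_one_mulInvariantVectorField X).contMDiffAt) h1 h2 (by simp)

-- Uniqueness of integral curves in `G`. For curves that stay in one domain during `(-2, 2)`, the
-- time-one map acts on the values of `u` as right multiplication by `c 1`.
omit [IsManifold (𝓡 (p + q)) ∞ M] in
lemma IsTransverseLift.map_eq_mul (hY : F.IsTransverseLift Y)
    {u : FoliatedChart (𝓡 (p + q)) M p q G} (hu : u ∈ F.cocycle) {X : EuclideanSpace ℝ (Fin q)}
    {γ : ℝ → M} (hγ : IsMIntegralCurve γ fun y => Y y X) {c : ℝ → G} (hc0 : c 0 = 1)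
    (hc : IsMIntegralCurve c (mulInvariantVectorField (I := 𝓡 q) (G := G) X))
    (hγu : ∀ t ∈ Ioo (-2 : ℝ) 2, γ t ∈ u.dom) {t : ℝ} (ht : t ∈ Ioo (-2 : ℝ) 2) :
    u.map (γ t) = u.map (γ 0) * c t := by
  have : IsManifold (𝓡 q) 1 G := IsManifold.of_le (n := ∞) (by simp)
  have : T2Space G := t2Space_of_lieGroup (EuclideanSpace ℝ (Fin q))
  have h1 : IsMIntegralCurveOn (fun t => u.map (γ t))
      (mulInvariantVectorField (I := 𝓡 q) (G := G) X) (Ioo (-2) 2) :=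
    fun t ht => (hY.hasMFDerivAt_map hu hγ (hγu t ht)).hasMFDerivWithinAt
  have h2 := ((hc.isMIntegralCurveOn (Ioo (-2) 2)).mul_left (u.map (γ 0)))
  exact isMIntegralCurveOn_Ioo_eqOn_of_contMDiff_boundaryless (t₀ := 0) (by norm_num)
    (contMDiff_one_mulInvariantVectorField X) h1 h2 (by simp [hc0]) ht

lemma isPiecewiseSmoothPath_of_contMDiff {E : Type*} [NormedAddCommGroup E] [NormedSpace ℝ E]
    {H : Type*} [TopologicalSpace H] {I : ModelWithCorners ℝ E H} {N : Type*} [TopologicalSpace N]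
    [ChartedSpace H N] {γ : ℝ → N} (hγ : ContMDiff 𝓘(ℝ, ℝ) I ∞ γ) :
    IsPiecewiseSmoothPath I ∅ γ :=
  ⟨hγ.continuous.continuousOn, fun _ _ _ _ _ => hγ.contMDiffOn⟩

lemma IsTransverseLift.isHorizontalLift (hY : F.IsTransverseLift Y)
    (hYs : ∀ X, ContMDiff (𝓡 (p + q)) (𝓡 (p + q)).tangent ∞
      (fun y => (⟨y, Y y X⟩ : TangentBundle (𝓡 (p + q)) M)))
    {X : EuclideanSpace ℝ (Fin q)} {γ : ℝ → M} (hγ : IsMIntegralCurve γ fun y => Y y X) {c : ℝ → G}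
    (hc : IsMIntegralCurve c (mulInvariantVectorField (I := 𝓡 q) (G := G) X)) :
    F.IsHorizontalLift (fun x => LinearMap.range (Y x)) c (γ 0) γ := by
  refine ⟨rfl, ⟨∅, isPiecewiseSmoothPath_of_contMDiff fun t =>
    (hγ.isMIntegralCurveAt t).contMDiffAt (hYs X), fun t _ _ => ⟨X, ?_⟩⟩,
    fun t₀ _ u hu ht => ⟨_, nhdsWithin_le_nhds (hY.eventually_map_eq hu hγ hc ht)⟩⟩
  rw [(hγ t).mfderiv]
  exact (one_smul ℝ (Y (γ t) X)).symm

/-- Transports along short one-parameter paths reach all points near a given one, up to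
moving in the leaves. -/
theorem IsLie.exists_small_transports [T2Space M] [CompactSpace M] (hF : F.IsLie) :
    ∃ ν : ∀ x : M, Submodule ℝ (TangentSpace (𝓡 (p + q)) x), F.IsComplement ν ∧
      ∀ x₀ : M, ∃ u ∈ F.cocycle, x₀ ∈ u.dom ∧ ∀ᶠ y in 𝓝 x₀, y ∈ u.dom ∧
        ∃ φ a, F.IsTransportTo ν φ a ∧ F.IsTransportTo ν φ.symm a⁻¹ ∧ φ x₀ ∈ u.dom ∧
          u.map (φ x₀) = u.map y ∧ u.map (φ x₀) = u.map x₀ * a := by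
  obtain ⟨Y, hYs, hY⟩ := hF.exists_transverse_fields
  have hY : F.IsTransverseLift Y := hY
  have hM1 : IsManifold (𝓡 (p + q)) 1 M := IsManifold.of_le (n := ∞) (by simp)
  have hG1 : IsManifold (𝓡 q) 1 G := IsManifold.of_le (n := ∞) (by simp)
  have : T2Space G := t2Space_of_lieGroup (EuclideanSpace ℝ (Fin q))
  choose ch hch hchx using F.cover
  obtain ⟨ε, hε, Fl, hFl, hloc⟩ := exists_flow hYs
    (U := fun x => (ch x).dom) (fun x => (ch x).isOpen_dom.mem_nhds (hchx x))
  choose c hc0 hc using fun X : EuclideanSpace ℝ (Fin q) =>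
    exists_isMIntegralCurve_mulInvariantVectorField (E := EuclideanSpace ℝ (Fin q)) (G := G) X
  have hv : ∀ X, ContMDiff (𝓡 (p + q)) (𝓡 (p + q)).tangent 1
      (fun y => (⟨y, Y y X⟩ : TangentBundle (𝓡 (p + q)) M)) := fun X => (hYs X).of_le (by simp)
  have hneg : ∀ X ∈ Metric.ball (0 : EuclideanSpace ℝ (Fin q)) ε, -X ∈ Metric.ball 0 ε :=
    fun X hX => by simpa using hX
  -- the time-one maps of opposite fields are inverse to each other
  have hinv : ∀ X ∈ Metric.ball (0 : EuclideanSpace ℝ (Fin q)) ε, ∀ x,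
      Fl (-X) (Fl X x 1) 1 = x := by
    intro X hX x
    have h1 : IsMIntegralCurve (fun t => Fl X x (-t + 1)) (fun y => Y y (-X)) := by
      have h2 := (((hFl X hX x).2.comp_add 1).comp_mul (-1))
      have h3 : ((-1 : ℝ) • fun y => Y y X) = fun y => Y y (-X) := by
        ext1 y
        simp
      rw [h3] at h2
      convert! h2 using 1
      ext1 t
      simp
    have h4 := isMIntegralCurve_Ioo_eq_of_contMDiff_boundaryless (t₀ := 0) (hv (-X))
      (hFl (-X) (hneg X hX) (Fl X x 1)).2 h1 (by rw [(hFl (-X) (hneg X hX) _).1]; simp)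
    have h5 := congrFun h4 1
    simp only [neg_add_cancel] at h5
    rw [h5, (hFl X hX x).1]
  have hcinv : ∀ X, c (-X) 1 = (c X 1)⁻¹ := by
    intro X
    -- The reversed path, translated so that it starts at the identity; it ends at `(c X 1)⁻¹`.
    have h1 : IsMIntegralCurve (fun t => (c X 1)⁻¹ * c X (-t + 1))
        (mulInvariantVectorField (I := 𝓡 q) (G := G) (-X)) := by
      have h2 := (((hc X).comp_add 1).comp_mul (-1))
      have h3 : (-1 : ℝ) • mulInvariantVectorField (I := 𝓡 q) (G := G) X =
          mulInvariantVectorField (I := 𝓡 q) (G := G) (-X) := by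
        funext g
        exact (map_smul (mfderiv (𝓡 q) (𝓡 q) (fun y => g * y) (1 : G)) (-1 : ℝ) X).symm.trans
          (congrArg (mfderiv (𝓡 q) (𝓡 q) (fun y => g * y) (1 : G)) (neg_one_smul ℝ X))
      rw [h3] at h2
      have h4 := isMIntegralCurve_iff_isMIntegralCurveOn.2
        ((h2.isMIntegralCurveOn univ).mul_left (c X 1)⁻¹)
      convert! h4 using 1
      ext1 t
      simp
    have h4 := isMIntegralCurve_Ioo_eq_of_contMDiff_boundaryless (t₀ := 0)
      (contMDiff_one_mulInvariantVectorField (-X)) (hc (-X)) h1 (by simp [hc0])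
    have h5 := congrFun h4 1
    simpa [hc0] using h5
  have hsm : ∀ X ∈ Metric.ball (0 : EuclideanSpace ℝ (Fin q)) ε,
      ContMDiff (𝓡 (p + q)) (𝓡 (p + q)) ∞ (fun x => Fl X x 1) := by
    intro X hX x
    obtain ⟨x₁, h⟩ := hloc x
    exact ContMDiffAt.comp x (f := fun x : M => (x, X)) (h.self_of_nhds X hX).2
      (contMDiffAt_id.prodMk contMDiffAt_const)
  let φ : ∀ X ∈ Metric.ball (0 : EuclideanSpace ℝ (Fin q)) ε,
      Diffeomorph (𝓡 (p + q)) (𝓡 (p + q)) M M ∞ := fun X hX =>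
    { toFun := fun x => Fl X x 1
      invFun := fun x => Fl (-X) x 1
      left_inv := hinv X hX
      right_inv := fun x => by simpa using hinv (-X) (hneg X hX) x
      contMDiff_toFun := hsm X hX
      contMDiff_invFun := hsm (-X) (hneg X hX) }
  -- In one chart of the cocycle the time-one map multiplies values on the right by `c X 1`, so
  -- nearby points of a plaque are sent to a single plaque.
  have hleafc : ∀ X ∈ Metric.ball (0 : EuclideanSpace ℝ (Fin q)) ε,
      @Continuous M M F.leafTopology F.leafTopology (fun x => Fl X x 1) := by
    intro X hX
    have hcont : @Continuous M M F.leafTopology _ (fun x => Fl X x 1) :=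
      continuous_le_dom F.leafTopology_le (hsm X hX).continuous
    refine @continuous_leafTopology _ _ _ _ _ _ _ _ _ _ _ _ _ _ F M F.leafTopology _ hcont ?_
    intro x v hv hxv
    obtain ⟨x₁, h⟩ := hloc x
    have hx := (h.self_of_nhds X hX).1
    have hux : x ∈ (ch x₁).dom := by
      have := hx 0 (by norm_num); rwa [(hFl X hX x).1] at this
    filter_upwards [F.nhds_leafTopology_le x h, F.eventually_leafTopology (hch x₁) hux,
      F.nhds_leafTopology_le x (((hsm X hX).continuous.tendsto x).eventually
        (F.eventually_compatible (hch x₁) hv (hx 1 (by norm_num)) hxv))]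
      with y h1 h2 h3
    refine h3 ?_
    have key : ∀ z, (∀ t ∈ Ioo (-2 : ℝ) 2, Fl X z t ∈ (ch x₁).dom) →
        (ch x₁).map (Fl X z 1) = (ch x₁).map z * c X 1 := fun z hz => by
      have := hY.map_eq_mul (hch x₁) (hFl X hX z).2 (hc0 X) (hc X) hz (t := 1) (by norm_num)
      rwa [(hFl X hX z).1] at this
    rw [key y (h1 X hX).1, key x hx, h2.2]
  have htr : ∀ X (hX : X ∈ Metric.ball (0 : EuclideanSpace ℝ (Fin q)) ε),
      F.IsTransportTo (fun x => LinearMap.range (Y x)) (φ X hX) (c X 1) := by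
    intro X hX
    refine ⟨c X, ⟨∅, isPiecewiseSmoothPath_of_contMDiff fun t =>
      ((hc X).isMIntegralCurveAt t).contMDiffAt (contMDiff_infty_mulInvariantVectorField _)⟩,
      hc0 X, rfl, F.isFoliatedDiffeo_of_continuous (hleafc X hX) (hleafc (-X) (hneg X hX)),
      fun x => ⟨Fl X x, ?_, rfl⟩⟩
    have := hY.isHorizontalLift hYs (hFl X hX x).2 (hc X)
    rwa [(hFl X hX x).1] at this
  refine ⟨fun x => LinearMap.range (Y x), hY.isComplement hF hYs, fun x₀ => ?_⟩
  obtain ⟨x₁, h⟩ := hloc x₀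
  have h0 : (0 : EuclideanSpace ℝ (Fin q)) ∈ Metric.ball 0 ε := Metric.mem_ball_self hε
  have hx := fun X hX => (h.self_of_nhds X hX).1
  have hux : x₀ ∈ (ch x₁).dom := by
    have := hx 0 h0 0 (by norm_num); rwa [(hFl 0 h0 x₀).1] at this
  have hFl0 : Fl 0 x₀ 1 = x₀ := by
    have h1 : IsMIntegralCurve (fun _ => x₀) (fun y => Y y 0) := isMIntegralCurve_const (by simp)
    exact congrFun (isMIntegralCurve_Ioo_eq_of_contMDiff_boundaryless (t₀ := 0) (hv 0)
      (hFl 0 h0 x₀).2 h1 (hFl 0 h0 x₀).1) 1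
  have hFls : ContMDiffAt (𝓡 q) (𝓡 (p + q)) ∞ (fun X => Fl X x₀ 1) 0 :=
    ContMDiffAt.comp (0 : EuclideanSpace ℝ (Fin q)) (f := fun X => (x₀, X))
      (h.self_of_nhds 0 h0).2 (contMDiffAt_const.prodMk contMDiffAt_id)
  let g : EuclideanSpace ℝ (Fin q) → G := fun X => (ch x₁).map (Fl X x₀ 1)
  have hg0 : g 0 = (ch x₁).map x₀ := by simp only [g, hFl0]
  have hgs : ContMDiffAt (𝓡 q) (𝓡 q) ∞ g 0 :=
    ContMDiffAt.comp (0 : EuclideanSpace ℝ (Fin q)) (f := fun X => Fl X x₀ 1)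
      ((ch x₁).contMDiffAt (by simpa only [hFl0] using hux)) hFls
  -- the differential of `g` at `0`
  have hgd : ∀ X ∈ Metric.ball (0 : EuclideanSpace ℝ (Fin q)) ε, mfderiv (𝓡 q) (𝓡 q) g 0 X =
      mulInvariantVectorField (I := 𝓡 q) (G := G) X ((ch x₁).map x₀) := by
    intro X hX
    -- Rescaling time turns the ray `s ↦ s • X` into the flow line of `X`, whose velocity is known;
    -- this computes the derivative of `g` at `0` in the direction `X`.
    have hscale : ∀ s ∈ Icc (-1 : ℝ) 1, Fl (s • X) x₀ 1 = Fl X x₀ s := by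
      intro s hs
      have hsX : s • X ∈ Metric.ball (0 : EuclideanSpace ℝ (Fin q)) ε := by
        rw [mem_ball_zero_iff] at hX ⊢
        rw [norm_smul]
        refine lt_of_le_of_lt ?_ hX
        exact mul_le_of_le_one_left (norm_nonneg X) (abs_le.2 hs)
      have h2 := ((hFl X hX x₀).2.comp_mul s)
      have h3 : (s • fun y => Y y X) = fun y => Y y (s • X) := by
        ext1 y
        simp
      rw [h3] at h2
      have h4 := congrFun (isMIntegralCurve_Ioo_eq_of_contMDiff_boundaryless (t₀ := 0) (hv (s • X))
        (hFl (s • X) hsX x₀).2 h2 (by simp [(hFl (s • X) hsX x₀).1, (hFl X hX x₀).1])) 1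
      simpa using h4
    have h1 : HasMFDerivAt 𝓘(ℝ, ℝ) (𝓡 q) (fun s : ℝ => g (s • X)) 0
        (((1 : ℝ →L[ℝ] ℝ).smulRight
          (mulInvariantVectorField (I := 𝓡 q) (G := G) X ((ch x₁).map (Fl X x₀ 0))))) := by
      refine (hY.hasMFDerivAt_map (hch x₁) (hFl X hX x₀).2
        (hx X hX 0 (by norm_num))).congr_of_eventuallyEq ?_
      filter_upwards [Icc_mem_nhds (by norm_num : (-1 : ℝ) < 0) one_pos] with s hs
      simp only [g, hscale s hs]
    have h2 : HasMFDerivAt 𝓘(ℝ, ℝ) (𝓡 q) (fun s : ℝ => s • X) 0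
        ((1 : ℝ →L[ℝ] ℝ).smulRight X : ℝ →L[ℝ] EuclideanSpace ℝ (Fin q)) :=
      ((hasDerivAt_id (0 : ℝ)).smul_const X).hasFDerivAt.hasMFDerivAt.congr_mfderiv (by
        refine ContinuousLinearMap.ext fun a => ?_
        simp)
    have h3 : HasMFDerivAt (𝓡 q) (𝓡 q) g ((0 : ℝ) • X) (mfderiv (𝓡 q) (𝓡 q) g 0) := by
      rw [zero_smul]
      exact (hgs.mdifferentiableAt (by simp)).hasMFDerivAt
    have h4 := DFunLike.congr_fun (hasMFDerivAt_unique (h3.comp (0 : ℝ) h2) h1) (1 : ℝ)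
    have h5 : mfderiv (𝓡 q) (𝓡 q) g 0 ((1 : ℝ) • X) = (1 : ℝ) •
      mulInvariantVectorField (I := 𝓡 q) (G := G) X ((ch x₁).map (Fl X x₀ 0)) := h4
    rw [one_smul, one_smul, (hFl X hX x₀).1] at h5
    exact h5
  have hgsurj : Function.Surjective (mfderiv (𝓡 q) (𝓡 q) g 0) := by
    intro w
    obtain ⟨X, hX⟩ : ∃ X : EuclideanSpace ℝ (Fin q),
        mulInvariantVectorField (I := 𝓡 q) (G := G) X ((ch x₁).map x₀) = w :=
      (mulInvariantVectorField_bijective (I := 𝓡 q) ((ch x₁).map x₀)).surjective w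
    -- The derivative was computed only on small vectors; linearity extends the formula to all of
    -- them.
    obtain ⟨r, hr, hrX⟩ : ∃ r : ℝ, r ≠ 0 ∧ r • X ∈
        Metric.ball (0 : EuclideanSpace ℝ (Fin q)) ε := by
      have h1 : Tendsto (fun r : ℝ => r • X) (𝓝[≠] 0) (𝓝 0) := by
        have : Continuous (fun r : ℝ => r • X) := by fun_prop
        have h2 := this.tendsto 0
        rw [zero_smul] at h2
        exact h2.mono_left nhdsWithin_le_nhds
      obtain ⟨r, h2, h3⟩ := ((h1.eventually (Metric.ball_mem_nhds _ hε)).and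
        self_mem_nhdsWithin).exists
      exact ⟨r, h3, h2⟩
    refine ⟨X, ?_⟩
    have h1 := hgd _ hrX
    have h2 : mulInvariantVectorField (I := 𝓡 q) (G := G) (r • X)
        ((ch x₁).map x₀) = r • w := by
      rw [← hX]
      exact map_smul (mfderiv (𝓡 q) (𝓡 q) (fun y => (ch x₁).map x₀ * y) (1 : G)) r X
    have h3 : r • mfderiv (𝓡 q) (𝓡 q) g 0 X = r • w :=
      (map_smul (mfderiv (𝓡 q) (𝓡 q) g 0) r X).symm.trans (h1.trans h2)
    exact smul_right_injective _ hr h3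
  have hmap := map_nhds_eq_of_mfderiv_surjective hgs hgsurj
  have hdom : ∀ᶠ X in 𝓝 (0 : EuclideanSpace ℝ (Fin q)), Fl X x₀ 1 ∈ (ch x₁).dom ∧
      X ∈ Metric.ball 0 ε :=
    ((hFls.continuousAt).eventually ((ch x₁).isOpen_dom.mem_nhds (by simpa only [hFl0] using hux))).and
      (Metric.ball_mem_nhds _ hε)
  refine ⟨ch x₁, hch x₁, hux, ?_⟩
  -- Openness of `g` at `0`: every value of the submersion near that of `x₀` is attained at the end
  -- of a short flow line from `x₀`.
  have himg : g '' {X | Fl X x₀ 1 ∈ (ch x₁).dom ∧ X ∈ Metric.ball 0 ε} ∈ 𝓝 ((ch x₁).map x₀) := by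
    rw [← hg0, ← hmap]
    exact image_mem_map hdom
  filter_upwards [((ch x₁).contMDiffAt hux).continuousAt himg, (ch x₁).isOpen_dom.mem_nhds hux]
    with y hy hyu
  obtain ⟨X, ⟨hXd, hX⟩, hXy⟩ := hy
  refine ⟨hyu, φ X hX, c X 1, htr X hX, ?_, hXd, hXy, ?_⟩
  · rw [← hcinv]
    have h1 := htr (-X) (hneg X hX)
    have h2 : (φ X hX).symm = φ (-X) (hneg X hX) := by
      ext x
      rfl
    rwa [h2]
  · have := hY.map_eq_mul (hch x₁) (hFl X hX x₀).2 (hc0 X) (hc X) (hx X hX) (t := 1) (by norm_num)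
    rwa [(hFl X hX x₀).1] at this

end SmoothFoliation

end Transports

/-! ### Concatenation of piecewise smooth paths. -/

section Concatenation

variable {E : Type*} [NormedAddCommGroup E] [NormedSpace ℝ E]
  {H : Type*} [TopologicalSpace H] {I : ModelWithCorners ℝ E H}
  {N : Type*} [TopologicalSpace N] [ChartedSpace H N]

/-- The concatenation of two paths parametrized by `[0,1]`. -/
noncomputable def pathConcat {N : Type*} (γ₁ γ₂ : ℝ → N) (t : ℝ) : N :=
  if t ≤ 1 / 2 then γ₁ (2 * t) else γ₂ (2 * t + (-1))

lemma pathConcat_of_le {N : Type*} (γ₁ γ₂ : ℝ → N) {t : ℝ} (h : t ≤ 1 / 2) :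
    pathConcat γ₁ γ₂ t = γ₁ (2 * t) := if_pos h

lemma pathConcat_of_ge {N : Type*} {γ₁ γ₂ : ℝ → N} (h₁₂ : γ₁ 1 = γ₂ 0) {t : ℝ} (h : 1 / 2 ≤ t) :
    pathConcat γ₁ γ₂ t = γ₂ (2 * t + (-1)) := by
  rcases h.eq_or_lt with rfl | h
  · rw [pathConcat_of_le _ _ le_rfl]
    norm_num [h₁₂]
  · exact if_neg h.not_ge

omit [NormedSpace ℝ E] [ChartedSpace H N] [TopologicalSpace H] [NormedAddCommGroup E] in
lemma continuousOn_pathConcat {γ₁ γ₂ : ℝ → N} (h₁ : ContinuousOn γ₁ (Icc 0 1))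
    (h₂ : ContinuousOn γ₂ (Icc 0 1)) (h₁₂ : γ₁ 1 = γ₂ 0) :
    ContinuousOn (pathConcat γ₁ γ₂) (Icc 0 1) := by
  rw [← Icc_union_Icc_eq_Icc (b := (1 / 2 : ℝ)) (by norm_num) (by norm_num)]
  refine ContinuousOn.union_of_isClosed ?_ ?_ isClosed_Icc isClosed_Icc
  · refine (h₁.comp (f := fun t : ℝ => 2 * t) (by fun_prop) fun t ht => ?_).congr
      fun t ht => pathConcat_of_le _ _ ht.2
    exact ⟨by linarith [ht.1], by linarith [ht.2]⟩
  · refine (h₂.comp (f := fun t : ℝ => 2 * t + (-1)) (by fun_prop) fun t ht => ?_).congr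
      fun t ht => pathConcat_of_ge h₁₂ ht.1
    exact ⟨by linarith [ht.1], by linarith [ht.2]⟩

lemma contMDiffOn_comp_affine {γ : ℝ → N} {a b r : ℝ} (h : ContMDiffOn 𝓘(ℝ, ℝ) I ∞ γ
    (Icc (2 * a + r) (2 * b + r))) :
    ContMDiffOn 𝓘(ℝ, ℝ) I ∞ (fun t => γ (2 * t + r)) (Icc a b) := by
  have h1 : ContMDiff 𝓘(ℝ, ℝ) 𝓘(ℝ, ℝ) ∞ fun t : ℝ => 2 * t + r :=
    (by fun_prop : ContDiff ℝ ∞ fun t : ℝ => 2 * t + r).contMDiff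
  exact h.comp h1.contMDiffOn fun t ht => ⟨by linarith [ht.1], by linarith [ht.2]⟩

open Classical in
/-- The break points of a concatenation. -/
noncomputable def concatBreaks (P₁ P₂ : Finset ℝ) : Finset ℝ :=
  insert (1 / 2) (P₁.image (fun t => t / 2) ∪ P₂.image fun t => (t + 1) / 2)

lemma half_mem_concatBreaks (P₁ P₂ : Finset ℝ) : (1 / 2 : ℝ) ∈ concatBreaks P₁ P₂ := by
  classical exact Finset.mem_insert_self _ _

lemma mem_concatBreaks_left {P₁ : Finset ℝ} (P₂ : Finset ℝ) {t : ℝ} (h : 2 * t ∈ P₁) :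
    t ∈ concatBreaks P₁ P₂ := by
  classical
  exact Finset.mem_insert_of_mem (Finset.mem_union_left _ (Finset.mem_image.2 ⟨_, h, by ring⟩))

lemma mem_concatBreaks_right (P₁ : Finset ℝ) {P₂ : Finset ℝ} {t : ℝ} (h : 2 * t + (-1) ∈ P₂) :
    t ∈ concatBreaks P₁ P₂ := by
  classical
  exact Finset.mem_insert_of_mem (Finset.mem_union_right _ (Finset.mem_image.2 ⟨_, h, by ring⟩))

/-- The break point `1 / 2` confines an interval without interior break points to one half of `[0,
1]`, where the concatenation is an affine reparametrization. -/
lemma IsPiecewiseSmoothPath.concat {γ₁ γ₂ : ℝ → N} {P₁ P₂ : Finset ℝ}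
    (h₁ : IsPiecewiseSmoothPath I P₁ γ₁) (h₂ : IsPiecewiseSmoothPath I P₂ γ₂)
    (h₁₂ : γ₁ 1 = γ₂ 0) : IsPiecewiseSmoothPath I (concatBreaks P₁ P₂) (pathConcat γ₁ γ₂) := by
  refine ⟨continuousOn_pathConcat h₁.1 h₂.1 h₁₂, fun a b hab hI hP => ?_⟩
  have ha := (hI (left_mem_Icc.2 hab.le)).1
  have hb := (hI (right_mem_Icc.2 hab.le)).2
  have hhalf := hP _ (half_mem_concatBreaks P₁ P₂)
  rcases le_or_gt b (1 / 2) with hb' | hb'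
  · refine (contMDiffOn_comp_affine (r := 0) (h₁.2 _ _ (by linarith)
      (Icc_subset_Icc (by linarith) (by linarith)) fun t ht ht' => ?_)).congr fun t ht => ?_
    · refine hP (t / 2) (mem_concatBreaks_left P₂ (by rwa [mul_div_cancel₀ t two_ne_zero])) ?_
      exact ⟨by linarith [ht'.1], by linarith [ht'.2]⟩
    · rw [pathConcat_of_le _ _ (ht.2.trans hb'), add_zero]
  · have ha' : 1 / 2 ≤ a := not_lt.1 fun h => hhalf ⟨h, hb'⟩
    refine (contMDiffOn_comp_affine (r := -1) (h₂.2 _ _ (by linarith)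
      (Icc_subset_Icc (by linarith) (by linarith)) fun t ht ht' => ?_)).congr fun t ht => ?_
    · refine hP ((t + 1) / 2) (mem_concatBreaks_right P₁ ?_) ?_
      · rwa [show 2 * ((t + 1) / 2) + (-1) = t by ring]
      · exact ⟨by linarith [ht'.1], by linarith [ht'.2]⟩
    · rw [pathConcat_of_ge h₁₂ (ha'.trans ht.1)]

/-- Where the reparametrized path is differentiable so is `γ`, the affine map being invertible, and
the velocity is doubled. -/
lemma mfderiv_comp_affine_mem {γ : ℝ → N} {D : ∀ x : N, Submodule ℝ (TangentSpace I x)} {t r : ℝ}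
    (h : (mfderiv 𝓘(ℝ, ℝ) I γ (2 * t + r) (1 : ℝ) : TangentSpace I (γ (2 * t + r))) ∈
      D (γ (2 * t + r))) :
    (mfderiv 𝓘(ℝ, ℝ) I (fun t => γ (2 * t + r)) t (1 : ℝ) : TangentSpace I (γ (2 * t + r))) ∈
      D (γ (2 * t + r)) := by
  by_cases hd : MDifferentiableAt 𝓘(ℝ, ℝ) I (fun t => γ (2 * t + r)) t
  · have h1 : HasDerivAt (fun s : ℝ => (s - r) / 2) (1 / 2) (2 * t + r) :=
      ((hasDerivAt_id _).sub_const r).div_const 2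
    have h2 : HasDerivAt (fun t : ℝ => 2 * t + r) 2 t := by
      simpa using ((hasDerivAt_id t).const_mul 2).add_const r
    have hγ : MDifferentiableAt 𝓘(ℝ, ℝ) I γ (2 * t + r) := by
      have h3 : MDifferentiableAt 𝓘(ℝ, ℝ) I (fun t => γ (2 * t + r)) ((2 * t + r - r) / 2) := by
        convert! hd using 1
        ring
      have h4 := h3.comp (2 * t + r) h1.differentiableAt.mdifferentiableAt
      convert! h4 using 1
      ext1 s
      simp only [Function.comp]
      congr 1
      ring
    have h5 := (hγ.hasMFDerivAt.comp t h2.hasFDerivAt.hasMFDerivAt).mfderiv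
    have h6 : (mfderiv 𝓘(ℝ, ℝ) I (fun t => γ (2 * t + r)) t (1 : ℝ) :
        TangentSpace I (γ (2 * t + r))) =
        (2 : ℝ) • (mfderiv 𝓘(ℝ, ℝ) I γ (2 * t + r) (1 : ℝ) : TangentSpace I (γ (2 * t + r))) := by
      refine (DFunLike.congr_fun h5 (1 : ℝ)).trans ?_
      refine Eq.trans ?_ (map_smul (mfderiv 𝓘(ℝ, ℝ) I γ (2 * t + r)) (2 : ℝ) (1 : ℝ))
      refine congrArg (mfderiv 𝓘(ℝ, ℝ) I γ (2 * t + r)) ?_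
      change (ContinuousLinearMap.toSpanSingleton ℝ (2 : ℝ)) (1 : ℝ) = (2 : ℝ) • (1 : ℝ)
      simp
    rw [h6]
    exact (D _).smul_mem 2 h
  -- Without differentiability the derivative has the default value `0`, which lies in every
  -- subspace.
  · rw [mfderiv_zero_of_not_mdifferentiableAt hd]
    exact (D _).zero_mem

end Concatenation

/-! ### Composition of transports. -/

section Composition

variable {p q : ℕ}
  {M : Type*} [TopologicalSpace M] [ChartedSpace (EuclideanSpace ℝ (Fin (p + q))) M]
  [IsManifold (𝓡 (p + q)) ∞ M]
  {G : Type*} [TopologicalSpace G] [ChartedSpace (EuclideanSpace ℝ (Fin q)) G] [Group G]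
  {F : SmoothFoliation (𝓡 (p + q)) M p q G}
  {ν : ∀ x : M, Submodule ℝ (TangentSpace (𝓡 (p + q)) x)}

namespace SmoothFoliation

-- Horizontality is insensitive to left translation of the path in `G`, so `c₂` may be translated to
-- start at `c₁ 1`.
omit [IsManifold (𝓡 (p + q)) ∞ M] in
lemma IsHorizontalLift.concat {c₁ c₂ : ℝ → G} {x : M} {γ₁ γ₂ : ℝ → M}
    (h₁ : F.IsHorizontalLift ν c₁ x γ₁) (h₂ : F.IsHorizontalLift ν c₂ (γ₁ 1) γ₂) (hc₂ : c₂ 0 = 1) :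
    F.IsHorizontalLift ν (pathConcat c₁ fun t => c₁ 1 * c₂ t) x (pathConcat γ₁ γ₂) := by
  obtain ⟨h₁0, ⟨P₁, hP₁, hν₁⟩, hD₁⟩ := h₁
  obtain ⟨h₂0, ⟨P₂, hP₂, hν₂⟩, hD₂⟩ := h₂
  have hc : c₁ 1 = c₁ 1 * c₂ 0 := by rw [hc₂, mul_one]
  have hleft : ∀ t₀ ∈ Icc (0 : ℝ) (1 / 2), ∀ u ∈ F.cocycle, γ₁ (2 * t₀) ∈ u.dom →
      ∃ h : G, ∀ᶠ t in 𝓝[Icc 0 (1 / 2)] t₀,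
        u.map (pathConcat γ₁ γ₂ t) = h * pathConcat c₁ (fun t => c₁ 1 * c₂ t) t := by
    intro t₀ ht₀ u hu hut
    obtain ⟨h, hh⟩ := hD₁ (2 * t₀) ⟨by linarith [ht₀.1], by linarith [ht₀.2]⟩ u hu hut
    have h1 : Tendsto (fun t : ℝ => 2 * t) (𝓝[Icc 0 (1 / 2)] t₀) (𝓝[Icc 0 1] (2 * t₀)) :=
      ((continuous_const_mul (2 : ℝ)).continuousWithinAt).tendsto_nhdsWithin fun t ht =>
        ⟨by linarith [ht.1], by linarith [ht.2]⟩
    refine ⟨h, ?_⟩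
    filter_upwards [h1.eventually hh, self_mem_nhdsWithin] with t ht ht'
    rw [pathConcat_of_le _ _ ht'.2, pathConcat_of_le _ _ ht'.2, ht]
  have hright : ∀ t₀ ∈ Icc (1 / 2 : ℝ) 1, ∀ u ∈ F.cocycle, γ₂ (2 * t₀ + (-1)) ∈ u.dom →
      ∃ h : G, ∀ᶠ t in 𝓝[Icc (1 / 2) 1] t₀,
        u.map (pathConcat γ₁ γ₂ t) = h * pathConcat c₁ (fun t => c₁ 1 * c₂ t) t := by
    intro t₀ ht₀ u hu hut
    obtain ⟨h, hh⟩ := hD₂ (2 * t₀ + (-1)) ⟨by linarith [ht₀.1], by linarith [ht₀.2]⟩ u hu hut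
    have h1 : Tendsto (fun t : ℝ => 2 * t + (-1)) (𝓝[Icc (1 / 2) 1] t₀)
        (𝓝[Icc 0 1] (2 * t₀ + (-1))) :=
      ((by fun_prop : Continuous fun t : ℝ => 2 * t + (-1)).continuousWithinAt).tendsto_nhdsWithin
        fun t ht => ⟨by linarith [ht.1], by linarith [ht.2]⟩
    -- The factor `(c₁ 1)⁻¹` absorbs the translation of the second path.
    refine ⟨h * (c₁ 1)⁻¹, ?_⟩
    filter_upwards [h1.eventually hh, self_mem_nhdsWithin] with t ht ht'
    rw [pathConcat_of_ge h₂0.symm ht'.1, pathConcat_of_ge hc ht'.1, ht]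
    group
  have hIcc : ∀ t, 𝓝[Icc (0 : ℝ) 1] t = 𝓝[Icc (0 : ℝ) (1 / 2)] t ⊔ 𝓝[Icc (1 / 2 : ℝ) 1] t := by
    intro t
    rw [← nhdsWithin_union, Icc_union_Icc_eq_Icc (by norm_num) (by norm_num)]
  refine ⟨?_, ⟨_, hP₁.concat hP₂ h₂0.symm, fun t ht htP => ?_⟩, fun t₀ ht₀ u hu hut => ?_⟩
  · rw [pathConcat_of_le _ _ (by norm_num), mul_zero, h₁0]
  · rcases lt_trichotomy t (1 / 2) with hlt | rfl | hgt
    · have he : pathConcat γ₁ γ₂ =ᶠ[𝓝 t] fun t => γ₁ (2 * t + 0) := by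
        filter_upwards [Iio_mem_nhds hlt] with s hs
        rw [pathConcat_of_le _ _ (le_of_lt hs), add_zero]
      have h1 := mfderiv_comp_affine_mem (γ := γ₁) (D := ν) (t := t) (r := 0) (hν₁ _
        ⟨by linarith [ht.1], by linarith⟩ fun h => htP (mem_concatBreaks_left _ (by simpa using h)))
      rw [he.mfderiv_eq, he.self_of_nhds]
      exact h1
    · exact absurd (half_mem_concatBreaks _ _) htP
    · have he : pathConcat γ₁ γ₂ =ᶠ[𝓝 t] fun t => γ₂ (2 * t + (-1)) := by
        filter_upwards [Ioi_mem_nhds hgt] with s hs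
        rw [pathConcat_of_ge h₂0.symm (le_of_lt hs)]
      have h1 := mfderiv_comp_affine_mem (γ := γ₂) (D := ν) (t := t) (r := -1) (hν₂ _
        ⟨by linarith, by linarith [ht.2]⟩ fun h => htP (mem_concatBreaks_right _ h))
      rw [he.mfderiv_eq, he.self_of_nhds]
      exact h1
  · rw [hIcc]
    simp only [eventually_sup]
    rcases lt_trichotomy t₀ (1 / 2) with hlt | rfl | hgt
    · rw [pathConcat_of_le _ _ hlt.le] at hut
      obtain ⟨h, hh⟩ := hleft t₀ ⟨ht₀.1, hlt.le⟩ u hu hut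
      have : 𝓝[Icc (1 / 2 : ℝ) 1] t₀ = ⊥ :=
        notMem_closure_iff_nhdsWithin_eq_bot.1 (by
          rw [isClosed_Icc.closure_eq]
          exact fun h => absurd h.1 hlt.not_ge)
      exact ⟨h, hh, by rw [this]; exact eventually_bot⟩
    · obtain ⟨h, hh⟩ := hleft (1 / 2) ⟨by norm_num, le_rfl⟩ u hu
        (by rwa [pathConcat_of_le _ _ le_rfl] at hut)
      obtain ⟨h', hh'⟩ := hright (1 / 2) ⟨le_rfl, by norm_num⟩ u hu
        (by rwa [pathConcat_of_ge h₂0.symm le_rfl] at hut)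
      -- Both one-sided identities hold at the junction itself, which forces their constants to
      -- agree.
      have e1 := hh.self_of_nhdsWithin (⟨by norm_num, le_rfl⟩)
      have e2 := hh'.self_of_nhdsWithin (⟨le_rfl, by norm_num⟩)
      have e3 : h = h' := mul_right_cancel (e1.symm.trans e2)
      exact ⟨h, hh, e3 ▸ hh'⟩
    · rw [pathConcat_of_ge h₂0.symm hgt.le] at hut
      obtain ⟨h, hh⟩ := hright t₀ ⟨hgt.le, ht₀.2⟩ u hu hut
      have : 𝓝[Icc (0 : ℝ) (1 / 2)] t₀ = ⊥ :=
        notMem_closure_iff_nhdsWithin_eq_bot.1 (by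
          rw [isClosed_Icc.closure_eq]
          exact fun h => absurd h.2 hgt.not_ge)
      exact ⟨h, by rw [this]; exact eventually_bot, hh⟩

omit [IsManifold (𝓡 (p + q)) ∞ M] in
lemma isTransportTo_refl : F.IsTransportTo ν (Diffeomorph.refl (𝓡 (p + q)) M ∞) 1 := by
  refine ⟨fun _ => 1, ⟨∅, isPiecewiseSmoothPath_of_contMDiff contMDiff_const⟩, rfl, rfl,
    fun x => image_id _, fun x => ⟨fun _ => x, ⟨rfl, ⟨∅,
      isPiecewiseSmoothPath_of_contMDiff contMDiff_const, fun t _ _ => ?_⟩, fun t _ u _ _ =>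
        ⟨u.map x, by simp⟩⟩, rfl⟩⟩
  rw [mfderiv_const]
  exact (ν x).zero_mem

-- Concatenate the lift from `x` with the lift from `φ x`. The path in `G` grows on the right, so
-- the transport performed first gives the left factor.
omit [IsManifold (𝓡 (p + q)) ∞ M] in
lemma IsTransportTo.trans [LieGroup (𝓡 q) ∞ G]
    {φ ψ : Diffeomorph (𝓡 (p + q)) (𝓡 (p + q)) M M ∞} {a b : G}
    (hφ : F.IsTransportTo ν φ a) (hψ : F.IsTransportTo ν ψ b) :
    F.IsTransportTo ν (φ.trans ψ) (a * b) := by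
  obtain ⟨c₁, ⟨P₁, hP₁⟩, h₁0, h₁1, hF₁, hT₁⟩ := hφ
  obtain ⟨c₂, ⟨P₂, hP₂⟩, h₂0, h₂1, hF₂, hT₂⟩ := hψ
  have hc : c₁ 1 = c₁ 1 * c₂ 0 := by rw [h₂0, mul_one]
  refine ⟨pathConcat c₁ fun t => c₁ 1 * c₂ t, ⟨_, hP₁.concat (P₂ := P₂) ⟨?_, ?_⟩ hc⟩, ?_, ?_,
    fun x => ?_, fun x => ?_⟩
  · exact (contMDiff_mul_left (I := 𝓡 q) (n := ∞)).continuous.comp_continuousOn hP₂.1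
  · exact fun s t hst hI hP => (contMDiff_mul_left (I := 𝓡 q) (n := ∞)).comp_contMDiffOn
      (hP₂.2 s t hst hI hP)
  · rw [pathConcat_of_le _ _ (by norm_num), mul_zero, h₁0]
  · rw [pathConcat_of_ge hc (by norm_num)]
    norm_num [h₁1, h₂1]
  · rw [Diffeomorph.coe_trans, image_comp, hF₁, hF₂]
    rfl
  · obtain ⟨γ₁, hγ₁, hγ₁1⟩ := hT₁ x
    obtain ⟨γ₂, hγ₂, hγ₂1⟩ := hT₂ (φ x)
    rw [← hγ₁1] at hγ₂
    refine ⟨pathConcat γ₁ γ₂, hγ₁.concat hγ₂ h₂0, ?_⟩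
    rw [pathConcat_of_ge hγ₂.1.symm (by norm_num)]
    norm_num [hγ₂1]

end SmoothFoliation

end Composition

/-! ### The map `conjAlong` and charts adapted to it. -/

section ConjugationAlong

variable {E : Type*} [NormedAddCommGroup E] [NormedSpace ℝ E]
  {E' : Type*} [NormedAddCommGroup E'] [NormedSpace ℝ E']
  {N : Type*} [TopologicalSpace N] [ChartedSpace E N]
  {G : Type*} [TopologicalSpace G] [ChartedSpace E' G] [Group G]

/-- The map `(x, g) ↦ f x * g * (f x)⁻¹`. -/
def conjAlong {N G : Type*} [Group G] (f : N → G) (z : N × G) : G := f z.1 * z.2 * (f z.1)⁻¹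

/-- This identity makes the local maps a cocycle: left translations of `f` act on the values as
conjugations. -/
lemma conjAlong_eq_of_map_eq {N G : Type*} [Group G] {f f' : N → G} {h : G} {z : N × G}
    (hz : f' z.1 = h * f z.1) : conjAlong f' z = h * conjAlong f z * h⁻¹ := by
  simp only [conjAlong, hz]
  group

lemma continuousOn_conjAlong [IsTopologicalGroup G] {f : N → G} {D : Set N}
    (hf : ContinuousOn f D) : ContinuousOn (conjAlong f) (Prod.fst ⁻¹' D) := by
  have h1 : ContinuousOn (fun z : N × G => f z.1) (Prod.fst ⁻¹' D) :=
    hf.comp continuousOn_fst fun z hz => hz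
  exact (h1.mul continuousOn_snd).mul h1.inv

lemma contMDiffAt_conjAlong [LieGroup 𝓘(ℝ, E') ∞ G] {f : N → G} {z : N × G}
    (hf : ContMDiffAt 𝓘(ℝ, E) 𝓘(ℝ, E') ∞ f z.1) :
    ContMDiffAt (𝓘(ℝ, E).prod 𝓘(ℝ, E')) 𝓘(ℝ, E') ∞ (conjAlong f) z := by
  have h1 : ContMDiffAt (𝓘(ℝ, E).prod 𝓘(ℝ, E')) 𝓘(ℝ, E') ∞ (fun z : N × G => f z.1) z :=
    ContMDiffAt.comp z (f := Prod.fst) hf contMDiffAt_fst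
  exact (h1.mul contMDiffAt_snd).mul h1.inv

/-- For each fixed `x` the map is a homeomorphism of `G`, so the image is a union of open sets. -/
lemma isOpen_image_conjAlong [IsTopologicalGroup G] (f : N → G) {O : Set (N × G)} (hO : IsOpen O) :
    IsOpen (conjAlong f '' O) := by
  have : conjAlong f '' O = ⋃ x : N, ((Homeomorph.mulLeft (f x)).trans
      (Homeomorph.mulRight (f x)⁻¹)) '' ((fun g => (x, g)) ⁻¹' O) := by
    ext k
    simp only [mem_iUnion, mem_image, mem_preimage]
    constructor
    · rintro ⟨⟨x, g⟩, h, rfl⟩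
      exact ⟨x, g, h, rfl⟩
    · rintro ⟨x, g, h, rfl⟩
      exact ⟨(x, g), h, rfl⟩
  rw [this]
  exact isOpen_iUnion fun x => (Homeomorph.isOpenMap _) _ (hO.preimage (by fun_prop))

/-- The chart `(x, g) ↦ (φ x, κ (f x * g * (f x)⁻¹))` of `N × G`. -/
def conjChart [IsTopologicalGroup G] (f : N → G) (φ : OpenPartialHomeomorph N E)
    (κ : OpenPartialHomeomorph G E') (hf : ContinuousOn f φ.source) :
    OpenPartialHomeomorph (N × G) (ModelProd E E') where
  toFun z := (φ z.1, κ (conjAlong f z))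
  invFun y := (φ.symm y.1, (f (φ.symm y.1))⁻¹ * κ.symm y.2 * f (φ.symm y.1))
  source := Prod.fst ⁻¹' φ.source ∩ conjAlong f ⁻¹' κ.source
  target := φ.target ×ˢ κ.target
  map_source' z hz := ⟨φ.map_source hz.1, κ.map_source hz.2⟩
  map_target' y hy := by
    refine ⟨φ.map_target hy.1, ?_⟩
    simp only [conjAlong, mem_preimage]
    convert! κ.map_target hy.2 using 1
    group
  left_inv' z hz := by
    refine Prod.ext (φ.left_inv hz.1) ?_
    change (f (φ.symm (φ z.1)))⁻¹ * κ.symm (κ (conjAlong f z)) * f (φ.symm (φ z.1)) = z.2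
    rw [φ.left_inv hz.1, κ.left_inv hz.2, conjAlong]
    group
  right_inv' y hy := by
    refine Prod.ext (φ.right_inv hy.1) ?_
    change κ (f (φ.symm y.1) * ((f (φ.symm y.1))⁻¹ * κ.symm y.2 * f (φ.symm y.1)) *
      (f (φ.symm y.1))⁻¹) = y.2
    convert! κ.right_inv hy.2 using 2
    group
  open_source := (continuousOn_conjAlong hf).isOpen_inter_preimage
    (φ.open_source.preimage continuous_fst) κ.open_source
  open_target := φ.open_target.prod κ.open_target
  continuousOn_toFun := by
    refine ContinuousOn.prodMk (φ.continuousOn.comp continuousOn_fst fun z hz => hz.1) ?_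
    exact κ.continuousOn.comp ((continuousOn_conjAlong hf).mono inter_subset_left) fun z hz => hz.2
  continuousOn_invFun := by
    have h1 : ContinuousOn (fun y : E × E' => φ.symm y.1) (φ.target ×ˢ κ.target) :=
      φ.symm.continuousOn.comp continuousOn_fst fun z hz => hz.1
    have h2 : ContinuousOn (fun y : E × E' => f (φ.symm y.1)) (φ.target ×ˢ κ.target) :=
      hf.comp h1 fun z hz => φ.map_target hz.1
    have h3 : ContinuousOn (fun y : E × E' => κ.symm y.2) (φ.target ×ˢ κ.target) :=
      κ.symm.continuousOn.comp continuousOn_snd fun z hz => hz.2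
    exact h1.prodMk ((h2.inv.mul h3).mul h2)

lemma conjChart_mem_maximalAtlas [IsManifold 𝓘(ℝ, E) ∞ N] [LieGroup 𝓘(ℝ, E') ∞ G]
    [IsTopologicalGroup G] {f : N → G} {φ : OpenPartialHomeomorph N E}
    {κ : OpenPartialHomeomorph G E'} (hf : ContMDiffOn 𝓘(ℝ, E) 𝓘(ℝ, E') ∞ f φ.source)
    (hφ : ContMDiffOn 𝓘(ℝ, E) 𝓘(ℝ, E) ∞ φ φ.source)
    (hφ' : ContMDiffOn 𝓘(ℝ, E) 𝓘(ℝ, E) ∞ φ.symm φ.target)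
    (hκ : κ ∈ IsManifold.maximalAtlas 𝓘(ℝ, E') ∞ G) :
    conjChart f φ κ hf.continuousOn ∈ IsManifold.maximalAtlas (𝓘(ℝ, E).prod 𝓘(ℝ, E')) ∞ (N × G) := by
  refine OpenPartialHomeomorph.mem_maximalAtlas_of_contMDiffOn _ ?_ ?_
  · have h1 : ContMDiffOn (𝓘(ℝ, E).prod 𝓘(ℝ, E')) 𝓘(ℝ, E) ∞ (fun z : N × G => φ z.1)
        (conjChart f φ κ hf.continuousOn).source :=
      hφ.comp contMDiffOn_fst fun z hz => hz.1
    have h2 : ContMDiffOn (𝓘(ℝ, E).prod 𝓘(ℝ, E')) 𝓘(ℝ, E') ∞ (fun z : N × G => κ (conjAlong f z))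
        (conjChart f φ κ hf.continuousOn).source :=
      (contMDiffOn_of_mem_maximalAtlas hκ).comp (fun z hz => (contMDiffAt_conjAlong
        (hf.contMDiffAt (φ.open_source.mem_nhds hz.1))).contMDiffWithinAt) fun z hz => hz.2
    have h3 := h1.prodMk h2
    rw [chartedSpaceSelf_prod] at h3
    exact h3
  · have h1 : ContMDiffOn (𝓘(ℝ, E).prod 𝓘(ℝ, E')) 𝓘(ℝ, E) ∞ (fun y : E × E' => φ.symm y.1)
        (φ.target ×ˢ κ.target) := hφ'.comp contMDiffOn_fst fun z hz => hz.1
    have h2 : ContMDiffOn (𝓘(ℝ, E).prod 𝓘(ℝ, E')) 𝓘(ℝ, E') ∞ (fun y : E × E' => f (φ.symm y.1))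
        (φ.target ×ˢ κ.target) := hf.comp h1 fun z hz => φ.map_target hz.1
    have h3 : ContMDiffOn (𝓘(ℝ, E).prod 𝓘(ℝ, E')) 𝓘(ℝ, E') ∞ (fun y : E × E' => κ.symm y.2)
        (φ.target ×ˢ κ.target) :=
      (contMDiffOn_symm_of_mem_maximalAtlas hκ).comp contMDiffOn_snd fun z hz => hz.2
    have h4 := h1.prodMk ((h2.inv.mul h3).mul h2)
    rw [chartedSpaceSelf_prod] at h4
    exact h4

/-- Every point has arbitrarily small smooth charts with connected image. -/
lemma exists_smooth_chart_isConnected [IsManifold 𝓘(ℝ, E) ∞ N] {D : Set N} (hD : IsOpen D) {x : N}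
    (hx : x ∈ D) : ∃ φ : OpenPartialHomeomorph N E, x ∈ φ.source ∧ φ.source ⊆ D ∧
      ContMDiffOn 𝓘(ℝ, E) 𝓘(ℝ, E) ∞ φ φ.source ∧
      ContMDiffOn 𝓘(ℝ, E) 𝓘(ℝ, E) ∞ φ.symm φ.target ∧ IsConnected φ.target := by
  have hxs := mem_chart_source E x
  obtain ⟨r, hr, hball⟩ := Metric.isOpen_iff.1 ((chartAt E x).symm.isOpen_inter_preimage hD)
    (chartAt E x x) ⟨(chartAt E x).map_source hxs, by
      simpa only [mem_preimage, (chartAt E x).left_inv hxs] using hx⟩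
  let ψ := (chartAt E x).symm.restrOpen (Metric.ball (chartAt E x x) r) Metric.isOpen_ball
  have hψ : ψ.source = Metric.ball (chartAt E x x) r :=
    inter_eq_right.2 fun y hy => (hball hy).1
  have hsub : ψ.target ⊆ (chartAt E x).source := fun y hy => by
    have h1 := (ψ.map_target hy).1
    have h2 := ψ.right_inv hy
    rw [← h2]
    exact (chartAt E x).map_target h1
  refine ⟨ψ.symm, ?_, ?_, ?_, ?_, ?_⟩
  · have h1 : ψ (chartAt E x x) = x := (chartAt E x).left_inv hxs
    have h2 := ψ.map_source (x := chartAt E x x) (by rw [hψ]; exact Metric.mem_ball_self hr)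
    rwa [h1] at h2
  · intro y hy
    have h1 := ψ.map_target hy
    have h2 := ψ.right_inv hy
    rw [hψ] at h1
    rw [← h2]
    exact (hball h1).2
  · exact (contMDiffOn_chart (I := 𝓘(ℝ, E)) (n := ∞) (x := x)).mono hsub
  · exact (contMDiffOn_chart_symm (I := 𝓘(ℝ, E)) (n := ∞) (x := x)).mono fun y hy => hy.1
  · change IsConnected ψ.source
    rw [hψ]
    exact ⟨Metric.nonempty_ball.2 hr, (convex_ball _ _).isPreconnected⟩

end ConjugationAlong

/-! ### The foliation of `M × G` and its leaves. -/

section ConjugationFoliation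

variable {p q : ℕ}
  {M : Type*} [TopologicalSpace M] [ChartedSpace (EuclideanSpace ℝ (Fin (p + q))) M]
  [IsManifold (𝓡 (p + q)) ∞ M]
  {G : Type*} [TopologicalSpace G] [ChartedSpace (EuclideanSpace ℝ (Fin q)) G] [Group G]
  [LieGroup (𝓡 q) ∞ G]

/-- The member of a cocycle on `M × G` with submersion `(x, g) ↦ κ (f x * g * (f x)⁻¹)`. -/
def conjFoliatedChart [IsTopologicalGroup G] (f : M → G)
    (φ : OpenPartialHomeomorph M (EuclideanSpace ℝ (Fin (p + q))))
    (κ : OpenPartialHomeomorph G (EuclideanSpace ℝ (Fin q)))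
    (hf : ContMDiffOn (𝓡 (p + q)) (𝓡 q) ∞ f φ.source)
    (hφ : ContMDiffOn (𝓡 (p + q)) (𝓡 (p + q)) ∞ φ φ.source)
    (hφ' : ContMDiffOn (𝓡 (p + q)) (𝓡 (p + q)) ∞ φ.symm φ.target)
    (hκ : κ ∈ IsManifold.maximalAtlas (𝓡 q) ∞ G) (hconn : IsConnected φ.target) :
    FoliatedChart ((𝓡 (p + q)).prod (𝓡 q)) (M × G) (p + q) q (EuclideanSpace ℝ (Fin q)) where
  dom := (conjChart f φ κ hf.continuousOn).source
  map z := κ (conjAlong f z)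
  isOpen_dom := (conjChart f φ κ hf.continuousOn).open_source
  -- In the adapted chart the map is the second projection; `prodComm` puts the target factor first,
  -- as the normal form of a submersion demands.
  isSubmersionAt z hz := by
    refine Manifold.IsSubmersionAt.mk_of_charts
      (ContinuousLinearEquiv.prodComm ℝ _ _) _ (OpenPartialHomeomorph.refl _) hz (mem_univ _)
      (conjChart_mem_maximalAtlas hf hφ hφ' hκ) (IsManifold.chart_mem_maximalAtlas
        (M := EuclideanSpace ℝ (Fin q)) (κ (conjAlong f z))) (fun _ _ => mem_univ _) ?_
    intro y hy
    have hy' : y ∈ (conjChart f φ κ hf.continuousOn).target := by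
      rw [OpenPartialHomeomorph.extend_target] at hy
      exact hy.1
    exact congrArg Prod.snd ((conjChart f φ κ hf.continuousOn).right_inv hy')
  fibre t ht := by
    have ht' : t ∈ κ.target := by
      obtain ⟨z, hz, rfl⟩ := ht
      exact κ.map_source hz.2
    let Ψ := conjChart f φ κ hf.continuousOn
    have hmem : ∀ e : φ.target, ((e : EuclideanSpace ℝ (Fin (p + q))), t) ∈ Ψ.target :=
      fun e => ⟨e.2, ht'⟩
    -- A fibre is a graph over the chart domain in `M`, so it is homeomorphic to the connected set
    -- `φ.target`.
    refine ⟨φ.target, φ.open_target, hconn, ⟨?_⟩⟩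
    exact
      { toFun := fun z => ⟨φ z.1.1, φ.map_source z.2.1.1⟩
        invFun := fun e => ⟨Ψ.symm ((e : EuclideanSpace ℝ (Fin (p + q))), t),
          Ψ.map_target (hmem e), congrArg Prod.snd (Ψ.right_inv (hmem e))⟩
        left_inv := fun z => Subtype.ext (by
          have h1 := Ψ.left_inv z.2.1
          have h2 : Ψ z = (φ z.1.1, t) := Prod.ext rfl z.2.2
          rw [h2] at h1
          exact h1)
        right_inv := fun e => Subtype.ext (congrArg Prod.fst (Ψ.right_inv (hmem e)))
        continuous_toFun := (continuousOn_iff_continuous_domRestrict.1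
          ((φ.continuousOn.comp continuousOn_fst fun z hz => hz.1.1) :
            ContinuousOn (fun z : M × G => φ z.1) _)).subtype_mk _
        continuous_invFun := (Ψ.symm.continuousOn.comp_continuous
          (continuous_subtype_val.prodMk continuous_const) hmem).subtype_mk _ }

namespace SmoothFoliation

variable (F : SmoothFoliation (𝓡 (p + q)) M p q G)

/-- The submersions `κ ∘ conjAlong u.map`, for members `u` of the cocycle of `F` and charts `κ`
of `G`. -/
def conjCocycle :
    Set (FoliatedChart ((𝓡 (p + q)).prod (𝓡 q)) (M × G) (p + q) q (EuclideanSpace ℝ (Fin q))) :=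
  {w | ∃ u ∈ F.cocycle, ∃ κ ∈ atlas (EuclideanSpace ℝ (Fin q)) G,
    (∀ z ∈ w.dom, z.1 ∈ u.dom ∧ conjAlong u.map z ∈ κ.source) ∧
      ∀ z, w.map z = κ (conjAlong u.map z)}

variable {F}

lemma exists_mem_conjCocycle {u : FoliatedChart (𝓡 (p + q)) M p q G} (hu : u ∈ F.cocycle)
    {z : M × G} (hz : z.1 ∈ u.dom) : ∃ w ∈ F.conjCocycle, z ∈ w.dom ∧
      (∀ y ∈ w.dom, y.1 ∈ u.dom ∧
        conjAlong u.map y ∈ (chartAt (EuclideanSpace ℝ (Fin q)) (conjAlong u.map z)).source) ∧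
      ∀ y, w.map y = chartAt (EuclideanSpace ℝ (Fin q)) (conjAlong u.map z) (conjAlong u.map y) := by
  have : IsTopologicalGroup G := topologicalGroup_of_lieGroup (𝓡 q) ∞
  obtain ⟨φ, hzφ, hφu, hφ, hφ', hconn⟩ := exists_smooth_chart_isConnected
    (E := EuclideanSpace ℝ (Fin (p + q))) u.isOpen_dom hz
  have hf : ContMDiffOn (𝓡 (p + q)) (𝓡 q) ∞ u.map φ.source := fun x hx =>
    (u.contMDiffAt (hφu hx)).contMDiffWithinAt
  have h1 : ∀ y ∈ (conjFoliatedChart u.map φ _ hf hφ hφ'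
      (IsManifold.chart_mem_maximalAtlas (I := 𝓡 q) (n := ∞) (conjAlong u.map z)) hconn).dom, y.1 ∈ u.dom ∧
        conjAlong u.map y ∈ (chartAt (EuclideanSpace ℝ (Fin q)) (conjAlong u.map z)).source :=
    fun y hy => ⟨hφu hy.1, hy.2⟩
  exact ⟨conjFoliatedChart u.map φ _ hf hφ hφ'
    (IsManifold.chart_mem_maximalAtlas (I := 𝓡 q) (n := ∞) (conjAlong u.map z)) hconn,
    ⟨u, hu, _, chart_mem_atlas _ _, h1, fun _ => rfl⟩, ⟨hzφ, mem_chart_source _ _⟩, h1, fun _ => rfl⟩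

/-- The foliation of `M × G` by the orbits of the structural transverse action of `F`, acting on
`G` by conjugations. -/
def IsLie.conjFoliation (hF : F.IsLie) :
    SmoothFoliation ((𝓡 (p + q)).prod (𝓡 q)) (M × G) (p + q) q (EuclideanSpace ℝ (Fin q)) where
  cocycle := F.conjCocycle
  cover z := by
    obtain ⟨u, hu, hzu⟩ := F.cover z.1
    obtain ⟨w, hw, hzw, -⟩ := exists_mem_conjCocycle hu hzu
    exact ⟨w, hw, hzw⟩
  compatible := by
    rintro w ⟨u, hu, κ, hκ, hd, hm⟩ w' ⟨v, hv, κ', hκ', hd', hm'⟩ z ⟨hz, hz'⟩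
    have : IsTopologicalGroup G := topologicalGroup_of_lieGroup (𝓡 q) ∞
    obtain ⟨O, hO, hzO, hOd, h, hh⟩ := hF u hu v hv z.1 ⟨(hd z hz).1, (hd' z hz').1⟩
    let O' : Set (M × G) := (w.dom ∩ w'.dom) ∩ Prod.fst ⁻¹' O
    have hO' : IsOpen O' := (w.isOpen_dom.inter w'.isOpen_dom).inter (hO.preimage continuous_fst)
    have hconj : ∀ y ∈ O', conjAlong v.map y = h * conjAlong u.map y * h⁻¹ := fun y hy =>
      conjAlong_eq_of_map_eq (hh y.1 hy.2)
    have himg : w.map '' O' = κ '' (conjAlong u.map '' O') := by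
      rw [image_image]
      exact image_congr fun y _ => hm y
    have hopen : IsOpen (w.map '' O') := by
      rw [himg]
      refine κ.isOpen_image_of_subset_source (isOpen_image_conjAlong _ hO') ?_
      rintro _ ⟨y, hy, rfl⟩
      exact (hd y hy.1.1).2
    -- The transition map is conjugation by `h`, read in the charts `κ` and `κ'`.
    let c : G ≃ₜ G := (Homeomorph.mulLeft h).trans (Homeomorph.mulRight h⁻¹)
    let e := ((κ.symm.trans c.toOpenPartialHomeomorph).trans κ').restrOpen (w.map '' O') hopen
    have hval : ∀ y ∈ O', w'.map y = e (w.map y) := by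
      intro y hy
      change w'.map y = κ' (h * κ.symm (w.map y) * h⁻¹)
      rw [hm', hm, κ.left_inv (hd y hy.1.1).2, hconj y hy]
    have hsource : e.source = w.map '' O' := by
      refine inter_eq_right.2 ?_
      rintro _ ⟨y, hy, rfl⟩
      refine ⟨⟨?_, mem_univ _⟩, ?_⟩
      · change w.map y ∈ κ.target
        rw [hm]
        exact κ.map_source (hd y hy.1.1).2
      · change h * κ.symm (w.map y) * h⁻¹ ∈ κ'.source
        rw [hm, κ.left_inv (hd y hy.1.1).2, ← hconj y hy]
        exact (hd' y hy.1.2).2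
    refine ⟨O', hO', ⟨⟨hz, hz'⟩, hzO⟩, inter_subset_left, e, hsource, ?_, hval⟩
    rw [← e.image_source_eq_target, hsource, image_image]
    exact (image_congr fun y hy => hval y hy).symm

omit [IsManifold (𝓡 (p + q)) ∞ M] [LieGroup (𝓡 q) ∞ G] in
lemma IsLie.eventually_conjAlong (hF : F.IsLie) {u v : FoliatedChart (𝓡 (p + q)) M p q G}
    (hu : u ∈ F.cocycle) (hv : v ∈ F.cocycle) {z : M × G} (hzu : z.1 ∈ u.dom) (hzv : z.1 ∈ v.dom) :
    ∃ h : G, ∀ᶠ y in 𝓝 z, conjAlong v.map y = h * conjAlong u.map y * h⁻¹ := by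
  obtain ⟨O, hO, hzO, -, h, hh⟩ := hF u hu v hv z.1 ⟨hzu, hzv⟩
  refine ⟨h, ?_⟩
  filter_upwards [(hO.preimage continuous_fst).mem_nhds hzO] with y hy
  exact conjAlong_eq_of_map_eq (hh _ hy)

lemma IsLie.eventually_leafTopology_conjFoliation (hF : F.IsLie)
    {u : FoliatedChart (𝓡 (p + q)) M p q G} (hu : u ∈ F.cocycle) {z : M × G} (hz : z.1 ∈ u.dom) :
    ∀ᶠ y in @nhds (M × G) hF.conjFoliation.leafTopology z,
      conjAlong u.map y = conjAlong u.map z := by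
  obtain ⟨w, hw, hzw, hd, hm⟩ := exists_mem_conjCocycle hu hz
  filter_upwards [hF.conjFoliation.eventually_leafTopology (u := w) hw hzw] with y hy
  rw [hm, hm] at hy
  exact (chartAt _ _).injOn (hd y hy.1).2 (hd z hzw).2 hy.2

/-- One member of the cocycle per point suffices: any other one changes the values by a locally
constant conjugation. -/
lemma IsLie.continuous_conjFoliation (hF : F.IsLie) {Z : Type*} [TopologicalSpace Z]
    {α : Z → M × G} (hα : Continuous α)
    (h : ∀ z, ∃ u ∈ F.cocycle, (α z).1 ∈ u.dom ∧
      ∀ᶠ z' in 𝓝 z, conjAlong u.map (α z') = conjAlong u.map (α z)) :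
    @Continuous Z (M × G) _ hF.conjFoliation.leafTopology α := by
  refine hF.conjFoliation.continuous_leafTopology hα fun z w hw hz => ?_
  obtain ⟨v, hv, κ, -, hd, hm⟩ := hw
  obtain ⟨u, hu, hzu, he⟩ := h z
  obtain ⟨g, hg⟩ := hF.eventually_conjAlong hu hv hzu (hd _ hz).1
  filter_upwards [he, hα.continuousAt hg] with z' h1 h2
  rw [hm, hm, hg.self_of_nhds, h2, h1]

lemma IsLie.mk_mem_leaf_conjFoliation (hF : F.IsLie) {x y : M} (g : G) (h : y ∈ F.leaf x) :
    (y, g) ∈ hF.conjFoliation.leaf (x, g) := by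
  have h1 : @Continuous M (M × G) F.leafTopology hF.conjFoliation.leafTopology (fun y => (y, g)) := by
    refine @IsLie.continuous_conjFoliation _ _ _ _ _ _ _ _ _ _ _ _ hF M F.leafTopology _ ?_ ?_
    · exact continuous_le_dom F.leafTopology_le (by fun_prop)
    · intro z
      obtain ⟨u, hu, hzu⟩ := F.cover z
      refine ⟨u, hu, hzu, ?_⟩
      filter_upwards [F.eventually_leafTopology hu hzu] with y hy
      simp only [conjAlong, hy.2]
  exact @Continuous.image_connectedComponent_subset M (M × G) F.leafTopology
    hF.conjFoliation.leafTopology _ h1 x _ (mem_image_of_mem (fun y => (y, g)) h)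

/-- Along the path `(γ t, (c t)⁻¹ * g * c t)` one has `u.map (γ t) = b * c t` locally, and
`conjAlong u.map` keeps the value `b * g * b⁻¹`. -/
lemma IsLie.transport_mem_leaf_conjFoliation (hF : F.IsLie)
    {ν : ∀ x : M, Submodule ℝ (TangentSpace (𝓡 (p + q)) x)}
    {φ : Diffeomorph (𝓡 (p + q)) (𝓡 (p + q)) M M ∞} {a : G} (h : F.IsTransportTo ν φ a)
    (x : M) (g : G) : (φ x, a⁻¹ * g * a) ∈ hF.conjFoliation.leaf (x, g) := by
  have : IsTopologicalGroup G := topologicalGroup_of_lieGroup (𝓡 q) ∞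
  obtain ⟨c, ⟨P', hP'⟩, h0, h1, -, hT⟩ := h
  obtain ⟨γ, ⟨hγ0, ⟨P, hP, -⟩, hD⟩, hγ1⟩ := hT x
  have hγ : Continuous fun t : Icc (0 : ℝ) 1 => γ t := continuousOn_iff_continuous_domRestrict.1 hP.1
  have hc : Continuous fun t : Icc (0 : ℝ) 1 => c t := continuousOn_iff_continuous_domRestrict.1 hP'.1
  have h2 : @Continuous (Icc (0 : ℝ) 1) (M × G) _ hF.conjFoliation.leafTopology
      (fun t => (γ t, (c t)⁻¹ * g * c t)) := by
    refine hF.continuous_conjFoliation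
      (hγ.prodMk ((hc.inv.mul continuous_const).mul hc)) fun t => ?_
    obtain ⟨u, hu, htu⟩ := F.cover (γ t)
    obtain ⟨b, hb⟩ := hD t t.2 u hu htu
    have h3 := hb.self_of_nhdsWithin t.2
    refine ⟨u, hu, htu, ?_⟩
    have h4 : ∀ᶠ s : Icc (0 : ℝ) 1 in 𝓝 t, u.map (γ s) = b * c s :=
      (tendsto_nhdsWithin_iff.2 ⟨continuous_subtype_val.tendsto t,
        Eventually.of_forall fun s : Icc (0 : ℝ) 1 => s.2⟩).eventually hb
    filter_upwards [h4] with s hs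
    simp only [conjAlong, hs, h3]
    group
  have h5 := hF.conjFoliation.mem_leaf_of_preconnected h2 ⟨0, by norm_num⟩ ⟨1, by norm_num⟩
  simpa [hγ0, hγ1, h0, h1] using h5

/-- The leaves of `hF.conjFoliation` are the orbits. -/
theorem IsLie.leaf_conjFoliation [T2Space M] [CompactSpace M] (hF : F.IsLie) (x : M) (g : G) :
    hF.conjFoliation.leaf (x, g) = F.orbitSet x g := by
  obtain ⟨ν, hν, hsmall⟩ := hF.exists_small_transports
  refine Subset.antisymm ?_ ?_
  -- The part of the orbit reached with the single complement `ν`; it will be shown to contain the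
  -- whole leaf.
  · let S : Set (M × G) := {z | ∃ φ a, F.IsTransportTo ν φ a ∧ z.1 ∈ φ '' F.leaf x ∧
      z.2 = a⁻¹ * g * a}
    have hfol : ∀ {φ : Diffeomorph (𝓡 (p + q)) (𝓡 (p + q)) M M ∞} {a : G},
        F.IsTransportTo ν φ a → F.IsFoliatedDiffeo φ := fun h => by
      obtain ⟨c, -, -, -, h, -⟩ := h
      exact h
    -- Membership in `S` is locally constant for the leaf topology, so `S` is open and closed.
    have hS : ∀ z, ∀ᶠ y in @nhds (M × G) hF.conjFoliation.leafTopology z, z ∈ S ↔ y ∈ S := by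
      intro z
      obtain ⟨u, hu, hzu, hev⟩ := hsmall z.1
      filter_upwards [hF.eventually_leafTopology_conjFoliation hu hzu,
        hF.conjFoliation.nhds_leafTopology_le z (continuousAt_fst hev)] with y hy hy'
      obtain ⟨hyu, φ, a, hφ, hφ', hφu, hφy, hφa⟩ := hy'
      have hleaf : y.1 ∈ F.leaf (φ z.1) := F.mem_leaf_of_map_eq hu hφu hyu hφy.symm
      -- Here `u.map y.1 = u.map z.1 * a`, so equality of the values of `conjAlong` determines the
      -- second component.
      have hy2 : y.2 = a⁻¹ * z.2 * a := by
        simp only [conjAlong, ← hφy, hφa] at hy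
        calc y.2 = (u.map z.1 * a)⁻¹ * (u.map z.1 * a * y.2 * (u.map z.1 * a)⁻¹) *
              (u.map z.1 * a) := by group
          _ = a⁻¹ * z.2 * a := by rw [hy]; group
      constructor
      · rintro ⟨ψ, b, hψ, ⟨l, hl, hlz⟩, hb⟩
        refine ⟨ψ.trans φ, b * a, hψ.trans hφ, ?_, ?_⟩
        · have e1 : z.1 ∈ F.leaf (ψ x) := by
            rw [← hfol hψ]
            exact ⟨l, hl, hlz⟩
          have e2 : φ z.1 ∈ F.leaf (φ (ψ x)) := by
            rw [← hfol hφ]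
            exact mem_image_of_mem _ e1
          rw [Diffeomorph.coe_trans, image_comp, hfol hψ, hfol hφ, ← F.leaf_eq e2]
          exact hleaf
        · rw [hy2, hb]
          group
      · rintro ⟨ψ, b, hψ, ⟨l, hl, hlz⟩, hb⟩
        -- The way back from `y` to `z` uses the inverse of the short transport, itself a transport.
        refine ⟨ψ.trans φ.symm, b * a⁻¹, hψ.trans hφ', ?_, ?_⟩
        · have e1 : y.1 ∈ F.leaf (ψ x) := by
            rw [← hfol hψ]
            exact ⟨l, hl, hlz⟩
          have e2 : φ z.1 ∈ F.leaf (ψ x) := by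
            rw [← F.leaf_eq e1, F.leaf_eq hleaf]
            exact F.mem_leaf _
          rw [Diffeomorph.coe_trans, image_comp, hfol hψ]
          exact ⟨_, e2, φ.symm_apply_apply z.1⟩
        · have : z.2 = a * y.2 * a⁻¹ := by rw [hy2]; group
          rw [this, hb]
          group
    have hxS : (x, g) ∈ S := ⟨_, 1, isTransportTo_refl, ⟨x, F.mem_leaf x, rfl⟩, by simp⟩
    have hsub : hF.conjFoliation.leaf (x, g) ⊆ S := by
      let := hF.conjFoliation.leafTopology
      refine IsClopen.connectedComponent_subset ⟨⟨?_⟩, ?_⟩ hxS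
      · refine isOpen_iff_mem_nhds.2 fun z hz => ?_
        filter_upwards [hS z] with y hy h
        exact hz (hy.2 h)
      · refine isOpen_iff_mem_nhds.2 fun z hz => ?_
        filter_upwards [hS z] with y hy
        exact hy.1 hz
    refine hsub.trans ?_
    rintro ⟨z, k⟩ ⟨φ, a, hφ, hz, hk⟩
    refine mem_iUnion.2 ⟨a, mem_prod.2 ⟨mem_iUnion₂.2 ⟨φ, ?_, hz⟩, hk⟩⟩
    obtain ⟨c, hP, h0, h1, hT⟩ := hφ
    -- A transport belongs to its own class by the constant homotopy.
    exact ⟨hT.1, ν, hν, c, hP, h0, h1, φ, hT, fun z => φ z.1, φ.contMDiff.comp contMDiff_fst,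
      fun _ => rfl, fun _ => rfl, fun y _ => F.mem_leaf _⟩
  · intro z hz
    obtain ⟨a, hz⟩ := mem_iUnion.1 hz
    obtain ⟨hz1, hz2⟩ := mem_prod.1 hz
    -- An arbitrary element of the class may come from another complement and path. It differs from
    -- a transport by a leafwise homotopy, which keeps the image point in its leaf.
    obtain ⟨f, ⟨-, ν', -, c, hP, h0, h1, φ, hT, K, -, hK0, hK1, hK⟩, y, hy, hyz⟩ :=
      mem_iUnion₂.1 hz1
    have e1 := hF.mk_mem_leaf_conjFoliation g hy
    have e2 := hF.transport_mem_leaf_conjFoliation ⟨c, hP, h0, h1, hT⟩ y g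
    have e3 : z.1 ∈ F.leaf (φ y) := by
      rw [← hyz, ← hK0, ← hK1]
      exact hK y 1
    have e4 := hF.mk_mem_leaf_conjFoliation (a⁻¹ * g * a) e3
    rw [hF.conjFoliation.leaf_eq e2, hF.conjFoliation.leaf_eq e1] at e4
    convert! e4 using 1
    exact Prod.ext rfl hz2

end SmoothFoliation

end ConjugationFoliation

/-! ### Derivatives of conjugations. -/

section ConjugationDerivatives

variable {p q : ℕ}
  {M : Type*} [TopologicalSpace M] [ChartedSpace (EuclideanSpace ℝ (Fin (p + q))) M]
  {G : Type*} [TopologicalSpace G] [ChartedSpace (EuclideanSpace ℝ (Fin q)) G] [Group G]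
  [LieGroup (𝓡 q) ∞ G]

lemma mdifferentiable_conj (a : G) :
    MDifferentiable (𝓡 q) (𝓡 q) (fun h : G => a * h * a⁻¹) := by
  have h : ContMDiff (𝓡 q) (𝓡 q) ∞ (fun h : G => a * h * a⁻¹) :=
    (contMDiff_const.mul contMDiff_id).mul contMDiff_const
  exact h.mdifferentiable (by simp)

lemma mdifferentiable_orbit_conj (g : G) :
    MDifferentiable (𝓡 q) (𝓡 q) (fun h : G => h * g * h⁻¹) := by
  have h : ContMDiff (𝓡 q) (𝓡 q) ∞ (fun h : G => h * g * h⁻¹) :=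
    (contMDiff_id.mul contMDiff_const).mul contMDiff_id.inv
  exact h.mdifferentiable (by simp)

lemma mfderiv_conj_injective (a g : G) :
    Function.Injective (mfderiv (𝓡 q) (𝓡 q) (fun h : G => a * h * a⁻¹) g) := by
  have h2 : (fun h : G => a⁻¹ * h * a⁻¹⁻¹) ∘ (fun h => a * h * a⁻¹) = id := by
    ext h
    simp [mul_assoc]
  have h3 := mfderiv_comp g (mdifferentiable_conj (q := q) a⁻¹ (a * g * a⁻¹)) (mdifferentiable_conj (q := q) a g)
  rw [h2, mfderiv_id] at h3
  intro v w h
  have h4 : ∀ v : EuclideanSpace ℝ (Fin q), mfderiv (𝓡 q) (𝓡 q) (fun h : G => a⁻¹ * h * a⁻¹⁻¹)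
      (a * g * a⁻¹) (mfderiv (𝓡 q) (𝓡 q) (fun h : G => a * h * a⁻¹) g v) = v :=
    fun v => (DFunLike.congr_fun h3 v).symm
  exact (h4 v).symm.trans ((congrArg _ h).trans (h4 w))

lemma mfderiv_conjAlong_apply {f : M → G} {z : M × G}
    (hf : ContMDiffAt (𝓡 (p + q)) (𝓡 q) ∞ f z.1) (v : TangentSpace (𝓡 (p + q)) z.1)
    (w : TangentSpace (𝓡 q) z.2) :
    mfderiv ((𝓡 (p + q)).prod (𝓡 q)) (𝓡 q) (conjAlong f) z (SmoothFoliation.pairVector z v w) =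
      (mfderiv (𝓡 q) (𝓡 q) (fun h => h * z.2 * h⁻¹) (f z.1) (mfderiv (𝓡 (p + q)) (𝓡 q) f z.1 v) +
      mfderiv (𝓡 q) (𝓡 q) (fun h => f z.1 * h * (f z.1)⁻¹) z.2 w :
        TangentSpace (𝓡 q) (conjAlong f z)) := by
  have h1 := mfderiv_prod_eq_add_apply (v := SmoothFoliation.pairVector z v w) ((contMDiffAt_conjAlong hf).mdifferentiableAt (by simp))
  refine h1.trans ?_
  congr 1
  exact mfderiv_comp_apply z.1 (mdifferentiable_orbit_conj (q := q) z.2 (f z.1))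
    (hf.mdifferentiableAt (by simp)) v

/-- The derivative at the identity of `h ↦ h * g * h⁻¹`. -/
lemma mfderiv_orbit_conj_one (g : G) (X : GroupLieAlgebra (𝓡 q) G) :
    (mfderiv (𝓡 q) (𝓡 q) (fun h : G => h * g * h⁻¹) 1 X : EuclideanSpace ℝ (Fin q)) =
      - (mulInvariantVectorField (X - groupAd g⁻¹ X) g : TangentSpace (𝓡 q) g) := by
  have hmul : MDifferentiableAt ((𝓡 q).prod (𝓡 q)) (𝓡 q) (fun z : G × G => z.1 * z.2) (g, 1) :=
    (contMDiff_mul (𝓡 q) ∞).contMDiffAt.mdifferentiableAt (by simp)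
  have hid : MDifferentiableAt (𝓡 q) (𝓡 q) (fun h : G => h) 1 := mdifferentiableAt_id
  have hτ := mdifferentiable_orbit_conj (q := q) g 1
  let T : EuclideanSpace ℝ (Fin q) := mfderiv (𝓡 q) (𝓡 q) (fun h : G => h * g * h⁻¹) 1 X
  let R : EuclideanSpace ℝ (Fin q) := mfderiv (𝓡 q) (𝓡 q) (fun h : G => h * g) 1 X
  let A : EuclideanSpace ℝ (Fin q) := mulInvariantVectorField (I := 𝓡 q) X g
  let B : EuclideanSpace ℝ (Fin q) := mulInvariantVectorField (I := 𝓡 q) (groupAd g⁻¹ X) g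
  -- Differentiate `h * g = (h * g * h⁻¹) * h` at the identity.
  have h1 : R = T + A := by
    have e1 : (fun h : G => h * g) =
        (fun z : G × G => z.1 * z.2) ∘ fun h : G => (h * g * h⁻¹, h) := by
      ext h
      simp
    have e2 : R = mfderiv ((𝓡 q).prod (𝓡 q)) (𝓡 q) (fun z : G × G => z.1 * z.2) (g, 1)
        ((T, X) : EuclideanSpace ℝ (Fin q) × EuclideanSpace ℝ (Fin q)) := by
      have e3 := mfderiv_comp_apply_of_eq (1 : G) hmul (hτ.prodMk hid) (by simp) X
      have e4 := congrArg (fun f : G → G =>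
        (mfderiv (𝓡 q) (𝓡 q) f 1 X : EuclideanSpace ℝ (Fin q))) e1
      refine e4.trans (e3.trans ?_)
      rw [hτ.mfderiv_prod hid]
      exact congrArg (fun Y : EuclideanSpace ℝ (Fin q) =>
        (mfderiv ((𝓡 q).prod (𝓡 q)) (𝓡 q) (fun z : G × G => z.1 * z.2) (g, 1)
          ((T, Y) : EuclideanSpace ℝ (Fin q) × EuclideanSpace ℝ (Fin q)) :
          EuclideanSpace ℝ (Fin q))) (DFunLike.congr_fun (mfderiv_id (I := 𝓡 q) (x := (1 : G))) X)
    have e3 := mfderiv_prod_eq_add_apply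
      (v := ((T, X) : EuclideanSpace ℝ (Fin q) × EuclideanSpace ℝ (Fin q))) hmul
    refine (e2.trans e3).trans (congrArg (· + A) ?_)
    have e4 : (fun z : G => z * 1) = id := by
      ext z
      simp
    have e5 := congrArg (fun f : G → G =>
        (mfderiv (𝓡 q) (𝓡 q) f g T : EuclideanSpace ℝ (Fin q))) e4
    refine e5.trans ?_
    exact DFunLike.congr_fun (mfderiv_id (I := 𝓡 q) (x := g)) T
  -- Differentiate `h * g = g * (g⁻¹ * h * g)` at the identity.
  have h2 : R = B := by
    have e1 : (fun h : G => h * g) = (fun h => g * h) ∘ fun h => g⁻¹ * h * g⁻¹⁻¹ := by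
      ext h
      simp [mul_assoc]
    have e4 := congrArg (fun f : G → G =>
        (mfderiv (𝓡 q) (𝓡 q) f 1 X : EuclideanSpace ℝ (Fin q))) e1
    exact e4.trans (mfderiv_comp_apply_of_eq (1 : G) ((contMDiff_mul_left (I := 𝓡 q)
      (n := ∞)).mdifferentiable (by simp) 1) (mdifferentiable_conj (q := q) g⁻¹ 1) (by simp) X)
  have h3 : (mulInvariantVectorField (I := 𝓡 q) (X - groupAd g⁻¹ X) g : TangentSpace (𝓡 q) g) =
      A - B :=
    map_sub (mfderiv (𝓡 q) (𝓡 q) (fun h : G => g * h) 1) X (groupAd g⁻¹ X)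
  refine Eq.trans ?_ (congrArg (fun v : EuclideanSpace ℝ (Fin q) => -v) h3).symm
  change T = -(A - B)
  rw [← h2, h1]
  abel

/-- The kernel of the derivative of `conjAlong f`, on the vectors whose first component is
transverse. -/
lemma mfderiv_conjAlong_mulInvariantVectorField {f : M → G} {z : M × G}
    (hf : ContMDiffAt (𝓡 (p + q)) (𝓡 q) ∞ f z.1) (X : GroupLieAlgebra (𝓡 q) G)
    {v : TangentSpace (𝓡 (p + q)) z.1}
    (hv : mfderiv (𝓡 (p + q)) (𝓡 q) f z.1 v = mulInvariantVectorField X (f z.1)) :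
    mfderiv ((𝓡 (p + q)).prod (𝓡 q)) (𝓡 q) (conjAlong f) z
      (SmoothFoliation.pairVector z v (mulInvariantVectorField (X - groupAd z.2⁻¹ X) z.2)) = 0 := by
  rw [mfderiv_conjAlong_apply hf, hv]
  have h1 : (mfderiv (𝓡 q) (𝓡 q) (fun h => h * z.2 * h⁻¹) (f z.1)
      (mulInvariantVectorField X (f z.1)) : EuclideanSpace ℝ (Fin q)) =
      mfderiv (𝓡 q) (𝓡 q) (fun h => f z.1 * h * (f z.1)⁻¹) z.2
        (mfderiv (𝓡 q) (𝓡 q) (fun h : G => h * z.2 * h⁻¹) 1 X : EuclideanSpace ℝ (Fin q)) := by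
    -- Conjugation by `f z.1` intertwines the orbit map with left translation, reducing the
    -- derivative at `f z.1` to that at the identity.
    have e1 : (fun h : G => h * z.2 * h⁻¹) ∘ (fun h => f z.1 * h) =
        (fun h => f z.1 * h * (f z.1)⁻¹) ∘ fun h : G => h * z.2 * h⁻¹ := by
      ext h
      simp [mul_assoc]
    have e2 := mfderiv_comp_apply_of_eq (1 : G) (mdifferentiable_orbit_conj (q := q) z.2 (f z.1))
      ((contMDiff_mul_left (I := 𝓡 q) (n := ∞)).mdifferentiable (by simp) 1) (mul_one _) X
    have e3 := mfderiv_comp_apply_of_eq (1 : G) (mdifferentiable_conj (q := q) (f z.1) z.2)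
      (mdifferentiable_orbit_conj (q := q) z.2 1) (by simp) X
    rw [e1] at e2
    exact e2.symm.trans e3
  have h2 := congrArg (mfderiv (𝓡 q) (𝓡 q) (fun h => f z.1 * h * (f z.1)⁻¹) z.2)
    (mfderiv_orbit_conj_one z.2 X)
  have h3 := (h1.trans h2).trans
    (map_neg (mfderiv (𝓡 q) (𝓡 q) (fun h => f z.1 * h * (f z.1)⁻¹) z.2) _)
  exact (congrArg (· + (mfderiv (𝓡 q) (𝓡 q) (fun h => f z.1 * h * (f z.1)⁻¹) z.2
    (mulInvariantVectorField (X - groupAd z.2⁻¹ X) z.2) : EuclideanSpace ℝ (Fin q))) h3).trans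
      (neg_add_cancel _)

end ConjugationDerivatives

/-! ### Identification of the tangent distribution with `W`. -/

section TangentDistribution

variable {p q : ℕ}
  {M : Type*} [TopologicalSpace M] [ChartedSpace (EuclideanSpace ℝ (Fin (p + q))) M]
  [IsManifold (𝓡 (p + q)) ∞ M]
  {G : Type*} [TopologicalSpace G] [ChartedSpace (EuclideanSpace ℝ (Fin q)) G] [Group G]
  [LieGroup (𝓡 q) ∞ G]

namespace SmoothFoliation

variable {F : SmoothFoliation (𝓡 (p + q)) M p q G}

omit [IsManifold (𝓡 (p + q)) ∞ M] in
lemma FoliatedChart.mdifferentiableAt_conjAlong (u : FoliatedChart (𝓡 (p + q)) M p q G) {z : M × G}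
    (hz : z.1 ∈ u.dom) :
    MDifferentiableAt ((𝓡 (p + q)).prod (𝓡 q)) (𝓡 q) (conjAlong u.map) z :=
  (contMDiffAt_conjAlong (u.contMDiffAt hz)).mdifferentiableAt (by simp)

omit [IsManifold (𝓡 (p + q)) ∞ M] in
lemma IsLie.mfderiv_conjAlong_eq_zero (hF : F.IsLie) {u v : FoliatedChart (𝓡 (p + q)) M p q G}
    (hu : u ∈ F.cocycle) (hv : v ∈ F.cocycle) {z : M × G} (hzu : z.1 ∈ u.dom) (hzv : z.1 ∈ v.dom)
    {ξ : TangentSpace ((𝓡 (p + q)).prod (𝓡 q)) z}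
    (h : mfderiv ((𝓡 (p + q)).prod (𝓡 q)) (𝓡 q) (conjAlong u.map) z ξ = 0) :
    mfderiv ((𝓡 (p + q)).prod (𝓡 q)) (𝓡 q) (conjAlong v.map) z ξ = 0 := by
  obtain ⟨g, hg⟩ := hF.eventually_conjAlong hu hv hzu hzv
  have h1 : conjAlong v.map =ᶠ[𝓝 z] (fun h => g * h * g⁻¹) ∘ conjAlong u.map := hg
  rw [h1.mfderiv_eq]
  refine (mfderiv_comp_apply z (mdifferentiable_conj (q := q) g _)
    (FoliatedChart.mdifferentiableAt_conjAlong u hzu) ξ).trans ?_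
  rw [h]
  exact map_zero _

/-- Charts of `G` have injective derivatives, and two functions `conjAlong` differ locally by a
conjugation, so the kernel can be read from one of them. -/
lemma IsLie.mem_tangent_conjFoliation_iff (hF : F.IsLie) {u : FoliatedChart (𝓡 (p + q)) M p q G}
    (hu : u ∈ F.cocycle) {z : M × G} (hz : z.1 ∈ u.dom)
    (ξ : TangentSpace ((𝓡 (p + q)).prod (𝓡 q)) z) :
    ξ ∈ hF.conjFoliation.tangent z ↔
      mfderiv ((𝓡 (p + q)).prod (𝓡 q)) (𝓡 q) (conjAlong u.map) z ξ = 0 := by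
  have hG1 : IsManifold (𝓡 q) 1 G := IsManifold.of_le (n := ∞) (by simp)
  constructor
  · intro h
    obtain ⟨w, hw, hzw, hd, hm⟩ := exists_mem_conjCocycle hu hz
    have h1 := h w hw hzw
    have h2 : w.map = chartAt (EuclideanSpace ℝ (Fin q)) (conjAlong u.map z) ∘ conjAlong u.map :=
      funext hm
    have hκ := mdifferentiable_chart (I := 𝓡 q) (conjAlong u.map z)
    rw [h2] at h1
    have h3 := (mfderiv_comp_apply z (hκ.mdifferentiableAt (mem_chart_source _ _))
      (FoliatedChart.mdifferentiableAt_conjAlong u hz) ξ).symm.trans h1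
    exact (hκ.mfderiv_injective (mem_chart_source _ _)) (h3.trans (map_zero _).symm)
  · rintro h w ⟨v, hv, κ, hκ, hd, hm⟩ hzw
    have h1 := hF.mfderiv_conjAlong_eq_zero hu hv hz (hd z hzw).1 h
    have h2 : w.map = κ ∘ conjAlong v.map := funext hm
    rw [h2]
    refine (mfderiv_comp_apply z ((mdifferentiable_of_mem_atlas hκ).mdifferentiableAt (hd z hzw).2)
      (FoliatedChart.mdifferentiableAt_conjAlong v (hd z hzw).1) ξ).trans ?_
    rw [h1]
    exact map_zero _

-- On `{x} × G` the map is a conjugation, whose derivative is injective.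
omit [IsManifold (𝓡 (p + q)) ∞ M] in
lemma eq_zero_of_mfderiv_conjAlong_eq_zero (u : FoliatedChart (𝓡 (p + q)) M p q G) {z : M × G}
    (hz : z.1 ∈ u.dom) {w : TangentSpace (𝓡 q) z.2}
    (h : mfderiv ((𝓡 (p + q)).prod (𝓡 q)) (𝓡 q) (conjAlong u.map) z (pairVector z 0 w) = 0) :
    w = 0 := by
  rw [mfderiv_conjAlong_apply (u.contMDiffAt hz)] at h
  let C : EuclideanSpace ℝ (Fin q) :=
    mfderiv (𝓡 q) (𝓡 q) (fun h => u.map z.1 * h * (u.map z.1)⁻¹) z.2 w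
  have h0 : (mfderiv (𝓡 q) (𝓡 q) (fun h => h * z.2 * h⁻¹) (u.map z.1)
      (mfderiv (𝓡 (p + q)) (𝓡 q) u.map z.1 0) : EuclideanSpace ℝ (Fin q)) = 0 := by
    rw [map_zero]
    exact map_zero _
  have h1 : 0 + C = 0 := (congrArg (· + C) h0).symm.trans h
  refine mfderiv_conj_injective (q := q) (u.map z.1) z.2 ?_
  exact ((zero_add _).symm.trans h1).trans (map_zero _).symm

/-- The tangent distribution of the foliation by orbits. -/
theorem IsLie.tangent_conjFoliation (hF : F.IsLie)
    {ν : ∀ x : M, Submodule ℝ (TangentSpace (𝓡 (p + q)) x)} (hν : F.IsComplement ν) (z : M × G) :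
    hF.conjFoliation.tangent z = F.distW ν z := by
  obtain ⟨u, hu, hz⟩ := F.cover z.1
  have hV : ∀ (X : GroupLieAlgebra (𝓡 q) G) (v : TangentSpace (𝓡 (p + q)) z.1),
      mfderiv (𝓡 (p + q)) (𝓡 q) u.map z.1 v = mulInvariantVectorField X (u.map z.1) →
      pairVector z v (mulInvariantVectorField (X - groupAd z.2⁻¹ X) z.2) ∈
        hF.conjFoliation.tangent z := fun X v h =>
    (hF.mem_tangent_conjFoliation_iff hu hz _).2
      (mfderiv_conjAlong_mulInvariantVectorField (u.contMDiffAt hz) X h)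
  have hT : ∀ v ∈ F.tangent z.1, pairVector z v 0 ∈ hF.conjFoliation.tangent z := by
    intro v hv
    refine (hF.mem_tangent_conjFoliation_iff hu hz _).2 ?_
    rw [mfderiv_conjAlong_apply (u.contMDiffAt hz), (hF.mem_tangent_iff hu hz v).1 hv, map_zero]
    exact (zero_add _).trans (map_zero _)
  refine le_antisymm (fun ξ hξ => ?_) (sup_le (Submodule.span_le.2 ?_) (Submodule.span_le.2 ?_))
  · obtain ⟨v, w, rfl⟩ : ∃ (v : TangentSpace (𝓡 (p + q)) z.1) (w : TangentSpace (𝓡 q) z.2),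
        ξ = pairVector z v w := ⟨ξ.1, ξ.2, rfl⟩
    obtain ⟨v₀, hv₀, t, ht, rfl⟩ := Submodule.mem_sup.1
      ((hν.2 z.1).sup_eq_top.symm ▸ Submodule.mem_top : v ∈ ν z.1 ⊔ F.tangent z.1)
    obtain ⟨X, hX⟩ := (mulInvariantVectorField_bijective (I := 𝓡 q) (u.map z.1)).surjective
      (mfderiv (𝓡 (p + q)) (𝓡 q) u.map z.1 v₀)
    have h1 := hV X v₀ hX.symm
    have h2 := hT t ht
    -- Subtracting the generators of `V` and of `TF'` with the same first component leaves a kernel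
    -- vector tangent to `{x} × G`, which must vanish.
    have h3 : pairVector z 0 (w - mulInvariantVectorField (X - groupAd z.2⁻¹ X) z.2) ∈
        hF.conjFoliation.tangent z := by
      have h4 := (hF.conjFoliation.tangent z).sub_mem ((hF.conjFoliation.tangent z).sub_mem hξ h1) h2
      convert! h4 using 1
      refine Prod.ext ?_ ?_
      · change (0 : EuclideanSpace ℝ (Fin (p + q))) = (show EuclideanSpace ℝ (Fin (p + q)) from v₀) +
          (show EuclideanSpace ℝ (Fin (p + q)) from t) - (show EuclideanSpace ℝ (Fin (p + q)) from v₀)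
          - (show EuclideanSpace ℝ (Fin (p + q)) from t)
        abel
      · exact (sub_zero _).symm
    have h5 : w = mulInvariantVectorField (X - groupAd z.2⁻¹ X) z.2 := sub_eq_zero.1
      (eq_zero_of_mfderiv_conjAlong_eq_zero u hz ((hF.mem_tangent_conjFoliation_iff hu hz _).1 h3))
    have h6 : pairVector z (v₀ + t) w =
        pairVector z v₀ (mulInvariantVectorField (X - groupAd z.2⁻¹ X) z.2) + pairVector z t 0 := by
      rw [← h5]
      exact Prod.ext rfl (add_zero _).symm
    rw [h6]
    refine Submodule.add_mem_sup (Submodule.subset_span ⟨X, v₀, ⟨hv₀, fun v hv hzv => ?_⟩, rfl⟩)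
      (Submodule.subset_span ⟨t, ht, rfl⟩)
    exact hF.mfderiv_eq_mulInvariantVectorField hu hv hz hzv hX.symm
  · rintro _ ⟨X, v, ⟨-, h⟩, rfl⟩
    exact hV X v (h u hu hz)
  · rintro _ ⟨v, hv, rfl⟩
    exact hT v hv

end SmoothFoliation

end TangentDistribution

/-! ### Smooth frames of the tangent distribution. -/

section Frames

variable {p q : ℕ}
  {M : Type*} [TopologicalSpace M] [ChartedSpace (EuclideanSpace ℝ (Fin (p + q))) M]
  [IsManifold (𝓡 (p + q)) ∞ M]
  {G : Type*} [TopologicalSpace G] [ChartedSpace (EuclideanSpace ℝ (Fin q)) G] [Group G]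
  [LieGroup (𝓡 q) ∞ G]

/-- Translation of the first component in a chart `φ`, along the fibres of `conjAlong f`. -/
def conjTranslate {p q : ℕ} {M : Type*} [TopologicalSpace M] {G : Type*} [Group G] (f : M → G)
    (φ : OpenPartialHomeomorph M (EuclideanSpace ℝ (Fin (p + q))))
    (y : EuclideanSpace ℝ (Fin (p + q)) × (M × G)) : M × G :=
  (φ.symm (φ y.2.1 + y.1),
    (f (φ.symm (φ y.2.1 + y.1)))⁻¹ * conjAlong f y.2 * f (φ.symm (φ y.2.1 + y.1)))

omit [ChartedSpace (EuclideanSpace ℝ (Fin (p + q))) M] [IsManifold (𝓡 (p + q)) ∞ M]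
  [TopologicalSpace G] [ChartedSpace (EuclideanSpace ℝ (Fin q)) G] [LieGroup (𝓡 q) ∞ G] in
lemma conjAlong_conjTranslate (f : M → G)
    (φ : OpenPartialHomeomorph M (EuclideanSpace ℝ (Fin (p + q))))
    (y : EuclideanSpace ℝ (Fin (p + q)) × (M × G)) :
    conjAlong f (conjTranslate f φ y) = conjAlong f y.2 := by
  change f (φ.symm (φ y.2.1 + y.1)) * ((f (φ.symm (φ y.2.1 + y.1)))⁻¹ * conjAlong f y.2 *
    f (φ.symm (φ y.2.1 + y.1))) * (f (φ.symm (φ y.2.1 + y.1)))⁻¹ = _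
  group

omit [ChartedSpace (EuclideanSpace ℝ (Fin (p + q))) M] [IsManifold (𝓡 (p + q)) ∞ M]
  [TopologicalSpace G] [ChartedSpace (EuclideanSpace ℝ (Fin q)) G] [LieGroup (𝓡 q) ∞ G] in
lemma conjTranslate_zero (f : M → G)
    (φ : OpenPartialHomeomorph M (EuclideanSpace ℝ (Fin (p + q)))) {z : M × G}
    (hz : z.1 ∈ φ.source) : conjTranslate f φ (0, z) = z := by
  simp only [conjTranslate, add_zero, φ.left_inv hz, conjAlong]
  refine Prod.ext rfl ?_
  change (f z.1)⁻¹ * (f z.1 * z.2 * (f z.1)⁻¹) * f z.1 = z.2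
  group

omit [ChartedSpace (EuclideanSpace ℝ (Fin (p + q))) M] [IsManifold (𝓡 (p + q)) ∞ M]
  [ChartedSpace (EuclideanSpace ℝ (Fin q)) G] [Group G] [LieGroup (𝓡 q) ∞ G] in
lemma isOpen_conjTranslate_dom (φ : OpenPartialHomeomorph M (EuclideanSpace ℝ (Fin (p + q)))) :
    IsOpen {y : EuclideanSpace ℝ (Fin (p + q)) × (M × G) |
      y.2.1 ∈ φ.source ∧ φ y.2.1 + y.1 ∈ φ.target} := by
  have h1 : ContinuousOn (fun y : EuclideanSpace ℝ (Fin (p + q)) × (M × G) => φ y.2.1 + y.1)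
      {y | y.2.1 ∈ φ.source} :=
    (φ.continuousOn.comp (f := fun y : EuclideanSpace ℝ (Fin (p + q)) × (M × G) => y.2.1)
      (by fun_prop) fun y hy => hy).add continuousOn_fst
  exact h1.isOpen_inter_preimage (φ.open_source.preimage (by fun_prop)) φ.open_target

omit [IsManifold (𝓡 (p + q)) ∞ M] in
lemma contMDiffOn_conjTranslate {f : M → G}
    {φ : OpenPartialHomeomorph M (EuclideanSpace ℝ (Fin (p + q)))}
    (hf : ContMDiffOn (𝓡 (p + q)) (𝓡 q) ∞ f φ.source)
    (hφ : ContMDiffOn (𝓡 (p + q)) (𝓡 (p + q)) ∞ φ φ.source)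
    (hφ' : ContMDiffOn (𝓡 (p + q)) (𝓡 (p + q)) ∞ φ.symm φ.target) :
    ContMDiffOn ((𝓡 (p + q)).prod ((𝓡 (p + q)).prod (𝓡 q))) ((𝓡 (p + q)).prod (𝓡 q)) ∞
      (conjTranslate f φ) {y | y.2.1 ∈ φ.source ∧ φ y.2.1 + y.1 ∈ φ.target} := by
  have h1 : ContMDiffOn ((𝓡 (p + q)).prod ((𝓡 (p + q)).prod (𝓡 q))) (𝓡 (p + q)) ∞
      (fun y : EuclideanSpace ℝ (Fin (p + q)) × (M × G) => φ.symm (φ y.2.1 + y.1))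
      {y | y.2.1 ∈ φ.source ∧ φ y.2.1 + y.1 ∈ φ.target} :=
    hφ'.comp ((hφ.comp (contMDiff_fst.comp contMDiff_snd).contMDiffOn fun y hy => hy.1).add
      contMDiffOn_fst) fun y hy => hy.2
  have h2 := hf.comp h1 fun y hy => φ.map_target hy.2
  have h3 : ContMDiffOn ((𝓡 (p + q)).prod ((𝓡 (p + q)).prod (𝓡 q))) (𝓡 q) ∞
      (fun y : EuclideanSpace ℝ (Fin (p + q)) × (M × G) => conjAlong f y.2)
      {y | y.2.1 ∈ φ.source ∧ φ y.2.1 + y.1 ∈ φ.target} := fun y hy =>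
    (ContMDiffAt.comp y (contMDiffAt_conjAlong (hf.contMDiffAt (φ.open_source.mem_nhds hy.1)))
      contMDiffAt_snd).contMDiffWithinAt
  exact h1.prodMk ((h2.inv.mul h3).mul h2)

namespace SmoothFoliation

variable {F : SmoothFoliation (𝓡 (p + q)) M p q G}

/-- A kernel vector with zero first component vanishes, so the kernel embeds in the tangent space of
`M`. -/
lemma finrank_tangent_conjFoliation_le (hF : F.IsLie) (z : M × G) :
    Module.finrank ℝ (hF.conjFoliation.tangent z) ≤ p + q := by
  obtain ⟨u, hu, hz⟩ := F.cover z.1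
  let fst : TangentSpace ((𝓡 (p + q)).prod (𝓡 q)) z →ₗ[ℝ] EuclideanSpace ℝ (Fin (p + q)) :=
    LinearMap.fst ℝ (EuclideanSpace ℝ (Fin (p + q))) (EuclideanSpace ℝ (Fin q))
  have hinj : Function.Injective (fst.comp (hF.conjFoliation.tangent z).subtype) := by
    refine LinearMap.ker_eq_bot.1 (LinearMap.ker_eq_bot'.2 ?_)
    rintro ⟨ξ, hξ⟩ h
    have h1 : ξ = pairVector z 0 ξ.2 := Prod.ext h rfl
    have h2 := (hF.mem_tangent_conjFoliation_iff hu hz ξ).1 hξ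
    rw [h1] at h2
    have h3 := eq_zero_of_mfderiv_conjAlong_eq_zero u hz h2
    exact Subtype.ext (Prod.ext h h3)
  have := LinearMap.finrank_le_finrank_of_injective hinj
  simpa using this

/-- Translations in a chart of `M`, corrected in `G` to preserve `conjAlong`, have velocities in the
kernel. Their first components are the coordinate fields, hence independent, and the dimension bound
shows that they span. -/
theorem IsLie.isSmoothSubbundle_tangent_conjFoliation (hF : F.IsLie) :
    IsSmoothSubbundle (p + q) hF.conjFoliation.tangent := by
  intro z₀
  obtain ⟨u, hu, hz₀⟩ := F.cover z₀.1
  obtain ⟨φ, hzφ, hφu, hφ, hφ', -⟩ := exists_smooth_chart_isConnected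
    (E := EuclideanSpace ℝ (Fin (p + q))) u.isOpen_dom hz₀
  have hf : ContMDiffOn (𝓡 (p + q)) (𝓡 q) ∞ u.map φ.source := fun x hx =>
    (u.contMDiffAt (hφu hx)).contMDiffWithinAt
  have hΛ := contMDiffOn_conjTranslate hf hφ hφ'
  have hW := isOpen_conjTranslate_dom (G := G) φ
  have hmem : ∀ z : M × G, z.1 ∈ φ.source → ((0 : EuclideanSpace ℝ (Fin (p + q))), z) ∈
      {y : EuclideanSpace ℝ (Fin (p + q)) × (M × G) |
        y.2.1 ∈ φ.source ∧ φ y.2.1 + y.1 ∈ φ.target} := fun z hz =>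
    ⟨hz, by simpa using φ.map_source hz⟩
  let S : ∀ z : M × G, EuclideanSpace ℝ (Fin (p + q)) →ₗ[ℝ]
      TangentSpace ((𝓡 (p + q)).prod (𝓡 q)) z := fun z =>
    ContinuousLinearMap.toLinearMap
      (mfderiv (𝓡 (p + q)) ((𝓡 (p + q)).prod (𝓡 q)) (fun r => conjTranslate u.map φ (r, z)) 0)
  have hd : ∀ z : M × G, z.1 ∈ φ.source → MDifferentiableAt (𝓡 (p + q))
      ((𝓡 (p + q)).prod (𝓡 q)) (fun r => conjTranslate u.map φ (r, z)) 0 := fun z hz =>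
    (ContMDiffAt.comp (0 : EuclideanSpace ℝ (Fin (p + q))) (hΛ.contMDiffAt (hW.mem_nhds (hmem z hz)))
      (contMDiffAt_id.prodMk contMDiffAt_const)).mdifferentiableAt (by simp)
  have hker : ∀ z : M × G, z.1 ∈ φ.source → ∀ r, S z r ∈ hF.conjFoliation.tangent z := by
    intro z hz r
    refine (hF.mem_tangent_conjFoliation_iff hu (hφu hz) _).2 ?_
    have h1 := mfderiv_comp_apply_of_eq (0 : EuclideanSpace ℝ (Fin (p + q)))
      (FoliatedChart.mdifferentiableAt_conjAlong u (hφu hz)) (hd z hz)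
      (conjTranslate_zero u.map φ hz) r
    have h2 : conjAlong u.map ∘ (fun r => conjTranslate u.map φ (r, z)) =
        fun _ => conjAlong u.map z := funext fun r => conjAlong_conjTranslate u.map φ (r, z)
    rw [h2, mfderiv_const] at h1
    exact h1.symm
  have hinj : ∀ z : M × G, z.1 ∈ φ.source → LinearMap.ker (S z) = ⊥ := by
    intro z hz
    refine LinearMap.ker_eq_bot'.2 fun r hr => ?_
    have hφz : MDifferentiableAt ((𝓡 (p + q)).prod (𝓡 q)) (𝓡 (p + q))
        (fun y : M × G => φ y.1) z :=
      (ContMDiffAt.comp z (f := Prod.fst) (hφ.contMDiffAt (φ.open_source.mem_nhds hz))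
        contMDiffAt_fst).mdifferentiableAt (by simp)
    have h1 := mfderiv_comp_apply_of_eq (0 : EuclideanSpace ℝ (Fin (p + q))) hφz (hd z hz)
      (conjTranslate_zero u.map φ hz) r
    have h2 : (fun y : M × G => φ y.1) ∘ (fun r => conjTranslate u.map φ (r, z)) =ᶠ[𝓝 0]
        fun r => φ z.1 + r := by
      have h3 : ContinuousAt (fun r => φ z.1 + r) 0 := by fun_prop
      filter_upwards [h3 (φ.open_target.mem_nhds (by simpa using φ.map_source hz))] with r hr
      exact φ.right_inv hr
    rw [h2.mfderiv_eq] at h1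
    have h4 : mfderiv (𝓡 (p + q)) (𝓡 (p + q)) (fun r => φ z.1 + r) 0 r = r := by
      rw [mfderiv_eq_fderiv, fderiv_const_add]
      exact DFunLike.congr_fun (fderiv_fun_id (𝕜 := ℝ)) r
    refine h4.symm.trans (h1.trans ?_)
    exact (congrArg (mfderiv ((𝓡 (p + q)).prod (𝓡 q)) (𝓡 (p + q)) (fun y : M × G => φ y.1) z)
      hr).trans (map_zero _)
  refine ⟨Prod.fst ⁻¹' φ.source, φ.open_source.preimage continuous_fst, hzφ,
    fun i z => S z (EuclideanSpace.single i 1), fun i => ?_, fun z hz => ?_⟩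
  · refine ((contMDiffOn_mfderiv_left hW hΛ 0 (EuclideanSpace.single i (1 : ℝ))).mono
      fun z hz => hmem z hz).congr fun z hz => ?_
    exact Bundle.TotalSpace.ext (conjTranslate_zero u.map φ hz).symm HEq.rfl
  · have hli : LinearIndependent ℝ fun i => S z (EuclideanSpace.single i (1 : ℝ)) := by
      have h3 := (EuclideanSpace.basisFun (Fin (p + q)) ℝ).toBasis.linearIndependent.map' (S z)
        (hinj z hz)
      convert! h3 using 2 with i
      simp
    refine ⟨hli, ?_⟩
    have : FiniteDimensional ℝ (TangentSpace ((𝓡 (p + q)).prod (𝓡 q)) z) :=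
      inferInstanceAs (FiniteDimensional ℝ
        (EuclideanSpace ℝ (Fin (p + q)) × EuclideanSpace ℝ (Fin q)))
    refine Submodule.eq_of_le_of_finrank_le (Submodule.span_le.2 ?_) ?_
    · rintro _ ⟨i, rfl⟩
      exact hker z hz _
    · refine (finrank_tangent_conjFoliation_le hF z).trans ?_
      have h1 := finrank_span_eq_card hli
      rw [Fintype.card_fin] at h1
      exact h1.ge

end SmoothFoliation

end Frames

/-! ### Involutivity of kernels. -/

section Involutivity

variable {E : Type*} [NormedAddCommGroup E] [NormedSpace ℝ E]
  {E' : Type*} [NormedAddCommGroup E'] [NormedSpace ℝ E']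

/-- The Lie bracket of two vector fields that a function does not distinguish from zero has the
same property. -/
lemma fderiv_lieBracket_eq_zero {f : E → E'} {Y Z : E → E} {x : E} (hf : ContDiffAt ℝ 2 f x)
    (hY : DifferentiableAt ℝ Y x) (hZ : DifferentiableAt ℝ Z x)
    (hfY : ∀ᶠ y in 𝓝 x, fderiv ℝ f y (Y y) = 0) (hfZ : ∀ᶠ y in 𝓝 x, fderiv ℝ f y (Z y) = 0) :
    fderiv ℝ f x (VectorField.lieBracket ℝ Y Z x) = 0 := by
  have hf' : DifferentiableAt ℝ (fderiv ℝ f) x :=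
    (hf.fderiv_right (m := 1) (by norm_num)).differentiableAt (by norm_num)
  have hsymm : IsSymmSndFDerivAt ℝ f x := hf.isSymmSndFDerivAt (by simp)
  -- Differentiate `Df(V) = 0` in the direction `w`. For `V = Y, Z` the second derivatives then
  -- cancel by symmetry in the difference that forms the bracket.
  have key : ∀ V : E → E, DifferentiableAt ℝ V x → (∀ᶠ y in 𝓝 x, fderiv ℝ f y (V y) = 0) →
      ∀ w, fderiv ℝ (fderiv ℝ f) x w (V x) + fderiv ℝ f x (fderiv ℝ V x w) = 0 := by
    intro V hV hfV w
    have h1 := (hf'.hasFDerivAt.clm_apply hV.hasFDerivAt)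
    have h2 : (fun y => fderiv ℝ f y (V y)) =ᶠ[𝓝 x] fun _ => 0 := hfV
    have h3 := h1.unique ((hasFDerivAt_const (0 : E') x).congr_of_eventuallyEq h2)
    have h4 := DFunLike.congr_fun h3 w
    simpa [add_comm] using h4
  have h1 := key Y hY hfY (Z x)
  have h2 := key Z hZ hfZ (Y x)
  rw [VectorField.lieBracket, map_sub, sub_eq_zero]
  rw [hsymm (Z x) (Y x)] at h1
  exact add_left_cancel (h2.trans h1.symm)

variable {H : Type*} [TopologicalSpace H] {I : ModelWithCorners ℝ E H} [I.Boundaryless]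
  [CompleteSpace E]
  {N : Type*} [TopologicalSpace N] [ChartedSpace H N] [IsManifold I ∞ N]

/-- The bracket is defined by pulling the fields back to a chart, and `f` read in this chart
annihilates the pullbacks, which reduces the claim to the linear case. -/
lemma mfderiv_mlieBracket_eq_zero {f : N → E'} {Y Z : ∀ x : N, TangentSpace I x} {x : N}
    (hf : ContMDiffAt I 𝓘(ℝ, E') ∞ f x)
    (hY : MDifferentiableAt I I.tangent (fun y => (⟨y, Y y⟩ : TangentBundle I N)) x)
    (hZ : MDifferentiableAt I I.tangent (fun y => (⟨y, Z y⟩ : TangentBundle I N)) x)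
    (hfY : ∀ᶠ y in 𝓝 x, mfderiv I 𝓘(ℝ, E') f y (Y y) = 0)
    (hfZ : ∀ᶠ y in 𝓝 x, mfderiv I 𝓘(ℝ, E') f y (Z y) = 0) :
    mfderiv I 𝓘(ℝ, E') f x (VectorField.mlieBracket I Y Z x) = 0 := by
  have : IsManifold I 1 N := IsManifold.of_le (n := ∞) (by simp)
  have : IsManifold I 2 N := IsManifold.of_le (n := ∞) (WithTop.coe_le_coe.2 le_top)
  set φ := extChartAt I x with hφ
  have hx : x ∈ φ.source := mem_extChartAt_source x
  have htgt : ∀ᶠ e in 𝓝 (φ x), e ∈ φ.target := extChartAt_target_mem_nhds x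
  have hsymm : ContinuousAt φ.symm (φ x) := continuousAt_extChartAt_symm x
  have hleft : φ.symm (φ x) = x := φ.left_inv hx
  have hds : ∀ e ∈ φ.target, MDifferentiableAt 𝓘(ℝ, E) I φ.symm e := fun e he =>
    ((contMDiffOn_extChartAt_symm (n := ∞) x).contMDiffAt
      ((isOpen_extChartAt_target x).mem_nhds he)).mdifferentiableAt (by simp)
  have hfd : ∀ᶠ y in 𝓝 x, MDifferentiableAt I 𝓘(ℝ, E') f y := by
    filter_upwards [(contMDiffAt_iff_contMDiffAt_nhds (by simp)).1 (hf.of_le (by simp : (1 : WithTop ℕ∞) ≤ ∞))] with y hy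
    exact hy.mdifferentiableAt (by simp)
  let g : E → E' := f ∘ φ.symm
  have hg : ContDiffAt ℝ ∞ g (φ x) := by
    rw [← contMDiffAt_iff_contDiffAt]
    refine ContMDiffAt.comp _ (by rwa [hleft]) ((contMDiffOn_extChartAt_symm (n := ∞) x).contMDiffAt
      (extChartAt_target_mem_nhds x))
  have hgd : ∀ᶠ e in 𝓝 (φ x), fderiv ℝ g e =
      (mfderiv I 𝓘(ℝ, E') f (φ.symm e)).comp (mfderiv 𝓘(ℝ, E) I φ.symm e) := by
    have h1 := hsymm.eventually (p := fun y => MDifferentiableAt I 𝓘(ℝ, E') f y) (by rwa [hleft])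
    filter_upwards [h1, htgt] with e h1 h2
    rw [← mfderiv_eq_fderiv]
    exact mfderiv_comp e h1 (hds e h2)
  have key : ∀ V : (∀ x : N, TangentSpace I x),
      (∀ᶠ y in 𝓝 x, mfderiv I 𝓘(ℝ, E') f y (V y) = 0) →
      ∀ᶠ e in 𝓝 (φ x), fderiv ℝ g e
        (VectorField.mpullbackWithin 𝓘(ℝ, E) I φ.symm V (range I) e) = 0 := by
    intro V hV
    have h1 := hsymm.eventually (p := fun y => mfderiv I 𝓘(ℝ, E') f y (V y) = 0) (by rwa [hleft])
    filter_upwards [hgd, h1, htgt] with e h2 h3 h4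
    rw [h2, VectorField.mpullbackWithin_apply]
    have h5 := isInvertible_mfderivWithin_extChartAt_symm (I := I) h4
    rw [I.range_eq_univ, mfderivWithin_univ] at h5 ⊢
    have h6 := DFunLike.congr_fun h5.self_comp_inverse (V (φ.symm e))
    exact (congrArg (mfderiv I 𝓘(ℝ, E') f (φ.symm e)) h6).trans h3
  have hdiff : ∀ V : (∀ x : N, TangentSpace I x),
      MDifferentiableAt I I.tangent (fun y => (⟨y, V y⟩ : TangentBundle I N)) x →
      DifferentiableAt ℝ (VectorField.mpullbackWithin 𝓘(ℝ, E) I φ.symm V (range I)) (φ x) := by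
    intro V hV
    have h1 : DifferentiableWithinAt ℝ
        (VectorField.mpullbackWithin 𝓘(ℝ, E) I φ.symm V (range I)) univ (φ x) := by
      have h2 := (hV.mdifferentiableWithinAt
        (s := univ)).differentiableWithinAt_mpullbackWithin_vectorField
      rw [preimage_univ, univ_inter, I.range_eq_univ] at h2
      rw [I.range_eq_univ]
      exact h2
    exact differentiableWithinAt_univ.1 h1
  have h0 := fderiv_lieBracket_eq_zero (hg.of_le (WithTop.coe_le_coe.2 le_top)) (hdiff Y hY) (hdiff Z hZ) (key Y hfY)
    (key Z hfZ)
  rw [VectorField.mlieBracket, VectorField.mlieBracketWithin_apply, preimage_univ, univ_inter]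
  have hfg : f =ᶠ[𝓝 x] g ∘ φ := by
    filter_upwards [extChartAt_source_mem_nhds (I := I) x] with y hy
    exact congrArg f (φ.left_inv hy).symm
  rw [hfg.mfderiv_eq]
  have hinv := isInvertible_mfderiv_extChartAt (I := I) hx
  refine (mfderiv_comp_apply x (hg.differentiableAt (by simp)).mdifferentiableAt
    (mdifferentiableAt_extChartAt (mem_chart_source H x)) _).trans ?_
  rw [mfderiv_eq_fderiv]
  refine (congrArg (fderiv ℝ g (φ x)) (DFunLike.congr_fun hinv.self_comp_inverse _)).trans ?_
  have h1 : (VectorField.lieBracketWithin ℝ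
      (VectorField.mpullbackWithin 𝓘(ℝ, E) I φ.symm Y (range I))
      (VectorField.mpullbackWithin 𝓘(ℝ, E) I φ.symm Z (range I)) (range I) (φ x) : E) =
      VectorField.lieBracket ℝ
        (VectorField.mpullbackWithin 𝓘(ℝ, E) I φ.symm Y (range I))
        (VectorField.mpullbackWithin 𝓘(ℝ, E) I φ.symm Z (range I)) (φ x) := by
    rw [I.range_eq_univ]
    exact congrFun VectorField.lieBracketWithin_univ (φ x)
  exact (congrArg (fderiv ℝ g (φ x)) h1).trans h0

/-- The tangent distribution of a foliation is involutive. -/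
theorem SmoothFoliation.isInvolutive_tangent {p q : ℕ}
    (F : SmoothFoliation I N p q (EuclideanSpace ℝ (Fin q))) : IsInvolutive F.tangent := by
  intro O hO Y Z hY hZ hYt hZt y hy u hu hyu
  have hev : ∀ᶠ z in 𝓝 y, z ∈ O ∩ u.dom := (hO.inter u.isOpen_dom).mem_nhds ⟨hy, hyu⟩
  refine mfderiv_mlieBracket_eq_zero (u.contMDiffAt hyu)
    ((hY.contMDiffAt (hO.mem_nhds hy)).mdifferentiableAt (by simp))
    ((hZ.contMDiffAt (hO.mem_nhds hy)).mdifferentiableAt (by simp)) ?_ ?_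
  · filter_upwards [hev] with z hz
    exact hYt z hz.1 u hu hz.2
  · filter_upwards [hev] with z hz
    exact hZt z hz.1 u hu hz.2

end Involutivity

theorem propositionp {p q : ℕ}
    {M : Type*} [TopologicalSpace M] [T2Space M] [CompactSpace M]
    [ChartedSpace (EuclideanSpace ℝ (Fin (p + q))) M] [IsManifold (𝓡 (p + q)) ∞ M]
    {G : Type*} [TopologicalSpace G] [ChartedSpace (EuclideanSpace ℝ (Fin q)) G] [Group G]
    [LieGroup (𝓡 q) ∞ G] [SimplyConnectedSpace G]
    (F : SmoothFoliation (𝓡 (p + q)) M p q G) (hF : F.IsLie) :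
    ∃ 𝒢 : SmoothFoliation ((𝓡 (p + q)).prod (𝓡 q)) (M × G) (p + q) q (EuclideanSpace ℝ (Fin q)),
      (∀ (x : M) (g : G), 𝒢.leaf (x, g) = F.orbitSet x g) ∧
      ∀ ν : (∀ x : M, Submodule ℝ (TangentSpace (𝓡 (p + q)) x)), F.IsComplement ν →
        IsSmoothSubbundle (p + q) (F.distW ν) ∧
        IsInvolutive (F.distW ν) ∧
        ∀ z : M × G, 𝒢.tangent z = F.distW ν z := by
  -- Every complement gives the same distribution, namely the tangent one of the foliation, so its
  -- properties need no further argument.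
  have htan : ∀ ν : (∀ x : M, Submodule ℝ (TangentSpace (𝓡 (p + q)) x)), F.IsComplement ν →
      F.distW ν = hF.conjFoliation.tangent := fun ν hν =>
    funext fun z => (hF.tangent_conjFoliation hν z).symm
  refine ⟨hF.conjFoliation, hF.leaf_conjFoliation, fun ν hν => ⟨?_, ?_, fun z => ?_⟩⟩
  · rw [htan ν hν]
    exact hF.isSmoothSubbundle_tangent_conjFoliation
  · rw [htan ν hν]
    exact hF.conjFoliation.isInvolutive_tangent
  · rw [htan ν hν]
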